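/- Let $k,m,n$ be positive integers with $k\le n-m$. Let $\mathfrak M_{p,q}$ be the space of real $p\times q$ matrices with Lebesgue measure, $x'$ the transpose of $x$, and $|x|_m=\det(x'x)^{1/2}$. Let $\mathcal P_m$ be the cone of positive definite symmetric $m\times m$ matrices; for symmetric $A,B$ write $A<B$ if $B-A\in\mathcal P_m$; put $|a|=\det a$ and $d_*a=|a|^{-(m+1)/2}\prod_{i\le j}da_{i,j}$ on $\mathcal P_m$. Let $V_{n,n-k}=\{\xi\in\mathfrak M_{n,n-k}:\xi'\xi=I_{n-k}\}$ with its $O(n)$-invariant probability measure $d_*\xi$, let $\sigma_{n,m}=2^m\pi^{nm/2}/\Gamma_m(n/2)$ with $\Gamma_m(\alpha)=\int_{\mathcal P_m}e^{-\mathrm{tr}\,r}|r|^{\alpha}\,d_*r$, and let $(\tilde{\mathcal F}w)(y)=\int_{\mathfrak M_{n-k,m}}e^{i\,\mathrm{tr}(y'x)}w(x)\,dx$. A function $w:\mathfrak M_{n-k,m}\to\mathbb C$ is radial if $w(z)=w_0(z'z)$ for some function $w_0$. It is an admissible wavelet if (i) $w$ is radial and integrable; (ii) $(\tilde{\mathcal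 F}w)(y)=u_0(y'y)$, where $u_0(s^{1/2}rs^{1/2})=u_0(r^{1/2}sr^{1/2})$ for all $r,s\in\mathcal P_m$; (iii) with $$c_w(A,B)=\frac{2^{m(k+1)}\pi^{km}}{\sigma_{n,m}}\int_{\{\zeta\in\mathfrak M_{n-k,m}:\,A<\zeta'\zeta<B\}}\frac{(\tilde{\mathcal F}w)(\zeta)}{|\zeta|_m^n}\,d\zeta,\qquad A,B\in\mathcal P_m,$$ the limit $c_w=\lim_{A\to0,\,B\to\infty}c_w(A,B)$ exists and is finite (where $B\to\infty$ means that eventually $B>\lambda I_m$ for every real $\lambda$), and $\sup\{|c_w(\varepsilon r,\rho r)|: r\in\mathcal P_m,\ 0<\varepsilon<\rho<\infty\}<\infty$. (Both hold if the integral of $(\tilde{\mathcal F}w)(\zeta)/|\zeta|_m^n$ over $\mathfrak M_{n-k,m}$ converges absolutely.) Let $u,v$ be integrable radial functions on $\mathfrak M_{n-k,m}$ whose convolution $u*v$ is an admissible wavelet. For $a\in\mathcal P_m$ put $u_a(z)=|a|^{(k-n)/2}u(za^{-1/2})$, $v_a(z)=|a|^{(k-n)/2}v(za^{-1/2})$,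 and $$(U_af)(\xi,t)=\int_{\mathfrak M_{n,m}}f(x)\,u_a(t-\xi'x)\,dx,\qquad (V_a^*\varphi)(x)=\int_{V_{n,n-k}}d_*\xi\int_{\mathfrak M_{n-k,m}}\varphi(\xi,t)\,v_a(\xi'x-t)\,dt.$$ Then the finite limit $$c_{u,v}=\lim_{A\to0,\,B\to\infty}\frac{2^{m(k+1)}\pi^{km}}{\sigma_{n,m}}\int_{\{\zeta\in\mathfrak M_{n-k,m}:\,A<\zeta'\zeta<B\}}\frac{(\tilde{\mathcal F}u)(\zeta)\,(\tilde{\mathcal F}v)(\zeta)}{|\zeta|_m^n}\,d\zeta$$ exists, and for every $f\in L^1(\mathfrak M_{n,m})\cap L^2(\mathfrak M_{n,m})$ the truncated integrals $$I_{\varepsilon,\rho}f(x)=\int_{\varepsilon I_m<a<\rho I_m}\frac{(V_a^*U_af)(x)}{|a|^{k/2}}\,d_*a,\qquad 0<\varepsilon<\rho<\infty,$$ converge absolutely (as integrals in $a$) for almost every $x$, belong to $L^2(\mathfrak M_{n,m})$, and satisfy $I_{\varepsilon,\rho}f\to c_{u,v}f$ in $L^2(\mathfrak M_{n,m})$ as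 $\varepsilon\to0$, $\rho\to\infty$. -/

import Mathlib

open MeasureTheory Filter Topology

namespace MatrixRidgelet

/-- `Mat n m`: real matrices with `n` rows and `m` columns. -/
abbrev Mat (n m : ℕ) := Matrix (Fin n) (Fin m) ℝ

/-- Lebesgue measure `∏ dx_{i,j}` on the space of matrices. -/
noncomputable instance instMeasureSpaceMat (n m : ℕ) : MeasureSpace (Mat n m) :=
  inferInstanceAs (MeasureSpace (Fin n → Fin m → ℝ))

instance instBorelSpaceMat (n m : ℕ) : BorelSpace (Mat n m) :=
  inferInstanceAs (BorelSpace (Fin n → Fin m → ℝ))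

/-! ### The cone of positive definite matrices -/

/-- The cone of positive definite symmetric `m × m` matrices. -/
def posCone (m : ℕ) : Set (Mat m m) := {r | r.PosDef}

/-- The order interval `{s : s - a` and `b - s` positive definite `}`. -/
def coneInterval {m : ℕ} (a b : Mat m m) : Set (Mat m m) :=
  {s | (s - a).PosDef ∧ (b - s).PosDef}

/-- The symmetric matrix with prescribed entries on and above the diagonal. -/
def symOfCoords {m : ℕ} (c : {p : Fin m × Fin m // p.1 ≤ p.2} → ℝ) : Mat m m :=
  Matrix.of fun i j => c ⟨(min i j, max i j), min_le_max⟩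

/-- The measure `dr = ∏_{i ≤ j} dr_{i,j}` on the cone, as a measure on `m × m` matrices. -/
noncomputable def coneMeasure (m : ℕ) : Measure (Mat m m) :=
  (Measure.map symOfCoords volume).restrict (posCone m)

/-- The invariant measure `d_* r = |r|^{-d} dr`, `d = (m + 1) / 2`, on the cone. -/
noncomputable def coneInvMeasure (m : ℕ) : Measure (Mat m m) :=
  (coneMeasure m).withDensity fun r => ENNReal.ofReal (r.det ^ (-(((m : ℝ) + 1) / 2)))

open scoped MatrixOrder in
/-- The positive semidefinite square root `a^{1/2}` of a positive semidefinite matrix. -/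
noncomputable def matSqrt {m : ℕ} (a : Mat m m) : Mat m m := CFC.sqrt a

/-- A function on the cone is symmetric if
`w₀ (s^{1/2} r s^{1/2}) = w₀ (r^{1/2} s r^{1/2})` for all positive definite `r`, `s`. -/
def IsSymmetricOnCone {m : ℕ} (w₀ : Mat m m → ℂ) : Prop :=
  ∀ r s : Mat m m, r.PosDef → s.PosDef →
    w₀ (matSqrt s * r * matSqrt s) = w₀ (matSqrt r * s * matSqrt r)

/-- `A → 0` within the cone. -/
def coneZero (m : ℕ) : Filter (Mat m m) := 𝓝[posCone m] 0

/-- `B → ∞` within the cone: eventually `B > c I` for every real `c`. -/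
def coneInfty (m : ℕ) : Filter (Mat m m) :=
  ⨅ c : ℝ, 𝓟 {B : Mat m m | B.PosDef ∧ (B - c • (1 : Mat m m)).PosDef}

/-- The Siegel gamma function `Γ_m` (for a real argument). -/
noncomputable def siegelGamma (m : ℕ) (α : ℝ) : ℝ :=
  ∫ r : Mat m m, Real.exp (-r.trace) * r.det ^ (α - ((m : ℝ) + 1) / 2) ∂(coneMeasure m)

/-- The total mass `σ_{n,m} = 2^m π^{nm/2} / Γ_m(n/2)` of the Stiefel manifold. -/
noncomputable def stiefelMass (n m : ℕ) : ℝ :=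
  2 ^ m * Real.pi ^ ((n : ℝ) * m / 2) / siegelGamma m ((n : ℝ) / 2)

/-- `|x|_m = det(x'x)^{1/2}`. -/
noncomputable def detNorm {n m : ℕ} (x : Mat n m) : ℝ := Real.sqrt (x.transpose * x).det

/-! ### The Stiefel manifold and its invariant probability measure -/

/-- The Stiefel manifold of orthonormal `p`-frames in `ℝⁿ`. -/
abbrev Stiefel (n p : ℕ) := {ξ : Mat n p // ξ.transpose * ξ = 1}

/-- The frame `ξ₀ = [0; I_{n-k}]`. -/
def stiefelBase (n k : ℕ) : Stiefel n (n - k) :=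
  ⟨Matrix.of fun i j => if (i : ℕ) = k + j then 1 else 0, by
    ext a b
    have hlt : k + (a : ℕ) < n := by have := a.2; omega
    rw [Matrix.mul_apply, Finset.sum_eq_single (⟨k + a, hlt⟩ : Fin n)]
    · simp [Matrix.transpose_apply, Matrix.one_apply, Fin.ext_iff]
    · intro i _ hi
      have : (i : ℕ) ≠ k + a := fun h => hi (Fin.ext h)
      simp [Matrix.transpose_apply, this]
    · simp⟩

/-- The orthogonal group `O(n)`. -/
abbrev OrthGroup (n : ℕ) := Matrix.orthogonalGroup (Fin n) ℝ

instance instCompactSpaceOrthGroup (n : ℕ) : CompactSpace (OrthGroup n) := by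
  have hmem : ∀ A : Mat n n, A ∈ Matrix.orthogonalGroup (Fin n) ℝ ↔ A * A.transpose = 1 :=
    fun A => Matrix.mem_orthogonalGroup_iff (Fin n) ℝ
  refine isCompact_iff_compactSpace.mp ?_
  have hK : IsCompact (Set.univ.pi fun _ : Fin n => Set.univ.pi fun _ : Fin n =>
      Set.Icc (-1 : ℝ) 1) :=
    isCompact_univ_pi fun _ => isCompact_univ_pi fun _ => isCompact_Icc
  refine IsCompact.of_isClosed_subset (X := Mat n n) hK ?_ ?_
  · have : ((Matrix.orthogonalGroup (Fin n) ℝ : Set (Mat n n))) =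
        {A : Mat n n | A * A.transpose = 1} := Set.ext hmem
    rw [this]
    exact isClosed_eq (by fun_prop) continuous_const
  · intro A hA i _ j _
    have h1 : (A * A.transpose) i i = 1 := by rw [(hmem A).1 hA]; simp
    rw [Matrix.mul_apply] at h1
    have h2 : A i j * A i j ≤ ∑ l, A i l * A.transpose l i :=
      Finset.single_le_sum (f := fun l => A i l * A.transpose l i)
        (fun l _ => mul_self_nonneg (A i l)) (Finset.mem_univ j)
    exact abs_le.1 ((sq_le_one_iff_abs_le_one _).1 (by nlinarith))

/-- The action of `O(n)` on the base frame, `γ ↦ γ ξ₀`. -/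
def orbitMap (n k : ℕ) (γ : OrthGroup n) : Stiefel n (n - k) :=
  ⟨(γ : Mat n n) * (stiefelBase n k).1, by
    have h : (γ : Mat n n).transpose * (γ : Mat n n) = 1 :=
      (Matrix.mem_orthogonalGroup_iff' (Fin n) ℝ).1 γ.2
    rw [Matrix.transpose_mul, Matrix.mul_assoc, ← Matrix.mul_assoc _ (γ : Mat n n), h,
      Matrix.one_mul, (stiefelBase n k).2]⟩

/-- The `O(n)`-invariant probability measure `d_* ξ` on the Stiefel manifold of orthonormal
`(n-k)`-frames: the image of the Haar probability measure of `O(n)` under `γ ↦ γ ξ₀`. -/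
noncomputable def stiefelMeasure (n k : ℕ) : Measure (Stiefel n (n - k)) :=
  Measure.map (orbitMap n k) (Measure.haarMeasure ⊤)

/-! ### Fourier transform, ridgelet transforms, admissible wavelets -/

/-- The Fourier transform `(F w)(y) = ∫ exp(tr(i y'x)) w(x) dx`. -/
noncomputable def matFourier {p m : ℕ} (w : Mat p m → ℂ) (y : Mat p m) : ℂ :=
  ∫ x : Mat p m, Complex.exp (Complex.I * ((y.transpose * x).trace : ℂ)) * w x

/-- Radial functions: `w(z) = w₀(z'z)`. -/
def IsRadial {p m : ℕ} (w : Mat p m → ℂ) : Prop :=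
  ∃ w₀ : Mat m m → ℂ, ∀ z, w z = w₀ (z.transpose * z)

/-- The convolution `(u ∗ v)(z) = ∫ u(y) v(z - y) dy`. -/
noncomputable def conv {p m : ℕ} (u v : Mat p m → ℂ) : Mat p m → ℂ :=
  convolution u v (ContinuousLinearMap.mul ℂ ℂ) volume

/-- The scaled function `w_a(z) = |a|^{-p/2} w(z a^{-1/2})`. -/
noncomputable def scaled {p m : ℕ} (w : Mat p m → ℂ) (a : Mat m m) (z : Mat p m) : ℂ :=
  ((a.det ^ (-(p : ℝ) / 2) : ℝ) : ℂ) * w (z * (matSqrt a)⁻¹)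

/-- The continuous ridgelet transform `(W_a f)(ξ, t) = ∫ f(x) w_a(t - ξ'x) dx`. -/
noncomputable def ridgelet {n k m : ℕ} (w : Mat (n - k) m → ℂ) (a : Mat m m)
    (f : Mat n m → ℂ) (ξ : Stiefel n (n - k)) (t : Mat (n - k) m) : ℂ :=
  ∫ x : Mat n m, f x * scaled w a (t - ξ.1.transpose * x)

/-- The dual ridgelet transform `(W_a^* φ)(x) = ∫ d_*ξ ∫ φ(ξ, t) w_a(ξ'x - t) dt`. -/
noncomputable def dualRidgelet {n k m : ℕ} (w : Mat (n - k) m → ℂ) (a : Mat m m)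
    (φ : Stiefel n (n - k) → Mat (n - k) m → ℂ) (x : Mat n m) : ℂ :=
  ∫ ξ : Stiefel n (n - k),
    (∫ t : Mat (n - k) m, φ ξ t * scaled w a (ξ.1.transpose * x - t)) ∂(stiefelMeasure n k)

/-- The truncated normalized integral
`2^{m(k+1)} π^{km} / σ_{n,m} · ∫_{A < ζ'ζ < B} g(ζ) / |ζ|_m^n dζ`. -/
noncomputable def truncConst (n k m : ℕ) (g : Mat (n - k) m → ℂ) (A B : Mat m m) : ℂ :=
  ((2 ^ (m * (k + 1)) * Real.pi ^ (k * m) / stiefelMass n m : ℝ) : ℂ) *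
    ∫ ζ in {ζ : Mat (n - k) m | ζ.transpose * ζ ∈ coneInterval A B},
      g ζ / ((detNorm ζ ^ n : ℝ) : ℂ)

/-- The normalized improper integral of `g(ζ) / |ζ|_m^n` over the space of `(n-k) × m` matrices
equals `c`, as a limit of truncated integrals. -/
def HasConeIntegral (n k m : ℕ) (g : Mat (n - k) m → ℂ) (c : ℂ) : Prop :=
  Tendsto (fun AB : Mat m m × Mat m m => truncConst n k m g AB.1 AB.2)
    (coneZero m ×ˢ coneInfty m) (𝓝 c)

/-- Admissible wavelet functions on the space of `(n-k) × m` matrices. -/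
structure IsAdmissible (n k m : ℕ) (w : Mat (n - k) m → ℂ) : Prop where
  radial : IsRadial w
  integrable : Integrable w
  symmetric : ∃ u₀ : Mat m m → ℂ, IsSymmetricOnCone u₀ ∧
    ∀ y, matFourier w y = u₀ (y.transpose * y)
  /-- The improper integral `c_w` converges. -/
  converges : ∃ c : ℂ, HasConeIntegral n k m (matFourier w) c
  /-- Its truncations over `ε r < ζ'ζ < ρ r` are bounded uniformly in `ε`, `ρ` and `r`. This is
  automatic when the integral converges absolutely. -/
  bounded : ∃ C : ℝ, ∀ r : Mat m m, r.PosDef → ∀ ε ρ : ℝ, 0 < ε → ε < ρ →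
    ‖truncConst n k m (matFourier w) (ε • r) (ρ • r)‖ ≤ C

/-- The integrand `a ↦ (V_a^* U_a f)(x) / |a|^{k/2}`. -/
noncomputable def reproIntegrand {n k m : ℕ} (u v : Mat (n - k) m → ℂ) (f : Mat n m → ℂ)
    (x : Mat n m) (a : Mat m m) : ℂ :=
  dualRidgelet v a (ridgelet u a f) x / ((a.det ^ ((k : ℝ) / 2) : ℝ) : ℂ)

/-- The truncated reproducing integral
`∫_{ε I}^{ρ I} (V_a^* U_a f)(x) |a|^{-k/2} d_* a`. -/
noncomputable def reproTrunc {n k m : ℕ} (u v : Mat (n - k) m → ℂ) (f : Mat n m → ℂ)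
    (ε ρ : ℝ) (x : Mat n m) : ℂ :=
  ∫ a in coneInterval (ε • (1 : Mat m m)) (ρ • (1 : Mat m m)),
    reproIntegrand u v f x a ∂(coneInvMeasure m)

end MatrixRidgelet

open scoped ENNReal

namespace MatrixRidgelet

/-! ### Lebesgue measure on matrix spaces -/

section Lebesgue

variable {n m p : ℕ}

/-! The truncated operator `f ↦ ∫ V_a^* U_a f |a|^{-k/2} d_*a` is a Fourier multiplier, and its
symbol at `Y` is the truncated constant `c(ε r, ρ r)` itself, with `r = Y'Y` up to a factor `(2π)²`.
Admissibility says that these symbols are uniformly bounded and tend to `c` for every positive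
definite `r`, hence for almost every `Y`. Plancherel and dominated convergence then give the
theorem.

To find the symbol, fix `a`. For a frame `ξ`, the transform integrates `f` over the fibres of `x ↦
ξ'x`, convolves with `u_a` and then with `v_a`, and evaluates at `ξ'x`. By the projection-slice
principle, pairing with a test function `g` gives, up to normalisation, `∫∫ ĝ(ξη) (û v̂)(η a^{1/2})
f̂(ξη) dη d_*ξ` (`integral_kernelMeasure_eq`). Under `(ξ, η) ↦ Y = ξη` the measure `d_*ξ dη` becomes
`κ |Y|_m^{-k} dY` (`map_stiefel_mul`). So scale `a` contributes the symbol `κ |r|^{-k/2} w(a^{1/2} r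
a^{1/2})`, where `w(ζ'ζ) = û(ζ) v̂(ζ)`. Symmetry of `w` turns the argument into `s = r^{1/2} a
r^{1/2}`. The measure `d_*a` is invariant under `a ↦ s`, the interval `(εI, ρI)` goes to `(εr, ρr)`,
and `|a|^{-k/2} |r|^{-k/2} = |s|^{-k/2}`. Polar coordinates on the `(n-k) × m` matrices identify the
resulting integral with the truncated constant (`truncConst_smul_eq`).

The geometric input is the polar decomposition: the image of Lebesgue measure under `z ↦ z'z` has
density `|r|^{p/2}` against `d_*r`, up to a constant. It follows from the uniqueness of a measure on
the cone invariant under `r ↦ g'rg` (`IsConeInvariant.lintegral_mul_eq`), the constant being fixed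
by a Gaussian integral. Invariance of `d_*r` rests on the Jacobian `(det g)^{m+1}`
(`det_congrCoords`).

The analytic input is an absolute bound. The norms of `u_a` and `v_a` in `L¹` do not depend on `a`,
so all exchanges of integrals are legitimate over a bounded set of `x` and a bounded range of
scales. This shows only that the truncated integral is locally integrable. It is therefore compared,
through smooth compactly supported test functions, with the `L²` function that the multiplier
defines (`exists_matrix_multiplier`). -/

instance instSigmaFiniteVolumeMat : SigmaFinite (volume : Measure (Mat n m)) :=
  inferInstanceAs (SigmaFinite (volume : Measure (Fin n → Fin m → ℝ)))

instance instSecondCountableMat : SecondCountableTopology (Mat n m) :=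
  inferInstanceAs (SecondCountableTopology (Fin n → Fin m → ℝ))

instance instLocallyCompactMat : LocallyCompactSpace (Mat n m) :=
  inferInstanceAs (LocallyCompactSpace (Fin n → Fin m → ℝ))

instance instIsAddHaarVolumeMat : Measure.IsAddHaarMeasure (volume : Measure (Mat n m)) :=
  have : Measure.IsAddHaarMeasure (volume : Measure (Fin n → Fin m → ℝ)) :=
    Measure.pi.isAddHaarMeasure _
  this

/-- Matrices as vectors. -/
def vecEquiv (n m : ℕ) : Mat n m ≃L[ℝ] (Fin n × Fin m → ℝ) where
  toFun z q := z q.1 q.2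
  invFun c := Matrix.of fun i j => c (i, j)
  map_add' _ _ := rfl
  map_smul' _ _ := rfl
  left_inv _ := rfl
  right_inv _ := rfl
  continuous_toFun := continuous_pi fun q => continuous_id.matrix_elem q.1 q.2
  continuous_invFun := continuous_matrix fun i j => continuous_apply (i, j)

/-- Both sides are Haar measures on the same vector space, hence proportional, and both give the
unit cube mass one. -/
theorem volume_preserving_vecEquiv : MeasurePreserving (vecEquiv n m) := by
  refine ⟨(vecEquiv n m).continuous.measurable, ?_⟩
  have h1 : Measure.IsAddHaarMeasure (Measure.map (vecEquiv n m) volume) :=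
    (vecEquiv n m).toContinuousAddEquiv.isAddHaarMeasure_map _
  have h2 := Measure.isAddLeftInvariant_eq_smul (Measure.map (vecEquiv n m) volume) volume
  set c := Measure.addHaarScalarFactor (Measure.map (vecEquiv n m) volume)
    (volume : Measure (Fin n × Fin m → ℝ))
  have h3 : Measure.map (vecEquiv n m) volume (Set.univ.pi fun _ => Set.Icc (0 : ℝ) 1) = 1 := by
    rw [Measure.map_apply (vecEquiv n m).continuous.measurable
      (MeasurableSet.univ_pi fun _ => measurableSet_Icc)]
    have : (vecEquiv n m) ⁻¹' (Set.univ.pi fun _ => Set.Icc (0 : ℝ) 1) =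
        (Set.univ.pi fun _ : Fin n => Set.univ.pi fun _ : Fin m => Set.Icc (0 : ℝ) 1) := by
      ext z
      exact ⟨fun h i _ j _ => h (i, j) trivial, fun h q _ => h q.1 trivial q.2 trivial⟩
    rw [this]
    erw [volume_pi_pi]
    simp_rw [volume_pi_pi]
    simp
  rw [h2] at h3 ⊢
  have h4 : c = 1 := by
    rw [Measure.smul_apply, volume_pi_pi] at h3
    simpa [ENNReal.smul_def] using h3
  rw [h4, one_smul]

theorem volume_preserving_transpose :
    MeasurePreserving (Matrix.transpose : Mat n m → Mat m n) := by
  have h1 := volume_preserving_vecEquiv (n := n) (m := m)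
  have h2 : MeasurePreserving (vecEquiv m n).symm :=
    (volume_preserving_vecEquiv (n := m) (m := n)).symm
      (vecEquiv m n).toHomeomorph.toMeasurableEquiv
  have h3 := volume_measurePreserving_piCongrLeft (fun _ : Fin m × Fin n => ℝ)
    (Equiv.prodComm (Fin n) (Fin m))
  exact h2.comp (h3.comp h1)

/-- Right multiplication by `g` acts on each of the `p` rows separately as the linear map with
matrix `g'`, so the Jacobian is the `p`-th power of the one on `ℝ^m`. -/
theorem map_mul_right_volume (g : Mat m m) (hg : g.det ≠ 0) :
    Measure.map (fun z : Mat p m => z * g) volume =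
      ENNReal.ofReal ((|g.det| ^ p)⁻¹) • volume := by
  have h0 : g.transpose.det ≠ 0 := by rwa [Matrix.det_transpose]
  have h1 := Real.map_matrix_volume_pi_eq_smul_volume_pi h0
  have h2 : Measure.map (fun z : Mat p m => z * g) volume =
     Measure.pi (fun _ : Fin p => Measure.map (Matrix.toLin' g.transpose) volume) := by
    have hs : ∀ _ : Fin p, SigmaFinite (Measure.map (Matrix.toLin' g.transpose)
        (volume : Measure (Fin m → ℝ))) := fun _ => by
      rw [h1]; exact inferInstanceAs (SigmaFinite ((Real.toNNReal _) • volume))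
    rw [← Measure.pi_map_pi (hμ := hs) fun _ =>
      (Matrix.toLin' g.transpose).continuous_of_finiteDimensional.measurable.aemeasurable]
    congr 1
    ext z i j
    simp [Matrix.mul_apply, Matrix.mulVec, dotProduct, mul_comm]
  rw [h2, h1]
  have hs : ∀ _ : Fin p, SigmaFinite (ENNReal.ofReal |(g.transpose.det)⁻¹| •
      (volume : Measure (Fin m → ℝ))) := fun _ =>
    inferInstanceAs (SigmaFinite ((Real.toNNReal _) • volume))
  refine @Measure.pi_eq _ _ _ _ _ hs _ fun s _ => ?_
  simp only [Measure.smul_apply, smul_eq_mul, Finset.prod_mul_distrib, Finset.prod_const,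
    Finset.card_univ, Fintype.card_fin, Matrix.det_transpose]
  rw [← ENNReal.ofReal_pow (abs_nonneg _), abs_inv, inv_pow]
  exact (Measure.smul_apply _ _ _).trans (congrArg _ (volume_pi_pi s))

theorem map_mul_left_volume (g : Mat n n) (hg : g.det ≠ 0) :
    Measure.map (fun z : Mat n m => g * z) volume =
      ENNReal.ofReal ((|g.det| ^ m)⁻¹) • volume := by
  have h0 : g.transpose.det ≠ 0 := by rwa [Matrix.det_transpose]
  have h1 := map_mul_right_volume (p := m) g.transpose h0
  have hT := volume_preserving_transpose (n := n) (m := m)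
  have hT' := volume_preserving_transpose (n := m) (m := n)
  have hc : Measurable fun z : Mat m n => z * g.transpose :=
    (continuous_id.matrix_mul continuous_const).measurable
  have : (fun z : Mat n m => g * z) =
      Matrix.transpose ∘ (fun z : Mat m n => z * g.transpose) ∘ Matrix.transpose := by
    ext1 z; simp
  rw [this, ← Measure.map_map hT'.measurable (hc.comp hT.measurable),
    ← Measure.map_map hc hT.measurable, hT.map_eq, h1, Measure.map_smul, hT'.map_eq,
    Matrix.det_transpose]

theorem lintegral_mul_right (g : Mat m m) (hg : g.det ≠ 0) {F : Mat p m → ℝ≥0∞}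
    (hF : Measurable F) :
    ∫⁻ z : Mat p m, F (z * g) = ENNReal.ofReal ((|g.det| ^ p)⁻¹) * ∫⁻ z, F z := by
  have hc : Measurable fun z : Mat p m => z * g :=
    (continuous_id.matrix_mul continuous_const).measurable
  rw [← lintegral_map hF hc, map_mul_right_volume g hg, lintegral_smul_measure, smul_eq_mul]

theorem abs_det_orthGroup (γ : OrthGroup n) : |(γ : Mat n n).det| = 1 := by
  have h : (γ : Mat n n) * (γ : Mat n n).transpose = 1 :=
    (Matrix.mem_orthogonalGroup_iff (Fin n) ℝ).1 γ.2
  have h2 := congrArg Matrix.det h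
  rw [Matrix.det_mul, Matrix.det_transpose, Matrix.det_one] at h2
  exact abs_eq_abs.2 (mul_self_eq_one_iff.1 h2) |>.trans abs_one

theorem volume_preserving_orthGroup_mul (γ : OrthGroup n) :
    MeasurePreserving (fun z : Mat n m => (γ : Mat n n) * z) := by
  refine ⟨(continuous_const.matrix_mul continuous_id).measurable, ?_⟩
  have h := abs_det_orthGroup γ
  rw [map_mul_left_volume _ (by intro h0; simp [h0] at h), h]
  simp

/-- Almost every `p × m` matrix has full rank when `m ≤ p`. -/
theorem ae_det_gram_ne_zero (hmp : m ≤ p) :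
    ∀ᵐ z : Mat p m, (z.transpose * z).det ≠ 0 := by
  let J : Mat p m := Matrix.of fun i j => if (i : ℕ) = j then 1 else 0
  let top : Mat p m → Mat m m := fun z => z.submatrix (Fin.castLE hmp) id
  have htop : Continuous top := continuous_id.matrix_submatrix _ _
  -- the top block is almost everywhere nonsingular
  suffices h : ∀ᵐ z : Mat p m, (top z).det ≠ 0 by
    filter_upwards [h] with z hz h0
    obtain ⟨v, hv, hv0⟩ := Matrix.exists_mulVec_eq_zero_iff.2 h0
    refine hz (Matrix.exists_mulVec_eq_zero_iff.1 ⟨v, hv, ?_⟩)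
    have h1 : z.mulVec v = 0 := by
      rw [← Matrix.conjTranspose_eq_transpose_of_trivial] at hv0
      exact (Matrix.conjTranspose_mul_self_mulVec_eq_zero z v).1 hv0
    ext i
    exact congrFun h1 (Fin.castLE hmp i)
  have hmeas : MeasurableSet {z : Mat p m | (top z).det = 0} :=
    (isClosed_singleton.preimage htop.matrix_det).measurableSet
  rw [ae_iff]
  simp only [ne_eq, not_not]
  -- Along the line `z + tJ` the top block is `top z + t I`, whose determinant is a characteristic
  -- polynomial in `t` and so has finitely many zeros. Fubini over `t ∈ [0, 1]` and translation
  -- invariance then make the singular set null.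
  have key : ∀ z : Mat p m, volume {t : ℝ | (top (z + t • J)).det = 0} = 0 := by
    intro z
    refine Set.Finite.measure_zero ?_ _
    have h1 : ∀ t : ℝ, top (z + t • J) = top z + t • 1 := by
      intro t; ext i j
      simp [top, J, Matrix.one_apply, Fin.ext_iff]
    let P := (-(top z)).charpoly
    have h2 : {t : ℝ | (top (z + t • J)).det = 0} ⊆ {t | P.IsRoot t} := by
      intro t ht
      simp only [Set.mem_ofPred_eq, h1] at ht
      simp only [Set.mem_ofPred_eq, Polynomial.IsRoot, P, Matrix.eval_charpoly]
      rw [← ht]; congr 1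
      ext i j; simp [Matrix.scalar_apply, Matrix.one_apply, Matrix.diagonal_apply, add_comm]
    exact (Polynomial.finite_setOfPred_isRoot (Matrix.charpoly_monic _).ne_zero).subset h2
  set S := {z : Mat p m | (top z).det = 0}
  have hJ : Measurable fun q : Mat p m × ℝ => q.1 + q.2 • J :=
    (continuous_fst.add (continuous_snd.smul continuous_const)).measurable
  have h3 : ∫⁻ t in Set.Icc (0 : ℝ) 1, volume S = 0 := by
    calc ∫⁻ t in Set.Icc (0 : ℝ) 1, volume S
        = ∫⁻ t in Set.Icc (0 : ℝ) 1, ∫⁻ z : Mat p m, S.indicator 1 (z + t • J) := by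
          refine lintegral_congr fun t => ?_
          rw [lintegral_add_right_eq_self (fun z => S.indicator 1 z), lintegral_indicator_one hmeas]
      _ = ∫⁻ z : Mat p m, ∫⁻ t in Set.Icc (0 : ℝ) 1, S.indicator 1 (z + t • J) := by
          rw [lintegral_lintegral_swap]
          exact ((measurable_one.indicator hmeas).comp (hJ.comp measurable_swap)).aemeasurable
      _ = 0 := by
          refine (lintegral_congr fun z => ?_).trans lintegral_zero
          refine le_antisymm ((setLIntegral_le_lintegral _ _).trans ?_) bot_le
          have : (fun t : ℝ => S.indicator (1 : Mat p m → ℝ≥0∞) (z + t • J)) =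
            Set.indicator {t : ℝ | (top (z + t • J)).det = 0} 1 := by
            ext t; simp only [Set.indicator_apply, S, Set.mem_ofPred_eq, Pi.one_apply]
          rw [this]
          exact (lintegral_indicator_one_le _).trans (key z).le
  simpa using h3

end Lebesgue

/-! ### Positive definite matrices and square roots -/

section Cone

variable {n m p : ℕ}

theorem isClosed_setOf_posSemidef : IsClosed {a : Mat m m | a.PosSemidef} := by
  have : {a : Mat m m | a.PosSemidef} = {a : Mat m m | a.transpose = a} ∩
      ⋂ x : Fin m → ℝ, {a : Mat m m | 0 ≤ dotProduct x (a.mulVec x)} := by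
    ext a
    simp only [Set.mem_ofPred_eq, Matrix.posSemidef_iff_dotProduct_mulVec, Set.mem_inter_iff,
      Set.mem_iInter, star_trivial]
    rfl
  rw [this]
  refine (isClosed_eq continuous_id.matrix_transpose continuous_id).inter
    (isClosed_iInter fun x => isClosed_le continuous_const ?_)
  exact continuous_const.dotProduct (continuous_id.matrix_mulVec continuous_const)

theorem measurableSet_setOf_posDef : MeasurableSet {a : Mat m m | a.PosDef} := by
  have : {a : Mat m m | a.PosDef} = {a : Mat m m | a.PosSemidef} ∩ {a | a.det ≠ 0} := by
    ext a
    exact ⟨fun h => ⟨h.posSemidef, h.det_pos.ne'⟩, fun h => h.1.posDef_iff_det_ne_zero.2 h.2⟩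
  rw [this]
  exact isClosed_setOf_posSemidef.measurableSet.inter
    (isOpen_compl_singleton.preimage continuous_id.matrix_det).measurableSet

theorem measurableSet_posCone : MeasurableSet (posCone m) := measurableSet_setOf_posDef

theorem measurableSet_coneInterval (A B : Mat m m) : MeasurableSet (coneInterval A B) :=
  (measurableSet_setOf_posDef.preimage
      (continuous_id.sub continuous_const : Continuous fun s : Mat m m => s - A).measurable).inter
    (measurableSet_setOf_posDef.preimage
      (continuous_const.sub continuous_id : Continuous fun s : Mat m m => B - s).measurable)

theorem posSemidef_transpose_mul_self (z : Mat p m) : (z.transpose * z).PosSemidef := by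
  rw [← Matrix.conjTranspose_eq_transpose_of_trivial]
  exact Matrix.posSemidef_conjTranspose_mul_self z

theorem posDef_transpose_mul_self {z : Mat p m} (h : (z.transpose * z).det ≠ 0) :
    (z.transpose * z).PosDef :=
  (posSemidef_transpose_mul_self z).posDef_iff_det_ne_zero.2 h

theorem posDef_congr_iff {g r : Mat m m} (hg : g.det ≠ 0) :
    (g.transpose * r * g).PosDef ↔ r.PosDef := by
  have hU : IsUnit g := (Matrix.isUnit_iff_isUnit_det g).2 hg.isUnit
  have := Matrix.IsUnit.posDef_star_left_conjugate_iff (x := r) hU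
  rwa [Matrix.star_eq_conjTranspose, Matrix.conjTranspose_eq_transpose_of_trivial] at this

theorem mem_coneInterval_congr_iff {g r A B : Mat m m} (hg : g.det ≠ 0) :
    g.transpose * r * g ∈ coneInterval (g.transpose * A * g) (g.transpose * B * g) ↔
      r ∈ coneInterval A B := by
  simp only [coneInterval, Set.mem_ofPred_eq, ← Matrix.mul_sub, ← Matrix.sub_mul,
    posDef_congr_iff hg]

theorem posDef_of_mem_coneInterval {A B s : Mat m m} (hA : A.PosSemidef)
    (hs : s ∈ coneInterval A B) : s.PosDef := by
  simpa using hs.1.add_posSemidef hA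

theorem posSemidef_matSqrt (a : Mat m m) : (matSqrt a).PosSemidef := by
  open scoped MatrixOrder in
  exact Matrix.nonneg_iff_posSemidef.1 (CFC.sqrt_nonneg a)

theorem transpose_matSqrt (a : Mat m m) : (matSqrt a).transpose = matSqrt a := by
  have := (posSemidef_matSqrt a).isHermitian
  rwa [Matrix.IsHermitian, Matrix.conjTranspose_eq_transpose_of_trivial] at this

theorem matSqrt_mul_self {a : Mat m m} (ha : a.PosSemidef) : matSqrt a * matSqrt a = a := by
  open scoped MatrixOrder in
  exact CFC.sqrt_mul_sqrt_self a ha.nonneg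

theorem matSqrt_eq {a b : Mat m m} (hb : b.PosSemidef) (h : b * b = a) : matSqrt a = b := by
  open scoped MatrixOrder in
  exact CFC.sqrt_unique h hb.nonneg

theorem det_matSqrt_pos {a : Mat m m} (ha : a.PosDef) : 0 < (matSqrt a).det := by
  refine (posSemidef_matSqrt a).det_nonneg.lt_of_ne' fun h => ha.det_pos.ne' ?_
  rw [← matSqrt_mul_self ha.posSemidef, Matrix.det_mul, h, zero_mul]

theorem det_matSqrt_sq {a : Mat m m} (ha : a.PosDef) : (matSqrt a).det ^ 2 = a.det := by
  conv_rhs => rw [← matSqrt_mul_self ha.posSemidef, Matrix.det_mul]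
  exact pow_two _

theorem isCompact_setOf_abs_le (C : ℝ) : IsCompact {b : Mat n m | ∀ i j, |b i j| ≤ C} := by
  have : IsCompact (Set.univ.pi fun _ : Fin n => Set.univ.pi fun _ : Fin m =>
      Set.Icc (-C) C) := isCompact_univ_pi fun _ => isCompact_univ_pi fun _ => isCompact_Icc
  convert! this using 1
  ext b
  exact ⟨fun h i _ j _ => abs_le.1 (h i j), fun h i j => abs_le.2 (h i trivial j trivial)⟩

theorem sq_entry_le_trace (z : Mat p m) (i : Fin p) (j : Fin m) :
    z i j ^ 2 ≤ (z.transpose * z).trace := by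
  simp only [Matrix.trace, Matrix.diag_apply, Matrix.mul_apply, Matrix.transpose_apply]
  calc z i j ^ 2 = z i j * z i j := pow_two _
    _ ≤ ∑ l, z l j * z l j := Finset.single_le_sum (f := fun l => z l j * z l j)
        (fun l _ => mul_self_nonneg _) (Finset.mem_univ i)
    _ ≤ _ := Finset.single_le_sum (f := fun j => ∑ l, z l j * z l j)
        (fun j _ => Finset.sum_nonneg fun l _ => mul_self_nonneg _) (Finset.mem_univ j)

/-- Square roots of matrices near `a₀` stay in a compact set, and any cluster point is positive
semidefinite with square `a₀`, so uniqueness of the root leaves only one. -/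
theorem continuousOn_matSqrt : ContinuousOn matSqrt {a : Mat m m | a.PosSemidef} := by
  intro a₀ ha₀
  -- An entry `x` of the root of a nearby `a` satisfies `x² ≤ tr a < tr a₀ + 1 ≤ (tr a₀ + 2)²`.
  refine (isCompact_setOf_abs_le (n := m) (m := m) (a₀.trace + 2)).tendsto_nhds_of_unique_mapClusterPt
    ?_ ?_
  · have h1 : ∀ᶠ a : Mat m m in 𝓝 a₀, a.trace < a₀.trace + 1 :=
      (continuous_id.matrix_trace.tendsto a₀).eventually_lt_const (by simp)
    filter_upwards [nhdsWithin_le_nhds h1, self_mem_nhdsWithin] with a ha hpsd i j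
    have h2 := sq_entry_le_trace (matSqrt a) i j
    rw [transpose_matSqrt, matSqrt_mul_self hpsd] at h2
    have h3 : 0 ≤ a₀.trace := ha₀.trace_nonneg
    refine abs_le_of_sq_le_sq' ?_ (by linarith) |> abs_le.2
    nlinarith
  · intro y _ hy
    have hpsd : y.PosSemidef := isClosed_setOf_posSemidef.mem_of_mapClusterPt hy
      (Eventually.of_forall posSemidef_matSqrt)
    have h1 : MapClusterPt (y * y) (𝓝[{a : Mat m m | a.PosSemidef}] a₀)
        (fun a => matSqrt a * matSqrt a) :=
      hy.continuousAt_comp (f := fun b : Mat m m => b * b)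
        (continuous_id.matrix_mul continuous_id).continuousAt
    have h2 : Tendsto (fun a : Mat m m => matSqrt a * matSqrt a)
        (𝓝[{a : Mat m m | a.PosSemidef}] a₀) (𝓝 a₀) := by
      refine (tendsto_id.mono_left nhdsWithin_le_nhds).congr' ?_
      filter_upwards [self_mem_nhdsWithin] with a ha
      exact (matSqrt_mul_self ha).symm
    have h3 : y * y = a₀ := eq_of_nhds_neBot (ClusterPt.mono h1 h2)
    exact (matSqrt_eq hpsd h3).symm

theorem measurable_matSqrt : Measurable (matSqrt : Mat m m → Mat m m) := by
  classical
  -- Off the positive semidefinite matrices `CFC.sqrt` takes the default value `0`, so `matSqrt` is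
  -- a piecewise function with a closed domain of continuity.
  have h := (continuousOn_matSqrt (m := m)).measurable_piecewise
    (g := fun _ => 0) continuousOn_const isClosed_setOf_posSemidef.measurableSet
  convert h using 1
  ext1 a
  by_cases ha : a.PosSemidef
  · exact (Set.piecewise_eq_of_mem {a : Mat m m | a.PosSemidef} _ _ ha).symm
  · refine Eq.trans ?_ (Set.piecewise_eq_of_notMem {a : Mat m m | a.PosSemidef} matSqrt (fun _ => 0) ha).symm
    open scoped MatrixOrder in
    exact CFC.sqrt_of_not_nonneg fun h => ha (Matrix.nonneg_iff_posSemidef.1 h)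

end Cone

/-! ### Invariant measure of the cone -/

section ConeMeasure

variable {n m p : ℕ}

/-- Index set of the entries on and above the diagonal. -/
abbrev UpperIndex (m : ℕ) := {p : Fin m × Fin m // p.1 ≤ p.2}

/-- The action `r ↦ g' r g` on symmetric matrices, in coordinates. -/
def congrCoords (g : Mat m m) : (UpperIndex m → ℝ) →ₗ[ℝ] (UpperIndex m → ℝ) where
  toFun c q := (g.transpose * symOfCoords c * g) q.1.1 q.1.2
  map_add' c d := by
    have : symOfCoords (c + d) = symOfCoords c + symOfCoords d := rfl
    ext q; simp [this, Matrix.mul_add, Matrix.add_mul]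
  map_smul' t c := by
    have : symOfCoords (t • c) = t • symOfCoords c := rfl
    ext q; simp [this]

theorem transpose_symOfCoords (c : UpperIndex m → ℝ) :
    (symOfCoords c).transpose = symOfCoords c := by
  ext i j
  simp only [symOfCoords, Matrix.transpose_apply, Matrix.of_apply]
  congr 3
  · exact min_comm _ _
  · exact max_comm _ _

theorem symOfCoords_restrict {r : Mat m m} (hr : r.transpose = r) :
    symOfCoords (fun q : UpperIndex m => r q.1.1 q.1.2) = r := by
  ext i j
  simp only [symOfCoords, Matrix.of_apply]
  rcases le_total i j with h | h
  · rw [min_eq_left h, max_eq_right h]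
  · rw [min_eq_right h, max_eq_left h]
    exact congrFun (congrFun hr i) j

theorem symOfCoords_congrCoords (g : Mat m m) (c : UpperIndex m → ℝ) :
    symOfCoords (congrCoords g c) = g.transpose * symOfCoords c * g :=
  symOfCoords_restrict (r := g.transpose * symOfCoords c * g) (by
    simp only [Matrix.transpose_mul, transpose_symOfCoords, Matrix.transpose_transpose,
      Matrix.mul_assoc])

theorem congrCoords_mul (g h : Mat m m) :
    congrCoords (g * h) = congrCoords h ∘ₗ congrCoords g := by
  refine LinearMap.ext fun c => funext fun q => ?_
  change ((g * h).transpose * symOfCoords c * (g * h) : Mat m m) q.1.1 q.1.2 =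
    (h.transpose * symOfCoords (congrCoords g c) * h : Mat m m) q.1.1 q.1.2
  rw [symOfCoords_congrCoords, Matrix.transpose_mul]
  simp only [Matrix.mul_assoc]

theorem det_congrCoords_mul (g h : Mat m m) :
    LinearMap.det (congrCoords (g * h)) =
      LinearMap.det (congrCoords g) * LinearMap.det (congrCoords h) := by
  rw [congrCoords_mul, LinearMap.det_comp, mul_comm]

/-- The factor `d i` occurs `m - i` times as a first entry and `i + 1` times as a second one, which
makes `m + 1` in all. -/
theorem prod_upperIndex (d : Fin m → ℝ) :
    ∏ q : UpperIndex m, (d q.1.1 * d q.1.2) = (∏ i, d i) ^ (m + 1) := by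
  have h (f : Fin m × Fin m → ℝ) :
      ∏ q : UpperIndex m, f q.1 = ∏ q : Fin m × Fin m, if q.1 ≤ q.2 then f q else 1 := by
    rw [← Finset.prod_filter]
    exact (Finset.prod_subtype _ (by simp) f).symm
  rw [h fun q => d q.1 * d q.2, ← Finset.prod_pow]
  have h1 : ∀ q : Fin m × Fin m, (if q.1 ≤ q.2 then d q.1 * d q.2 else 1) =
      (if q.1 ≤ q.2 then d q.1 else 1) * (if q.1 ≤ q.2 then d q.2 else 1) := by
    intro q; split_ifs <;> simp
  simp_rw [h1, Finset.prod_mul_distrib]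
  rw [Fintype.prod_prod_type, Fintype.prod_prod_type_right, ← Finset.prod_mul_distrib]
  refine Finset.prod_congr rfl fun i _ => ?_
  simp only
  rw [← Finset.prod_filter, ← Finset.prod_filter, Finset.prod_const, Finset.prod_const, ← pow_add]
  congr 1
  have e1 : (Finset.univ.filter fun j => i ≤ j) = Finset.Ici i := by ext; simp
  have e2 : (Finset.univ.filter fun j => j ≤ i) = Finset.Iic i := by ext; simp
  rw [e1, e2, Fin.card_Ici, Fin.card_Iic]
  omega

theorem det_congrCoords_diagonal (d : Fin m → ℝ) :
    LinearMap.det (congrCoords (Matrix.diagonal d)) = (Matrix.diagonal d).det ^ (m + 1) := by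
  have : congrCoords (Matrix.diagonal d) =
      Matrix.toLin' (Matrix.diagonal fun q : UpperIndex m => d q.1.1 * d q.1.2) := by
    refine LinearMap.ext fun c => funext fun q => ?_
    obtain ⟨⟨i, j⟩, hij⟩ := q
    rw [Matrix.toLin'_apply, Matrix.mulVec_diagonal]
    change ((Matrix.diagonal d).transpose * symOfCoords c * Matrix.diagonal d : Mat m m) i j = _
    rw [Matrix.diagonal_transpose, Matrix.mul_diagonal, Matrix.diagonal_mul]
    simp only [symOfCoords, Matrix.of_apply]
    have e : (⟨(min i j, max i j), min_le_max⟩ : UpperIndex m) = ⟨(i, j), hij⟩ := by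
      simp only [Subtype.mk.injEq, Prod.mk.injEq]
      exact ⟨min_eq_left hij, max_eq_right hij⟩
    rw [e]; ring
  rw [this, LinearMap.det_toLin', Matrix.det_diagonal, Matrix.det_diagonal, prod_upperIndex]

theorem det_congrCoords_transvection {i j : Fin m} (hij : i ≠ j) (c : ℝ) :
    LinearMap.det (congrCoords (Matrix.transvection i j c)) = 1 := by
  -- a transvection is conjugate to its own square
  let D : Mat m m := Matrix.diagonal fun l => if l = i then 2 else 1
  have hD : D * Matrix.transvection i j c =
      Matrix.transvection i j c * Matrix.transvection i j c * D := by
    rw [Matrix.transvection_mul_transvection_same _ _ hij]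
    simp only [D, Matrix.transvection, Matrix.mul_add, Matrix.add_mul, Matrix.mul_one,
      Matrix.one_mul]
    congr 1
    ext a b
    simp only [Matrix.diagonal_mul, Matrix.mul_diagonal, Matrix.single_apply]
    split_ifs with h1 h2 h3 <;> first | (exfalso; grind) | grind
  have hDdet : LinearMap.det (congrCoords D) ≠ 0 := by
    rw [det_congrCoords_diagonal, Matrix.det_diagonal]
    refine pow_ne_zero _ (Finset.prod_ne_zero_iff.2 fun l _ => ?_)
    split_ifs <;> norm_num
  -- The inverse transvection, with parameter `-c`, excludes the root `0`.
  have hT : LinearMap.det (congrCoords (Matrix.transvection i j c)) ≠ 0 := by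
    have h1 := det_congrCoords_mul (Matrix.transvection i j c) (Matrix.transvection i j (-c))
    rw [Matrix.transvection_mul_transvection_same _ _ hij] at h1
    intro h0
    rw [h0, zero_mul, add_neg_cancel, Matrix.transvection_zero] at h1
    have h2 := det_congrCoords_diagonal (fun _ : Fin m => (1 : ℝ))
    rw [Matrix.diagonal_one, h1, Matrix.det_one, one_pow] at h2
    exact zero_ne_one h2
  have h := congrArg (fun g => LinearMap.det (congrCoords g)) hD
  simp only [det_congrCoords_mul] at h
  have h' : LinearMap.det (congrCoords D) * LinearMap.det (congrCoords (Matrix.transvection i j c))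
      * (LinearMap.det (congrCoords (Matrix.transvection i j c)) - 1) = 0 := by linarith
  have := (mul_eq_zero.1 h').resolve_left (mul_ne_zero hDdet hT)
  linarith

/-- Both sides are multiplicative in `g`, so diagonal matrices and transvections suffice. This is
the Jacobian of `r ↦ g'rg` on symmetric matrices. -/
theorem det_congrCoords (g : Mat m m) (hg : g.det ≠ 0) :
    LinearMap.det (congrCoords g) = g.det ^ (m + 1) := by
  refine Matrix.diagonal_transvection_induction_of_det_ne_zero
    (fun g => LinearMap.det (congrCoords g) = g.det ^ (m + 1)) g hg
    (fun d _ => det_congrCoords_diagonal d) (fun t => ?_) fun A B _ _ hA hB => ?_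
  · rw [Matrix.TransvectionStruct.det, one_pow]
    exact det_congrCoords_transvection t.hij t.c
  · rw [det_congrCoords_mul, hA, hB, Matrix.det_mul, mul_pow]

theorem continuous_symOfCoords : Continuous (symOfCoords (m := m)) :=
  continuous_matrix fun _ _ => continuous_apply _

theorem measurable_symOfCoords : Measurable (symOfCoords (m := m)) :=
  continuous_symOfCoords.measurable

theorem lintegral_coneMeasure {F : Mat m m → ℝ≥0∞} (hF : Measurable F) :
    ∫⁻ r, F r ∂(coneMeasure m) =
      ∫⁻ c : UpperIndex m → ℝ, (posCone m).indicator F (symOfCoords c) := by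
  rw [coneMeasure, ← lintegral_indicator measurableSet_posCone,
    lintegral_map (hF.indicator measurableSet_posCone) measurable_symOfCoords]

theorem measurable_congr (g : Mat m m) : Measurable fun r : Mat m m => g.transpose * r * g :=
  ((continuous_const.matrix_mul continuous_id).matrix_mul continuous_const).measurable

theorem lintegral_coneMeasure_congr (g : Mat m m) (hg : g.det ≠ 0) {F : Mat m m → ℝ≥0∞}
    (hF : Measurable F) :
    ∫⁻ r, F (g.transpose * r * g) ∂(coneMeasure m) =
      ENNReal.ofReal ((|g.det| ^ (m + 1))⁻¹) * ∫⁻ r, F r ∂(coneMeasure m) := by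
  have hL : LinearMap.det (congrCoords g) ≠ 0 := by
    rw [det_congrCoords g hg]; exact pow_ne_zero _ hg
  have hm := Real.map_linearMap_volume_pi_eq_smul_volume_pi hL
  have hI := hF.indicator (measurableSet_posCone (m := m))
  have hcL : Measurable (congrCoords g) :=
    (congrCoords g).continuous_of_finiteDimensional.measurable
  rw [lintegral_coneMeasure hF, lintegral_coneMeasure (F := fun r => F (g.transpose * r * g))
    (hF.comp (measurable_congr g)), ← abs_pow, ← abs_inv, ← det_congrCoords g hg,
    ← smul_eq_mul, ← lintegral_smul_measure, ← hm,
    lintegral_map (f := fun c => (posCone m).indicator F (symOfCoords c))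
      (hI.comp measurable_symOfCoords) hcL]
  refine lintegral_congr fun c => ?_
  rw [symOfCoords_congrCoords]
  by_cases h : symOfCoords c ∈ posCone m
  · rw [Set.indicator_of_mem h, Set.indicator_of_mem]
    exact (posDef_congr_iff hg).2 h
  · rw [Set.indicator_of_notMem h, Set.indicator_of_notMem]
    exact fun h' => h ((posDef_congr_iff hg).1 h')

theorem measurable_det : Measurable fun r : Mat m m => r.det :=
  continuous_id.matrix_det.measurable

theorem lintegral_coneInvMeasure {F : Mat m m → ℝ≥0∞} (hF : Measurable F) :
    ∫⁻ r, F r ∂(coneInvMeasure m) =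
      ∫⁻ r, ENNReal.ofReal (r.det ^ (-(((m : ℝ) + 1) / 2))) * F r ∂(coneMeasure m) := by
  rw [coneInvMeasure, lintegral_withDensity_eq_lintegral_mul _ _ hF]
  · rfl
  · exact (measurable_det.pow_const _).ennreal_ofReal

theorem ae_coneMeasure_posDef : ∀ᵐ r ∂(coneMeasure m), r.PosDef :=
  ae_restrict_mem measurableSet_posCone

theorem ae_coneInvMeasure_posDef : ∀ᵐ r ∂(coneInvMeasure m), r.PosDef :=
  (withDensity_absolutelyContinuous _ _).ae_le ae_coneMeasure_posDef

/-- The measure `d_* r` is invariant under `r ↦ g' r g`. -/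
theorem lintegral_coneInvMeasure_congr (g : Mat m m) (hg : g.det ≠ 0) {F : Mat m m → ℝ≥0∞}
    (hF : Measurable F) :
    ∫⁻ r, F (g.transpose * r * g) ∂(coneInvMeasure m) = ∫⁻ r, F r ∂(coneInvMeasure m) := by
  have hd : Measurable fun r : Mat m m => ENNReal.ofReal (r.det ^ (-(((m : ℝ) + 1) / 2))) :=
    (measurable_det.pow_const _).ennreal_ofReal
  have hpos : 0 < |g.det| ^ (m + 1) := pow_pos (abs_pos.2 hg) _
  rw [lintegral_coneInvMeasure hF, lintegral_coneInvMeasure (F := fun r => F (g.transpose * r * g))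
    (hF.comp (measurable_congr g))]
  -- Since `|g'rg| = |det g|² |r|`, the weight of exponent `-(m+1)/2` releases the factor `|det
  -- g|^{m+1}`, which cancels the Jacobian.
  have h1 : ∫⁻ r, ENNReal.ofReal (r.det ^ (-(((m : ℝ) + 1) / 2))) * F (g.transpose * r * g)
        ∂(coneMeasure m) =
      ∫⁻ r, ENNReal.ofReal (|g.det| ^ (m + 1)) *
        (fun s : Mat m m => ENNReal.ofReal (s.det ^ (-(((m : ℝ) + 1) / 2))) * F s)
          (g.transpose * r * g) ∂(coneMeasure m) := by
    refine lintegral_congr_ae ?_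
    filter_upwards [ae_coneMeasure_posDef] with r hr
    rw [← mul_assoc, ← ENNReal.ofReal_mul hpos.le]
    congr 2
    have e1 : (g.transpose * r * g).det = |g.det| ^ (2 : ℝ) * r.det := by
      rw [Matrix.det_mul, Matrix.det_mul, Matrix.det_transpose, Real.rpow_two, sq_abs]; ring
    rw [e1, Real.mul_rpow (by positivity) hr.det_pos.le, ← Real.rpow_mul (abs_nonneg _),
      ← mul_assoc, ← Real.rpow_natCast, ← Real.rpow_add (abs_pos.2 hg)]
    push_cast
    have : ((m : ℝ) + 1) + 2 * (-(((m : ℝ) + 1) / 2)) = 0 := by ring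
    rw [this, Real.rpow_zero, one_mul]
  have hdF : Measurable fun s : Mat m m =>
      ENNReal.ofReal (s.det ^ (-(((m : ℝ) + 1) / 2))) * F s := hd.mul hF
  refine h1.trans ((lintegral_const_mul _ (hdF.comp (measurable_congr g))).trans
    ((congrArg _ (lintegral_coneMeasure_congr g hg hdF)).trans ?_))
  rw [← mul_assoc, ← ENNReal.ofReal_mul hpos.le, mul_inv_cancel₀ hpos.ne', ENNReal.ofReal_one, one_mul]

theorem map_congr_coneInvMeasure (g : Mat m m) (hg : g.det ≠ 0) :
    MeasurePreserving (fun r : Mat m m => g.transpose * r * g)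
      (coneInvMeasure m) (coneInvMeasure m) := by
  refine ⟨measurable_congr g, Measure.ext_of_lintegral _ fun F hF => ?_⟩
  rw [lintegral_map hF (measurable_congr g), lintegral_coneInvMeasure_congr g hg hF]

end ConeMeasure

/-! ### Order intervals of the cone and their invariant measure -/

section Gram

variable {n m p : ℕ}

/-- The cone is open among symmetric matrices: the quadratic form is jointly continuous and positive
on the compact unit sphere, hence stays positive there for nearby matrices, and homogeneity covers
all other vectors. -/
theorem eventually_posDef {a₀ : Mat m m} (h : a₀.PosDef) :
    ∀ᶠ a : Mat m m in 𝓝 a₀, a.transpose = a → a.PosDef := by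
  have hK : IsCompact (Metric.sphere (0 : Fin m → ℝ) 1) := isCompact_sphere _ _
  have hq : Continuous fun q : Mat m m × (Fin m → ℝ) => dotProduct q.2 (q.1.mulVec q.2) :=
    continuous_snd.dotProduct (continuous_fst.matrix_mulVec continuous_snd)
  have h1 := hK.eventually_forall_of_forall_eventually (x₀ := a₀)
    (P := fun a x => 0 < dotProduct x (a.mulVec x)) fun x hx => by
      refine (hq.tendsto (a₀, x)).eventually_const_lt ?_
      have hx0 : x ≠ 0 := by
        rintro rfl
        simp at hx
      simpa using h.dotProduct_mulVec_pos hx0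
  filter_upwards [h1] with a ha hsym
  refine Matrix.PosDef.of_dotProduct_mulVec_pos
    (by rwa [Matrix.IsHermitian, Matrix.conjTranspose_eq_transpose_of_trivial]) fun x hx => ?_
  have hn : 0 < ‖x‖ := norm_pos_iff.2 hx
  have h2 := ha (‖x‖⁻¹ • x) (by simp [norm_smul, hn.ne'])
  rw [Matrix.mulVec_smul, dotProduct_smul, smul_dotProduct, smul_eq_mul, smul_eq_mul,
    ← mul_assoc] at h2
  simpa using (mul_pos_iff_of_pos_left (by positivity)).1 h2

theorem posDef_smul_one {c : ℝ} (hc : 0 < c) : (c • (1 : Mat m m)).PosDef :=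
  Matrix.PosDef.one.smul hc

theorem smul_one_mem_coneInterval {ε t ρ : ℝ} (h1 : ε < t) (h2 : t < ρ) :
    t • (1 : Mat m m) ∈ coneInterval (ε • (1 : Mat m m)) (ρ • (1 : Mat m m)) := by
  constructor
  · rw [← sub_smul]; exact posDef_smul_one (sub_pos.2 h1)
  · rw [← sub_smul]; exact posDef_smul_one (sub_pos.2 h2)

theorem transpose_smul_one (c : ℝ) : (c • (1 : Mat m m)).transpose = c • (1 : Mat m m) := by
  rw [Matrix.transpose_smul, Matrix.transpose_one]

/-- An entry of `a` is the inner product of two rows of `a^{1/2}`, and the squared length of a row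
is at most `tr a ≤ mρ`. -/
theorem abs_entry_le_of_posSemidef {ρ : ℝ} {a : Mat m m} (ha : a.PosSemidef)
    (h : (ρ • (1 : Mat m m) - a).PosSemidef) (i j : Fin m) : |a i j| ≤ m * ρ := by
  have h2 := sq_entry_le_trace (matSqrt a)
  rw [transpose_matSqrt, matSqrt_mul_self ha] at h2
  have htr : a.trace ≤ m * ρ := by
    have := h.trace_nonneg
    rw [Matrix.trace_sub, Matrix.trace_smul, Matrix.trace_one] at this
    simp only [Fintype.card_fin, smul_eq_mul] at this
    linarith
  refine le_trans ?_ htr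
  have e : a i j = ∑ l, matSqrt a i l * matSqrt a l j := by
    conv_lhs => rw [← matSqrt_mul_self ha]
    rw [Matrix.mul_apply]
  have htr2 : a.trace = ∑ i, ∑ l, matSqrt a i l ^ 2 := by
    conv_lhs => rw [← matSqrt_mul_self ha]
    simp only [Matrix.trace, Matrix.diag_apply, Matrix.mul_apply]
    refine Finset.sum_congr rfl fun i _ => Finset.sum_congr rfl fun l _ => ?_
    rw [pow_two]; congr 1
    exact congrFun (congrFun (transpose_matSqrt a) i) l
  have hrow : ∀ i, ∑ l, matSqrt a i l ^ 2 ≤ a.trace := fun i => by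
    rw [htr2]
    exact Finset.single_le_sum (f := fun i => ∑ l, matSqrt a i l ^ 2)
      (fun _ _ => Finset.sum_nonneg fun _ _ => sq_nonneg _) (Finset.mem_univ i)
  have hsym : ∀ l, matSqrt a l j = matSqrt a j l := fun l =>
    congrFun (congrFun (transpose_matSqrt a) j) l
  have hi := hrow i
  have hj := hrow j
  rw [e]
  calc |∑ l, matSqrt a i l * matSqrt a l j| ≤ ∑ l, |matSqrt a i l * matSqrt a l j| :=
        Finset.abs_sum_le_sum_abs _ _
    _ ≤ ∑ l, (matSqrt a i l ^ 2 + matSqrt a j l ^ 2) / 2 := by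
        refine Finset.sum_le_sum fun l _ => ?_
        rw [hsym, abs_mul]
        nlinarith [sq_nonneg (|matSqrt a i l| - |matSqrt a j l|), sq_abs (matSqrt a i l),
          sq_abs (matSqrt a j l)]
    _ ≤ a.trace := by
        rw [← Finset.sum_div, Finset.sum_add_distrib]; linarith

/-- An order interval away from the boundary lies in a compact part of the cone. -/
theorem exists_isCompact_posDef {ε : ℝ} (hε : 0 < ε) (m : ℕ) (ρ : ℝ) :
    ∃ K : Set (Mat m m), IsCompact K ∧ (∀ a ∈ K, a.PosDef) ∧
      (∀ a ∈ K, (ρ • (1 : Mat m m) - a).PosSemidef) ∧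
      coneInterval (ε • (1 : Mat m m)) (ρ • (1 : Mat m m)) ⊆ K := by
  let K : Set (Mat m m) := {a | (a - ε • (1 : Mat m m)).PosSemidef ∧
    (ρ • (1 : Mat m m) - a).PosSemidef}
  have hKpos : ∀ a ∈ K, a.PosDef := fun a ha => by
    simpa using (posDef_smul_one (m := m) hε).posSemidef_add ha.1
  have hKcl : IsClosed K := by
    have h1 : Continuous fun a : Mat m m => a - ε • (1 : Mat m m) :=
      continuous_id.sub continuous_const
    have h2 : Continuous fun a : Mat m m => ρ • (1 : Mat m m) - a :=
      continuous_const.sub continuous_id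
    exact (isClosed_setOf_posSemidef.preimage h1).inter (isClosed_setOf_posSemidef.preimage h2)
  exact ⟨K, (isCompact_setOf_abs_le (m * ρ)).of_isClosed_subset hKcl
    fun a ha => abs_entry_le_of_posSemidef (hKpos a ha).posSemidef ha.2, hKpos,
    fun a ha => ha.2, fun a ha => ⟨ha.1.posSemidef, ha.2.posSemidef⟩⟩

theorem exists_det_rpow_le {ε : ℝ} (hε : 0 < ε) (m : ℕ) (ρ s : ℝ) :
    ∃ C : ℝ, ∀ a ∈ coneInterval (ε • (1 : Mat m m)) (ρ • (1 : Mat m m)), a.det ^ s ≤ C := by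
  obtain ⟨K, hKc, hKpos, -, hsub⟩ := exists_isCompact_posDef hε m ρ
  have hcont : ContinuousOn (fun a : Mat m m => a.det ^ s) K :=
    continuous_id.matrix_det.continuousOn.rpow_const fun a ha => Or.inl (hKpos a ha).det_pos.ne'
  obtain ⟨C, hC⟩ := (hKc.image_of_continuousOn hcont).bddAbove
  exact ⟨C, fun a ha => hC ⟨a, hsub ha, rfl⟩⟩

/-- Bounded order intervals away from the boundary of the cone have finite invariant measure. -/
theorem coneInvMeasure_coneInterval_lt_top {ε ρ : ℝ} (hε : 0 < ε) :
    coneInvMeasure m (coneInterval (ε • (1 : Mat m m)) (ρ • (1 : Mat m m))) < ∞ := by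
  obtain ⟨K, hKc, hKpos, hKle, hsub⟩ := exists_isCompact_posDef hε m ρ
  have hKcl := hKc.isClosed
  have hcont : ContinuousOn (fun a : Mat m m => a.det ^ (-(((m : ℝ) + 1) / 2))) K :=
    continuous_id.matrix_det.continuousOn.rpow_const fun a ha => Or.inl (hKpos a ha).det_pos.ne'
  obtain ⟨C, hC⟩ := (hKc.image_of_continuousOn hcont).bddAbove
  refine (measure_mono hsub).trans_lt ?_
  rw [coneInvMeasure, withDensity_apply _ hKcl.measurableSet]
  have h1 : ∫⁻ a in K, ENNReal.ofReal (a.det ^ (-(((m : ℝ) + 1) / 2))) ∂(coneMeasure m) ≤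
      ENNReal.ofReal C * coneMeasure m K := by
    rw [← setLIntegral_const]
    exact setLIntegral_mono measurable_const fun a ha =>
      ENNReal.ofReal_le_ofReal (hC ⟨a, ha, rfl⟩)
  refine h1.trans_lt (ENNReal.mul_lt_top ENNReal.ofReal_lt_top ?_)
  refine (Measure.restrict_apply_le _ _).trans_lt ?_
  rw [Measure.map_apply measurable_symOfCoords hKcl.measurableSet]
  have h2 : symOfCoords ⁻¹' K ⊆ Set.Icc (fun _ => -(m * ρ)) (fun _ => m * ρ) := by
    intro c hc
    have h3 : ∀ q : UpperIndex m, |c q| ≤ m * ρ := by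
      rintro ⟨⟨i, j⟩, hij⟩
      have := abs_entry_le_of_posSemidef (hKpos _ hc).posSemidef (hKle _ hc) i j
      simp only [symOfCoords, Matrix.of_apply] at this
      convert this using 3
      simp only [Subtype.mk.injEq, Prod.mk.injEq]
      exact ⟨(min_eq_left hij).symm, (max_eq_right hij).symm⟩
    exact ⟨fun q => (abs_le.1 (h3 q)).1, fun q => (abs_le.1 (h3 q)).2⟩
  exact (measure_mono h2).trans_lt isCompact_Icc.measure_lt_top

/-- In the coordinates `r_{i,j}`, `i ≤ j`, the interval contains a neighbourhood of `tI` for any `ε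
< t < ρ`, and the density of the invariant measure is positive on it. -/
theorem coneInvMeasure_coneInterval_pos {ε ρ : ℝ} (hε : 0 < ε) (hρ : ε < ρ) :
    0 < coneInvMeasure m (coneInterval (ε • (1 : Mat m m)) (ρ • (1 : Mat m m))) := by
  obtain ⟨t, ht1, ht2⟩ := exists_between hρ
  set I := coneInterval (ε • (1 : Mat m m)) (ρ • (1 : Mat m m))
  have hI : MeasurableSet I := measurableSet_coneInterval _ _
  have hIpos : ∀ a ∈ I, a.PosDef := fun a ha =>
    posDef_of_mem_coneInterval (posDef_smul_one hε).posSemidef ha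
  have hmem := smul_one_mem_coneInterval (m := m) ht1 ht2
  let c₀ : UpperIndex m → ℝ := fun q => (t • (1 : Mat m m)) q.1.1 q.1.2
  have hc₀ : symOfCoords c₀ = t • (1 : Mat m m) :=
    symOfCoords_restrict (transpose_smul_one t)
  have hnhds : symOfCoords ⁻¹' I ∈ 𝓝 c₀ := by
    have h1 := eventually_posDef hmem.1
    have h2 := eventually_posDef hmem.2
    rw [← hc₀] at h1 h2
    have hc1 : Continuous fun c : UpperIndex m → ℝ => symOfCoords c - ε • (1 : Mat m m) :=
      continuous_symOfCoords.sub continuous_const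
    have hc2 : Continuous fun c : UpperIndex m → ℝ => ρ • (1 : Mat m m) - symOfCoords c :=
      continuous_const.sub continuous_symOfCoords
    filter_upwards [(hc1.tendsto c₀).eventually h1, (hc2.tendsto c₀).eventually h2] with c h1 h2
    refine ⟨h1 ?_, h2 ?_⟩ <;>
    rw [Matrix.transpose_sub, transpose_smul_one, transpose_symOfCoords]
  have hvol : coneMeasure m I ≠ 0 := by
    rw [coneMeasure, Measure.restrict_apply hI, Set.inter_eq_left.2 (show I ⊆ posCone m from hIpos),
      Measure.map_apply measurable_symOfCoords hI]
    exact (Measure.measure_pos_of_mem_nhds _ hnhds).ne'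
  rw [pos_iff_ne_zero, coneInvMeasure, withDensity_apply _ hI]
  intro h0
  rw [lintegral_eq_zero_iff ((measurable_det.pow_const _).ennreal_ofReal)] at h0
  refine hvol ?_
  have h3 : ∀ᵐ a ∂((coneMeasure m).restrict I), False := by
    filter_upwards [h0, ae_restrict_mem hI] with a ha haI
    have := Real.rpow_pos_of_pos (hIpos a haI).det_pos (-(((m : ℝ) + 1) / 2))
    simp only [Pi.zero_apply, ENNReal.ofReal_eq_zero] at ha
    linarith
  rw [eventually_false_iff_eq_bot, ae_eq_bot, Measure.restrict_eq_zero] at h3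
  exact h3

end Gram

/-! ### Uniqueness of the invariant measure and the polar decomposition -/

section Uniqueness

variable {n m p : ℕ}

theorem measurable_matInv : Measurable fun r : Mat m m => r⁻¹ := by
  have h : (fun r : Mat m m => r⁻¹) = fun r => (r.det)⁻¹ • r.adjugate := by
    ext1 r
    rw [Matrix.inv_def, Ring.inverse_eq_inv']
  rw [h]
  have h1 : Measurable fun r : Mat m m => (r.det)⁻¹ := measurable_det.inv
  have h2 : Measurable fun r : Mat m m => r.adjugate := continuous_id.matrix_adjugate.measurable
  have h3 : Measurable fun q : ℝ × Mat m m => q.1 • q.2 :=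
    (continuous_fst.smul continuous_snd).measurable
  exact h3.comp (h1.prodMk h2)

theorem ae_det_ne_zero : ∀ᵐ g : Mat m m, g.det ≠ 0 := by
  filter_upwards [ae_det_gram_ne_zero (p := m) le_rfl] with g hg h
  exact hg (by rw [Matrix.det_mul, h, mul_zero])

/-- The Gaussian mass of `m × m` matrices. -/
noncomputable def gaussMass (n m : ℕ) : ℝ≥0∞ :=
  ∫⁻ z : Mat n m, ENNReal.ofReal (Real.exp (-(z.transpose * z).trace))

theorem gaussMass_eq : gaussMass n m = ENNReal.ofReal (Real.pi ^ ((n : ℝ) * m / 2)) := by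
  have h1 : ∫⁻ z : Mat n m, ENNReal.ofReal (Real.exp (-(z.transpose * z).trace)) =
      ∫⁻ c : Fin n × Fin m → ℝ, ∏ q, ENNReal.ofReal (Real.exp (-(c q) ^ 2)) := by
    have hm : Measurable fun c : Fin n × Fin m → ℝ =>
        ∏ q, ENNReal.ofReal (Real.exp (-(c q) ^ 2)) := by fun_prop
    rw [← volume_preserving_vecEquiv.lintegral_comp hm]
    refine lintegral_congr fun z => ?_
    rw [← ENNReal.ofReal_prod_of_nonneg fun _ _ => (Real.exp_pos _).le, ← Real.exp_sum]
    congr 2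
    simp only [Matrix.trace, Matrix.diag_apply, Matrix.mul_apply, Matrix.transpose_apply,
      Finset.sum_neg_distrib]
    rw [Fintype.sum_prod_type_right]
    simp only [pow_two]
    rfl
  have hint : Integrable fun t : ℝ => Real.exp (-t ^ 2) := by
    simpa using integrable_exp_neg_mul_sq one_pos
  have h2 : ∫ t : ℝ, Real.exp (-t ^ 2) = Real.pi ^ (1 / 2 : ℝ) := by
    have := integral_gaussian 1
    simpa [Real.sqrt_eq_rpow] using this
  have h3 := integral_fintype_prod_volume_eq_pow (ι := Fin n × Fin m)
    (fun t : ℝ => Real.exp (-t ^ 2))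
  rw [h2, ← Real.rpow_natCast, ← Real.rpow_mul Real.pi_pos.le] at h3
  have h4 : Integrable fun c : Fin n × Fin m → ℝ => ∏ q, Real.exp (-(c q) ^ 2) :=
    Integrable.fintype_prod (f := fun _ t => Real.exp (-t ^ 2)) fun _ => hint
  rw [gaussMass, h1]
  simp_rw [← ENNReal.ofReal_prod_of_nonneg fun _ _ => (Real.exp_pos _).le]
  rw [← ofReal_integral_eq_lintegral_ofReal h4
    (Eventually.of_forall fun c => Finset.prod_nonneg fun _ _ => (Real.exp_pos _).le), h3]
  congr 2
  simp
  ring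

/-- A measure on the cone that is invariant under `r ↦ g' r g`. -/
structure IsConeInvariant (μ : Measure (Mat m m)) : Prop where
  ae_posDef : ∀ᵐ r ∂μ, r.PosDef
  lintegral_comp_congr : ∀ g : Mat m m, g.det ≠ 0 → ∀ F : Mat m m → ℝ≥0∞, Measurable F →
    ∫⁻ r, F (g.transpose * r * g) ∂μ = ∫⁻ r, F r ∂μ

/-- The weight `|x|^{-m/2} exp(-tr(h x⁻¹ h'))`. -/
noncomputable def coneWeight (x h : Mat m m) : ℝ≥0∞ :=
  ENNReal.ofReal (x.det ^ (-(m : ℝ) / 2) * Real.exp (-(h * x⁻¹ * h.transpose).trace))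

theorem measurable_mul_mul_transpose {α : Type*} [MeasurableSpace α] {f g : α → Mat m m}
    (hf : Measurable f) (hg : Measurable g) :
    Measurable fun a => g a * f a * (g a).transpose := by
  have h : Continuous fun q : Mat m m × Mat m m => q.2 * q.1 * q.2.transpose :=
    (continuous_snd.matrix_mul continuous_fst).matrix_mul continuous_snd.matrix_transpose
  have h2 := h.measurable.comp (hf.prodMk hg)
  exact h2

theorem measurable_trace : Measurable fun x : Mat m m => x.trace :=
  continuous_id.matrix_trace.measurable

theorem measurable_coneWeight {α : Type*} [MeasurableSpace α] {f g : α → Mat m m}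
    (hf : Measurable f) (hg : Measurable g) : Measurable fun a => coneWeight (f a) (g a) := by
  have h := measurable_mul_mul_transpose (measurable_matInv.comp hf) hg
  have h1 : Measurable fun a => (f a).det ^ (-(m : ℝ) / 2) :=
    (measurable_det.comp hf).pow_const _
  have h2 : Measurable fun a => Real.exp (-(g a * (f a)⁻¹ * (g a).transpose).trace) :=
    Real.continuous_exp.measurable.comp (measurable_trace.comp h).neg
  exact (h1.mul h2).ennreal_ofReal

theorem measurable_gauss :
    Measurable fun z : Mat m m => ENNReal.ofReal (Real.exp (-(z * z.transpose).trace)) := by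
  have : Continuous fun z : Mat m m => -(z * z.transpose).trace :=
    (continuous_id.matrix_mul continuous_id.matrix_transpose).matrix_trace.neg
  exact (Real.continuous_exp.comp this).measurable.ennreal_ofReal

theorem measurable_comp_mul_transpose {F : Mat m m → ℝ≥0∞} (hF : Measurable F) :
    Measurable fun g : Mat m m => F (g * g.transpose) :=
  hF.comp (continuous_id.matrix_mul continuous_id.matrix_transpose).measurable

/-- The substitution `h = g x^{1/2}` has Jacobian `|x|^{-m/2}` and turns `tr(gg')` into `tr(h x⁻¹
h')`; together these form `coneWeight x h`. -/
theorem lintegral_gauss_mul_eq {x : Mat m m} (hx : x.PosDef) {F : Mat m m → ℝ≥0∞}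
    (hF : Measurable F) :
    ∫⁻ g : Mat m m, ENNReal.ofReal (Real.exp (-(g * g.transpose).trace)) *
        F (g * x * g.transpose) =
      ∫⁻ h : Mat m m, coneWeight x h * F (h * h.transpose) := by
  set s := matSqrt x
  have hs : 0 < s.det := det_matSqrt_pos hx
  have hsu : IsUnit s.det := hs.ne'.isUnit
  have hss : s * s = x := matSqrt_mul_self hx.posSemidef
  have hst : s.transpose = s := transpose_matSqrt x
  have hx1 : x⁻¹ = s⁻¹ * s⁻¹ := by rw [← hss, Matrix.mul_inv_rev]
  have h1 := lintegral_mul_right (p := m) s hs.ne'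
    (F := fun h => coneWeight x h * F (h * h.transpose))
    ((measurable_coneWeight measurable_const measurable_id).mul
      (measurable_comp_mul_transpose hF))
  have hc0 : ENNReal.ofReal ((|s.det| ^ m)⁻¹) ≠ 0 := by
    rw [abs_of_pos hs]; simpa using pow_pos hs m
  refine (ENNReal.mul_right_inj hc0 ENNReal.ofReal_ne_top).1 ?_
  rw [← h1, ← lintegral_const_mul]
  · refine lintegral_congr fun z => ?_
    have e1 : z * s * (z * s).transpose = z * x * z.transpose := by
      rw [Matrix.transpose_mul, hst, ← hss]; simp only [Matrix.mul_assoc]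
    have e2 : z * s * x⁻¹ * (z * s).transpose = z * z.transpose := by
      rw [Matrix.transpose_mul, hst, hx1]
      calc z * s * (s⁻¹ * s⁻¹) * (s * z.transpose)
          = z * (s * s⁻¹) * (s⁻¹ * s) * z.transpose := by simp only [Matrix.mul_assoc]
        _ = _ := by
          rw [Matrix.mul_nonsing_inv _ hsu, Matrix.nonsing_inv_mul _ hsu]; simp
    have e3 : x.det ^ (-(m : ℝ) / 2) = (|s.det| ^ m)⁻¹ := by
      rw [abs_of_pos hs, ← det_matSqrt_sq hx, ← Real.rpow_natCast, ← Real.rpow_mul hs.le,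
        ← Real.rpow_natCast, ← Real.rpow_neg hs.le]
      congr 1; push_cast; ring
    simp only [coneWeight, e1, e2, e3]
    rw [ENNReal.ofReal_mul (by positivity)]
    ring
  · exact measurable_gauss.mul
      (hF.comp (measurable_mul_mul_transpose measurable_const measurable_id))

/-- Invariance allows the substitution `x = h'yh`. Then `h x⁻¹ h' = y⁻¹`, and the determinant factor
produces `|det h|^{-m}`. -/
theorem IsConeInvariant.lintegral_coneWeight {μ : Measure (Mat m m)}
    (hμ : IsConeInvariant μ) {h : Mat m m} (hh : h.det ≠ 0) :
    ∫⁻ x, coneWeight x h ∂μ = ENNReal.ofReal ((|h.det| ^ m)⁻¹) * ∫⁻ x, coneWeight x 1 ∂μ := by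
  have hu : IsUnit h.det := hh.isUnit
  have hut : IsUnit h.transpose.det := by rwa [Matrix.det_transpose]
  rw [← hμ.lintegral_comp_congr h hh (fun x => coneWeight x h)
    (measurable_coneWeight measurable_id measurable_const)]
  refine Eq.trans ?_ (lintegral_const_mul _ (measurable_coneWeight measurable_id measurable_const))
  refine lintegral_congr_ae ?_
  filter_upwards [hμ.ae_posDef] with y hy
  have e1 : h * (h.transpose * y * h)⁻¹ * h.transpose = y⁻¹ := by
    rw [Matrix.mul_inv_rev, Matrix.mul_inv_rev]
    calc h * (h⁻¹ * (y⁻¹ * h.transpose⁻¹)) * h.transpose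
        = h * h⁻¹ * y⁻¹ * (h.transpose⁻¹ * h.transpose) := by simp only [Matrix.mul_assoc]
      _ = _ := by
        rw [Matrix.mul_nonsing_inv _ hu, Matrix.nonsing_inv_mul _ hut]; simp
  have e2 : (h.transpose * y * h).det ^ (-(m : ℝ) / 2) =
      (|h.det| ^ m)⁻¹ * y.det ^ (-(m : ℝ) / 2) := by
    have : (h.transpose * y * h).det = |h.det| ^ (2 : ℝ) * y.det := by
      rw [Matrix.det_mul, Matrix.det_mul, Matrix.det_transpose, Real.rpow_two, sq_abs]; ring
    rw [this, Real.mul_rpow (by positivity) hy.det_pos.le, ← Real.rpow_mul (abs_nonneg _),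
      ← Real.rpow_natCast, ← Real.rpow_neg (abs_nonneg _)]
    congr 2; ring
  change coneWeight (h.transpose * y * h) h = _ * coneWeight y 1
  simp only [coneWeight, e1, e2, Matrix.one_mul, Matrix.transpose_one, Matrix.mul_one]
  rw [mul_assoc, ENNReal.ofReal_mul (by positivity)]

/-- Uniqueness of the invariant measure. Average `∫ F dμ = ∫ F(g r g') dμ(r)` over `g` with a
Gaussian weight, exchange the integrals, and substitute `h = g x^{1/2}`. The right-hand side
involves `μ` only through the number `∫ coneWeight x 1 dμ(x)`, so any two invariant measures for
which this number is finite and nonzero are proportional. -/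
theorem IsConeInvariant.lintegral_mul_eq {μ : Measure (Mat m m)} [SFinite μ]
    (hμ : IsConeInvariant μ) {F : Mat m m → ℝ≥0∞} (hF : Measurable F) :
    gaussMass m m * ∫⁻ r, F r ∂μ =
      (∫⁻ g : Mat m m, F (g * g.transpose) * ENNReal.ofReal ((|g.det| ^ m)⁻¹)) *
        ∫⁻ x, coneWeight x 1 ∂μ := by
  have hFg := measurable_comp_mul_transpose hF
  have hFg3 : Measurable fun q : Mat m m × Mat m m => F (q.1 * q.2 * q.1.transpose) :=
    hF.comp (measurable_mul_mul_transpose measurable_snd measurable_fst)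
  have h1 : gaussMass m m * ∫⁻ r, F r ∂μ =
      ∫⁻ g : Mat m m, ENNReal.ofReal (Real.exp (-(g * g.transpose).trace)) *
          ∫⁻ r, F r ∂μ := by
    rw [lintegral_mul_const _ measurable_gauss, gaussMass]
    congr 1
    refine lintegral_congr fun z => ?_
    rw [Matrix.trace_mul_comm]
  have h2 : ∫⁻ g : Mat m m, ENNReal.ofReal (Real.exp (-(g * g.transpose).trace)) *
          ∫⁻ r, F r ∂μ =
      ∫⁻ g : Mat m m, ∫⁻ r, ENNReal.ofReal (Real.exp (-(g * g.transpose).trace)) *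
          F (g * r * g.transpose) ∂μ := by
    refine lintegral_congr_ae ?_
    filter_upwards [ae_det_ne_zero] with g hg
    have h1 := hμ.lintegral_comp_congr g.transpose (by rwa [Matrix.det_transpose]) F hF
    rw [Matrix.transpose_transpose] at h1
    rw [← h1, lintegral_const_mul]
    exact hF.comp (measurable_mul_mul_transpose measurable_id measurable_const)
  have h3 : ∫⁻ r, (∫⁻ g : Mat m m, ENNReal.ofReal (Real.exp (-(g * g.transpose).trace)) *
          F (g * r * g.transpose)) ∂μ =
      ∫⁻ x, (∫⁻ h : Mat m m, coneWeight x h * F (h * h.transpose)) ∂μ := by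
    refine lintegral_congr_ae ?_
    filter_upwards [hμ.ae_posDef] with x hx
    exact lintegral_gauss_mul_eq hx hF
  have h4 : ∫⁻ h : Mat m m, ∫⁻ x, coneWeight x h * F (h * h.transpose) ∂μ =
      ∫⁻ h : Mat m m, F (h * h.transpose) * ENNReal.ofReal ((|h.det| ^ m)⁻¹) *
        ∫⁻ x, coneWeight x 1 ∂μ := by
    refine lintegral_congr_ae ?_
    filter_upwards [ae_det_ne_zero] with h hh
    rw [lintegral_mul_const, hμ.lintegral_coneWeight hh]
    · ring
    · exact measurable_coneWeight measurable_id measurable_const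
  have hd : Measurable fun g : Mat m m => ENNReal.ofReal ((|g.det| ^ m)⁻¹) :=
    ((measurable_det.abs.pow_const m).inv).ennreal_ofReal
  rw [h1, h2, lintegral_lintegral_swap, h3, lintegral_lintegral_swap, h4]
  · exact lintegral_mul_const _ (hFg.mul hd)
  · exact ((measurable_coneWeight measurable_fst measurable_snd).mul (hFg.comp measurable_snd)).aemeasurable
  · exact ((measurable_gauss.comp measurable_fst).mul hFg3).aemeasurable

theorem isConeInvariant_coneInvMeasure : IsConeInvariant (coneInvMeasure m) :=
  ⟨ae_coneInvMeasure_posDef, fun g hg _ hF => lintegral_coneInvMeasure_congr g hg hF⟩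

instance instSFiniteConeInvMeasure : SFinite (coneInvMeasure m) := by
  unfold coneInvMeasure coneMeasure; infer_instance

/-! ### The Gram map `z ↦ z'z` and the polar decomposition constant -/

theorem continuous_gram : Continuous fun z : Mat p m => z.transpose * z :=
  continuous_id.matrix_transpose.matrix_mul continuous_id

theorem measurable_gram : Measurable fun z : Mat p m => z.transpose * z :=
  continuous_gram.measurable

theorem ae_posDef_gram (hmp : m ≤ p) : ∀ᵐ z : Mat p m, (z.transpose * z).PosDef := by
  filter_upwards [ae_det_gram_ne_zero hmp] with z hz using posDef_transpose_mul_self hz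

/-- The image of `|z|^{-p} dz` under `z ↦ z'z`. -/
noncomputable def gramInvMeasure (p m : ℕ) : Measure (Mat m m) :=
  (Measure.map (fun z : Mat p m => z.transpose * z) volume).withDensity
    fun r => ENNReal.ofReal (r.det ^ (-(p : ℝ) / 2))

instance instSFiniteGramInvMeasure : SFinite (gramInvMeasure p m) := by
  unfold gramInvMeasure; infer_instance

theorem measurable_ofReal_det_rpow (s : ℝ) :
    Measurable fun r : Mat m m => ENNReal.ofReal (r.det ^ s) :=
  (measurable_det.pow_const _).ennreal_ofReal

theorem lintegral_gramInvMeasure {F : Mat m m → ℝ≥0∞} (hF : Measurable F) :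
    ∫⁻ r, F r ∂(gramInvMeasure p m) = ∫⁻ z : Mat p m,
      ENNReal.ofReal ((z.transpose * z).det ^ (-(p : ℝ) / 2)) * F (z.transpose * z) := by
  rw [gramInvMeasure, lintegral_withDensity_eq_lintegral_mul _ (measurable_ofReal_det_rpow _) hF,
    lintegral_map ((measurable_ofReal_det_rpow _).mul hF) measurable_gram]
  rfl

/-- Replacing `z` by `zg` changes `z'z` into `g'(z'z)g`. The Jacobian `|det g|^{-p}` is matched by
the density `|z'z|^{-p/2}`. The hypothesis `m ≤ p` makes almost every Gram matrix positive definite.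
-/
theorem isConeInvariant_gramInvMeasure (hmp : m ≤ p) : IsConeInvariant (gramInvMeasure p m) := by
  refine ⟨(withDensity_absolutelyContinuous _ _).ae_le
    ((ae_map_iff measurable_gram.aemeasurable measurableSet_setOf_posDef).2
      (ae_posDef_gram hmp)), fun g hg F hF => ?_⟩
  rw [lintegral_gramInvMeasure hF,
    lintegral_gramInvMeasure (F := fun r => F (g.transpose * r * g)) (hF.comp (measurable_congr g))]
  have hpos : 0 < |g.det| ^ p := pow_pos (abs_pos.2 hg) _
  have hc : ENNReal.ofReal ((|g.det| ^ p)⁻¹) ≠ 0 := by simpa using hpos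
  have hm : Measurable fun z : Mat p m =>
      ENNReal.ofReal ((z.transpose * z).det ^ (-(p : ℝ) / 2)) * F (z.transpose * z) :=
    ((measurable_ofReal_det_rpow _).comp measurable_gram).mul (hF.comp measurable_gram)
  refine (ENNReal.mul_right_inj hc ENNReal.ofReal_ne_top).1 ?_
  have h1 := lintegral_mul_right g hg hm
  rw [← h1]
  refine (lintegral_const_mul' _ _ ENNReal.ofReal_ne_top).symm.trans ?_
  refine lintegral_congr_ae ?_
  filter_upwards [ae_posDef_gram hmp] with z hz
  have e1 : (z * g).transpose * (z * g) = g.transpose * (z.transpose * z) * g := by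
    rw [Matrix.transpose_mul]; simp only [Matrix.mul_assoc]
  have e2 : (g.transpose * (z.transpose * z) * g).det ^ (-(p : ℝ) / 2) =
      (|g.det| ^ p)⁻¹ * (z.transpose * z).det ^ (-(p : ℝ) / 2) := by
    have : (g.transpose * (z.transpose * z) * g).det =
        |g.det| ^ (2 : ℝ) * (z.transpose * z).det := by
      rw [Matrix.det_mul, Matrix.det_mul, Matrix.det_transpose, Real.rpow_two, sq_abs]; ring
    rw [this, Real.mul_rpow (by positivity) hz.det_pos.le, ← Real.rpow_mul (abs_nonneg _),
      ← Real.rpow_natCast, ← Real.rpow_neg (abs_nonneg _)]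
    congr 2; ring
  rw [e1, e2, ENNReal.ofReal_mul (by positivity)]
  exact (_root_.mul_assoc _ _ _).symm

theorem gaussMass_ne_zero : gaussMass n m ≠ 0 := by
  rw [gaussMass_eq]
  simpa using Real.rpow_pos_of_pos Real.pi_pos _

theorem gaussMass_ne_top : gaussMass n m ≠ ∞ := by
  rw [gaussMass_eq]; exact ENNReal.ofReal_ne_top

/-- The integrand of the Siegel gamma function. -/
noncomputable def siegelIntegrand (m : ℕ) (α : ℝ) (r : Mat m m) : ℝ≥0∞ :=
  ENNReal.ofReal (r.det ^ α) * ENNReal.ofReal (Real.exp (-r.trace))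

theorem measurable_siegelIntegrand (α : ℝ) : Measurable (siegelIntegrand m α) :=
  (measurable_ofReal_det_rpow α).mul
    (Real.continuous_exp.measurable.comp measurable_trace.neg).ennreal_ofReal

/-- No convergence is assumed: a divergent integral gives `0` on both sides. Finiteness and
positivity at `p/2` come out of `gramInvMeasure_eq`. -/
theorem siegelGamma_eq_toReal (α : ℝ) :
    siegelGamma m α = (∫⁻ r, siegelIntegrand m α r ∂(coneInvMeasure m)).toReal := by
  have hmeas : Measurable fun r : Mat m m =>
      Real.exp (-r.trace) * r.det ^ (α - ((m : ℝ) + 1) / 2) :=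
    (Real.continuous_exp.measurable.comp measurable_trace.neg).mul (measurable_det.pow_const _)
  rw [siegelGamma, integral_eq_lintegral_of_nonneg_ae _ hmeas.aestronglyMeasurable,
    lintegral_coneInvMeasure (measurable_siegelIntegrand α)]
  · congr 1
    refine lintegral_congr_ae ?_
    filter_upwards [ae_coneMeasure_posDef] with r hr
    have := Real.rpow_add hr.det_pos (-(((m : ℝ) + 1) / 2)) α
    rw [siegelIntegrand, ← mul_assoc, ← ENNReal.ofReal_mul (Real.rpow_pos_of_pos hr.det_pos _).le,
      ← this, mul_comm (Real.exp _), ENNReal.ofReal_mul (Real.rpow_pos_of_pos hr.det_pos _).le]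
    congr 3; ring
  · filter_upwards [ae_coneMeasure_posDef] with r hr
    exact mul_nonneg (Real.exp_pos _).le (Real.rpow_pos_of_pos hr.det_pos _).le

theorem lintegral_siegelIntegrand_gramInvMeasure (hmp : m ≤ p) :
    ∫⁻ r, siegelIntegrand m ((p : ℝ) / 2) r ∂(gramInvMeasure p m) = gaussMass p m := by
  rw [lintegral_gramInvMeasure (measurable_siegelIntegrand _), gaussMass]
  refine lintegral_congr_ae ?_
  filter_upwards [ae_posDef_gram hmp] with z hz
  rw [siegelIntegrand, ← mul_assoc, ← ENNReal.ofReal_mul (Real.rpow_pos_of_pos hz.det_pos _).le,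
    ← Real.rpow_add hz.det_pos]
  have : -(p : ℝ) / 2 + (p : ℝ) / 2 = 0 := by ring
  rw [this, Real.rpow_zero, ENNReal.ofReal_one, one_mul]

/-- The constant `π^{pm/2} / Γ_m(p/2)` of the polar decomposition. -/
noncomputable def polarConst (p m : ℕ) : ℝ :=
  Real.pi ^ ((p : ℝ) * m / 2) / siegelGamma m ((p : ℝ) / 2)

/-- Both measures are invariant, hence proportional once the constants `C₁`, `C₂` are known to be
finite and `C₂` nonzero. The ratio is found by testing on `|r|^{p/2} e^{-tr r}`: the Gram side is
the Gaussian integral `π^{pm/2}`, the other side is `Γ_m(p/2)`. -/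
theorem gramInvMeasure_eq (hmp : m ≤ p) : 0 < polarConst p m ∧
    gramInvMeasure p m = ENNReal.ofReal (polarConst p m) • coneInvMeasure m := by
  set C₁ := ∫⁻ x, coneWeight x 1 ∂(gramInvMeasure p m)
  set C₂ := ∫⁻ x, coneWeight x 1 ∂(coneInvMeasure m)
  set L := ∫⁻ r, siegelIntegrand m ((p : ℝ) / 2) r ∂(coneInvMeasure m)
  have h1 {F : Mat m m → ℝ≥0∞} (hF : Measurable F) :=
    (isConeInvariant_gramInvMeasure hmp).lintegral_mul_eq hF
  have h2 {F : Mat m m → ℝ≥0∞} (hF : Measurable F) :=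
    (isConeInvariant_coneInvMeasure (m := m)).lintegral_mul_eq hF
  have hC₁ : C₁ ≠ ∞ := by
    intro h
    have h3 := h1 (measurable_siegelIntegrand ((p : ℝ) / 2))
    rw [lintegral_siegelIntegrand_gramInvMeasure hmp] at h3
    have h4 := mul_ne_zero (gaussMass_ne_zero (n := m) (m := m)) (gaussMass_ne_zero (n := p) (m := m))
    have h5 := ENNReal.mul_ne_top (gaussMass_ne_top (n := m) (m := m)) (gaussMass_ne_top (n := p) (m := m))
    rw [h3] at h4 h5
    exact h5 (by rw [show ∫⁻ x, coneWeight x 1 ∂(gramInvMeasure p m) = ∞ from h,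
      ENNReal.mul_top (left_ne_zero_of_mul h4)])
  -- The convergence of `Γ_m(p/2)` is not yet available, so `C₂` is controlled by testing on the
  -- interval `(I, 2I)`, whose invariant measure is finite and positive.
  have hI : MeasurableSet (coneInterval ((1 : ℝ) • (1 : Mat m m)) ((2 : ℝ) • (1 : Mat m m))) :=
    measurableSet_coneInterval _ _
  have h3 := h2 (measurable_one.indicator hI)
  rw [lintegral_indicator_one hI] at h3
  have h4 := mul_ne_zero (gaussMass_ne_zero (n := m) (m := m))
    (coneInvMeasure_coneInterval_pos (m := m) one_pos one_lt_two).ne'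
  have h5 := ENNReal.mul_ne_top (gaussMass_ne_top (n := m) (m := m))
    (coneInvMeasure_coneInterval_lt_top (m := m) (ρ := 2) one_pos).ne
  rw [h3] at h4 h5
  have hC₂ : C₂ ≠ ∞ := fun h => h5 (by
    rw [show ∫⁻ x, coneWeight x 1 ∂(coneInvMeasure m) = ∞ from h,
      ENNReal.mul_top (left_ne_zero_of_mul h4)])
  have hC₂0 : C₂ ≠ 0 := right_ne_zero_of_mul h4
  have h6 : gramInvMeasure p m = (C₁ / C₂) • coneInvMeasure m := by
    refine Measure.ext_of_lintegral _ fun F hF => ?_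
    rw [lintegral_smul_measure, smul_eq_mul]
    refine (ENNReal.mul_right_inj (gaussMass_ne_zero (n := m) (m := m)) gaussMass_ne_top).1 ?_
    rw [h1 hF, mul_left_comm, h2 hF]
    change _ * C₁ = C₁ / C₂ * (_ * C₂)
    rw [mul_comm (C₁ / C₂), mul_assoc, ENNReal.mul_div_cancel hC₂0 hC₂]
  have h7 : ENNReal.ofReal (Real.pi ^ ((p : ℝ) * m / 2)) = C₁ / C₂ * L := by
    rw [← gaussMass_eq, ← lintegral_siegelIntegrand_gramInvMeasure hmp, h6,
      lintegral_smul_measure, smul_eq_mul]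
  have hpi : 0 < Real.pi ^ ((p : ℝ) * m / 2) := Real.rpow_pos_of_pos Real.pi_pos _
  have h8 : C₁ / C₂ * L ≠ 0 := by rw [← h7]; simpa using hpi
  have h9 : C₁ / C₂ * L ≠ ∞ := by rw [← h7]; exact ENNReal.ofReal_ne_top
  have hL0 : L ≠ 0 := right_ne_zero_of_mul h8
  have hL : L ≠ ∞ := fun h => h9 (by rw [h, ENNReal.mul_top (left_ne_zero_of_mul h8)])
  have hΓ : siegelGamma m ((p : ℝ) / 2) = L.toReal := siegelGamma_eq_toReal _
  have hΓpos : 0 < siegelGamma m ((p : ℝ) / 2) := by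
    rw [hΓ]; exact ENNReal.toReal_pos hL0 hL
  refine ⟨div_pos hpi hΓpos, ?_⟩
  rw [h6, polarConst, ENNReal.ofReal_div_of_pos hΓpos, h7, hΓ, ENNReal.ofReal_toReal hL,
    ENNReal.mul_div_cancel_right hL0 hL]

theorem polarConst_pos (hmp : m ≤ p) : 0 < polarConst p m := (gramInvMeasure_eq hmp).1

/-- Polar decomposition: the image of Lebesgue measure under `z ↦ z'z`. -/
theorem lintegral_gram (hmp : m ≤ p) {F : Mat m m → ℝ≥0∞} (hF : Measurable F) :
    ∫⁻ z : Mat p m, F (z.transpose * z) = ENNReal.ofReal (polarConst p m) *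
      ∫⁻ r, ENNReal.ofReal (r.det ^ ((p : ℝ) / 2)) * F r ∂(coneInvMeasure m) := by
  have hm := (measurable_ofReal_det_rpow (m := m) ((p : ℝ) / 2)).mul hF
  have h1 := lintegral_gramInvMeasure (p := p) hm
  rw [(gramInvMeasure_eq hmp).2, lintegral_smul_measure, smul_eq_mul] at h1
  refine Eq.trans (lintegral_congr_ae ?_) h1.symm
  filter_upwards [ae_posDef_gram hmp] with z hz
  rw [Pi.mul_apply, ← mul_assoc, ← ENNReal.ofReal_mul (Real.rpow_pos_of_pos hz.det_pos _).le,
    ← Real.rpow_add hz.det_pos]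
  have : -(p : ℝ) / 2 + (p : ℝ) / 2 = 0 := by ring
  rw [this, Real.rpow_zero, ENNReal.ofReal_one, one_mul]

theorem map_gram_volume (hmp : m ≤ p) :
    Measure.map (fun z : Mat p m => z.transpose * z) volume =
      ENNReal.ofReal (polarConst p m) • (coneInvMeasure m).withDensity
        fun r => ENNReal.ofReal (r.det ^ ((p : ℝ) / 2)) := by
  refine Measure.ext_of_lintegral _ fun F hF => ?_
  rw [lintegral_map hF measurable_gram, lintegral_gram hmp hF, lintegral_smul_measure,
    lintegral_withDensity_eq_lintegral_mul _ (measurable_ofReal_det_rpow _) hF]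
  rfl

theorem polarConst_eq_stiefelMass : polarConst n m = stiefelMass n m / 2 ^ m := by
  have h : (2 : ℝ) ^ m ≠ 0 := by positivity
  rw [polarConst, stiefelMass]
  field_simp

end Uniqueness

/-! ### Averaging over the orthogonal group -/

section Orthogonal

variable {n m p k : ℕ}

instance instSecondCountableOrthGroup : SecondCountableTopology (OrthGroup n) :=
  TopologicalSpace.Subtype.secondCountableTopology
    (Matrix.orthogonalGroup (Fin n) ℝ : Set (Mat n n))

/-- The Haar probability measure of `O(n)`. -/
noncomputable abbrev orthHaar (n : ℕ) : Measure (OrthGroup n) := Measure.haarMeasure ⊤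

instance instIsProbabilityOrthHaar : IsProbabilityMeasure (orthHaar n) :=
  ⟨Measure.haarMeasure_self⟩

/-- A right translate of the left Haar probability is again left invariant of mass one, and such a
measure is unique. -/
theorem map_mul_right_orthHaar (γ₀ : OrthGroup n) :
    Measure.map (fun γ => γ * γ₀) (orthHaar n) = orthHaar n := by
  have : IsProbabilityMeasure (Measure.map (fun γ => γ * γ₀) (orthHaar n)) :=
    Measure.isProbabilityMeasure_map (measurable_mul_const γ₀).aemeasurable
  exact Measure.isHaarMeasure_eq_of_isProbabilityMeasure _ _

theorem lintegral_orthHaar_mul_right (γ₀ : OrthGroup n) {F : OrthGroup n → ℝ≥0∞}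
    (hF : Measurable F) : ∫⁻ γ, F (γ * γ₀) ∂(orthHaar n) = ∫⁻ γ, F γ ∂(orthHaar n) := by
  conv_rhs => rw [← map_mul_right_orthHaar γ₀, lintegral_map hF (measurable_mul_const γ₀)]

/-- The standard frame `[I; 0]`. -/
def stdFrame (n m : ℕ) : Mat n m := Matrix.of fun i j => if (i : ℕ) = j then 1 else 0

theorem transpose_stdFrame_mul_self (hmn : m ≤ n) :
    (stdFrame n m).transpose * stdFrame n m = 1 := by
  ext a b
  rw [Matrix.mul_apply, Finset.sum_eq_single (Fin.castLE hmn a)]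
  · simp [stdFrame, Matrix.one_apply, Fin.ext_iff]
  · intro i _ hi
    have : (i : ℕ) ≠ a := fun h => hi (Fin.ext h)
    simp [stdFrame, this]
  · simp

/-- The columns of `V` are orthonormal and extend to an orthonormal basis of `ℝⁿ`, which gives the
columns of `γ`. -/
theorem exists_orthGroup_mul_stdFrame (hmn : m ≤ n) {V : Mat n m} (hV : V.transpose * V = 1) :
    ∃ γ : OrthGroup n, V = (γ : Mat n n) * stdFrame n m := by
  classical
  let v : Fin n → EuclideanSpace ℝ (Fin n) := fun j =>
    if h : (j : ℕ) < m then WithLp.toLp 2 fun i => V i ⟨j, h⟩ else 0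
  have hv : Orthonormal ℝ (({j : Fin n | (j : ℕ) < m} : Set (Fin n)).domRestrict v) := by
    rw [orthonormal_iff_ite]
    rintro ⟨a, ha⟩ ⟨b, hb⟩
    have ha' : (a : ℕ) < m := ha
    have hb' : (b : ℕ) < m := hb
    have h1 := congrFun (congrFun hV ⟨a, ha'⟩) ⟨b, hb'⟩
    rw [Matrix.mul_apply] at h1
    have e (c : Fin n) (hc : (c : ℕ) < m) (i : Fin n) : v c i = V i ⟨c, hc⟩ := by simp [v, hc]
    simp only [Set.domRestrict_apply, PiLp.inner_apply, Subtype.mk.injEq, e a ha', e b hb']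
    simp only [Matrix.transpose_apply, Matrix.one_apply, Fin.mk.injEq] at h1
    simp only [Fin.ext_iff, ← h1]
    exact Finset.sum_congr rfl fun i _ => by simp [mul_comm]
  obtain ⟨b, hb⟩ := hv.exists_orthonormalBasis_extension_of_card_eq (by simp)
  let A : Mat n n := Matrix.of fun i j => b j i
  have hA : A.transpose * A = 1 := by
    ext i j
    have h1 := orthonormal_iff_ite.1 b.orthonormal i j
    rw [PiLp.inner_apply] at h1
    rw [Matrix.mul_apply, Matrix.one_apply, ← h1]
    exact Finset.sum_congr rfl fun l _ => by simp [A, mul_comm]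
  refine ⟨⟨A, (Matrix.mem_orthogonalGroup_iff' (Fin n) ℝ).2 hA⟩, ?_⟩
  ext i j
  rw [Matrix.mul_apply, Finset.sum_eq_single (Fin.castLE hmn j)]
  · have h1 := hb (Fin.castLE hmn j) (show ((Fin.castLE hmn j : Fin n) : ℕ) < m by simp)
    simp [stdFrame, A, h1, v]
  · intro l _ hl
    have : (l : ℕ) ≠ j := fun h => hl (Fin.ext h)
    simp [stdFrame, this]
  · simp

/-- Polar decomposition of a full-rank matrix: `Y (Y'Y)^{-1/2}` has orthonormal columns. Hence
matrices with the same positive definite Gram matrix form one orbit of `O(n)`. -/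
theorem exists_orthGroup_mul_matSqrt (hmn : m ≤ n) {Y : Mat n m}
    (hY : (Y.transpose * Y).PosDef) :
    ∃ γ : OrthGroup n, Y = (γ : Mat n n) * (stdFrame n m * matSqrt (Y.transpose * Y)) := by
  set s := matSqrt (Y.transpose * Y)
  have hs : IsUnit s.det := (det_matSqrt_pos hY).ne'.isUnit
  have hss : s * s = Y.transpose * Y := matSqrt_mul_self hY.posSemidef
  have hst : s.transpose = s := transpose_matSqrt _
  have hV : (Y * s⁻¹).transpose * (Y * s⁻¹) = 1 := by
    rw [Matrix.transpose_mul, Matrix.transpose_nonsing_inv, hst]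
    calc s⁻¹ * Y.transpose * (Y * s⁻¹) = s⁻¹ * (Y.transpose * Y) * s⁻¹ := by
          simp only [Matrix.mul_assoc]
      _ = (s⁻¹ * s) * (s * s⁻¹) := by rw [← hss]; simp only [Matrix.mul_assoc]
      _ = 1 := by rw [Matrix.nonsing_inv_mul _ hs, Matrix.mul_nonsing_inv _ hs, Matrix.one_mul]
  obtain ⟨γ, hγ⟩ := exists_orthGroup_mul_stdFrame hmn hV
  refine ⟨γ, ?_⟩
  rw [← Matrix.mul_assoc, ← hγ, Matrix.mul_assoc, Matrix.nonsing_inv_mul _ hs, Matrix.mul_one]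

/-- The average of a function over the orbits of `O(n)`. -/
noncomputable def orthAvg (F : Mat n m → ℝ≥0∞) (Y : Mat n m) : ℝ≥0∞ :=
  ∫⁻ γ, F ((γ : Mat n n) * Y) ∂(orthHaar n)

theorem measurable_orth_mul {α : Type*} [MeasurableSpace α] {g : α → OrthGroup n}
    {f : α → Mat n m} (hg : Measurable g) (hf : Measurable f) :
    Measurable fun a => (g a : Mat n n) * f a := by
  have h : Continuous fun q : OrthGroup n × Mat n m => (q.1 : Mat n n) * q.2 :=
    (continuous_subtype_val.comp continuous_fst).matrix_mul continuous_snd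
  have h2 := h.measurable.comp (hg.prodMk hf)
  exact h2

theorem measurable_orthAvg {F : Mat n m → ℝ≥0∞} (hF : Measurable F) : Measurable (orthAvg F) :=
  (hF.comp (measurable_orth_mul measurable_snd measurable_fst)).lintegral_prod_right'

theorem orthAvg_orth_mul {F : Mat n m → ℝ≥0∞} (hF : Measurable F) (γ₀ : OrthGroup n)
    (Y : Mat n m) : orthAvg F ((γ₀ : Mat n n) * Y) = orthAvg F Y := by
  have h := lintegral_orthHaar_mul_right γ₀ (F := fun γ => F ((γ : Mat n n) * Y))
    (hF.comp (measurable_orth_mul measurable_id measurable_const))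
  rw [orthAvg, orthAvg, ← h]
  refine lintegral_congr fun γ => ?_
  rw [Submonoid.coe_mul, Matrix.mul_assoc]

theorem orthAvg_eq (hmn : m ≤ n) {F : Mat n m → ℝ≥0∞} (hF : Measurable F) {Y : Mat n m}
    (hY : (Y.transpose * Y).PosDef) :
    orthAvg F Y = orthAvg F (stdFrame n m * matSqrt (Y.transpose * Y)) := by
  obtain ⟨γ, hγ⟩ := exists_orthGroup_mul_matSqrt hmn hY
  conv_lhs => rw [hγ, orthAvg_orth_mul hF]

theorem gram_orth_mul (γ : OrthGroup n) (Y : Mat n m) :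
    ((γ : Mat n n) * Y).transpose * ((γ : Mat n n) * Y) = Y.transpose * Y := by
  have h : (γ : Mat n n).transpose * (γ : Mat n n) = 1 :=
    (Matrix.mem_orthogonalGroup_iff' (Fin n) ℝ).1 γ.2
  rw [Matrix.transpose_mul, Matrix.mul_assoc, ← Matrix.mul_assoc _ (γ : Mat n n), h,
    Matrix.one_mul]

/-- Integration of an orthogonal average against a radial weight. -/
theorem lintegral_orthAvg {F : Mat n m → ℝ≥0∞} (hF : Measurable F)
    {W : Mat m m → ℝ≥0∞} (hW : Measurable W) :
    ∫⁻ Y : Mat n m, W (Y.transpose * Y) * orthAvg F Y =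
      ∫⁻ Y : Mat n m, W (Y.transpose * Y) * F Y := by
  have hWg : Measurable fun Y : Mat n m => W (Y.transpose * Y) := hW.comp measurable_gram
  have hFo : Measurable fun q : Mat n m × OrthGroup n => F ((q.2 : Mat n n) * q.1) :=
    hF.comp (measurable_orth_mul measurable_snd measurable_fst)
  calc ∫⁻ Y : Mat n m, W (Y.transpose * Y) * orthAvg F Y
      = ∫⁻ Y : Mat n m, (∫⁻ γ, W (Y.transpose * Y) * F ((γ : Mat n n) * Y) ∂(orthHaar n)) := by
        refine lintegral_congr fun Y => ?_
        rw [orthAvg, lintegral_const_mul]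
        exact hF.comp (measurable_orth_mul measurable_id measurable_const)
    _ = ∫⁻ γ, (∫⁻ Y : Mat n m, W (Y.transpose * Y) * F ((γ : Mat n n) * Y)) ∂(orthHaar n) := by
        rw [lintegral_lintegral_swap]
        exact ((hWg.comp measurable_fst).mul hFo).aemeasurable
    _ = ∫⁻ γ, (∫⁻ Y : Mat n m, W (Y.transpose * Y) * F Y) ∂(orthHaar n) := by
        refine lintegral_congr fun γ => ?_
        refine Eq.trans (lintegral_congr fun Y => ?_)
          ((volume_preserving_orthGroup_mul γ).lintegral_comp (hWg.mul hF))
        rw [gram_orth_mul]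
    _ = _ := by rw [lintegral_const, measure_univ, mul_one]

/-- Averaging over `O(n)` replaces `F` by a function `A` of the Gram matrix, and `η` and `ξ₀η` have
the same Gram matrix. Both sides are then integrals of `A` against `|r|^{p/2} d_*r`, by polar
decomposition in `p × m` and in `n × m` matrices; the weight makes up the difference between the
exponents `n/2` and `p/2`. -/
theorem lintegral_orthHaar_frame (hmp : m ≤ p) (hpn : p ≤ n) {ξ₀ : Mat n p}
    (hξ : ξ₀.transpose * ξ₀ = 1) {F : Mat n m → ℝ≥0∞} (hF : Measurable F) :
    ∫⁻ γ, (∫⁻ η : Mat p m, F ((γ : Mat n n) * (ξ₀ * η))) ∂(orthHaar n) =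
      ENNReal.ofReal (polarConst p m / polarConst n m) * ∫⁻ Y : Mat n m,
        ENNReal.ofReal ((Y.transpose * Y).det ^ (((p : ℝ) - n) / 2)) * F Y := by
  have hmn := hmp.trans hpn
  let A : Mat m m → ℝ≥0∞ := fun r => orthAvg F (stdFrame n m * matSqrt r)
  have hA : Measurable A := (measurable_orthAvg hF).comp
    ((continuous_const.matrix_mul continuous_id).measurable.comp measurable_matSqrt)
  have hgram (η : Mat p m) : (ξ₀ * η).transpose * (ξ₀ * η) = η.transpose * η := by
    rw [Matrix.transpose_mul, Matrix.mul_assoc, ← Matrix.mul_assoc _ ξ₀, hξ, Matrix.one_mul]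
  have hcn := polarConst_pos hmn
  have hcp := polarConst_pos hmp
  have hmul : Measurable fun η : Mat p m => ξ₀ * η :=
    (continuous_const.matrix_mul continuous_id).measurable
  have h1 : ∫⁻ γ, (∫⁻ η : Mat p m, F ((γ : Mat n n) * (ξ₀ * η))) ∂(orthHaar n) =
      ∫⁻ η : Mat p m, A (η.transpose * η) := by
    rw [lintegral_lintegral_swap]
    · refine lintegral_congr_ae ?_
      filter_upwards [ae_posDef_gram hmp] with η hη
      rw [← hgram η] at hη ⊢
      exact orthAvg_eq hmn hF hη
    · exact (hF.comp (measurable_orth_mul measurable_fst (hmul.comp measurable_snd))).aemeasurable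
  have h2 : ∫⁻ Y : Mat n m, ENNReal.ofReal ((Y.transpose * Y).det ^ (((p : ℝ) - n) / 2)) * F Y =
      ∫⁻ Y : Mat n m, ENNReal.ofReal ((Y.transpose * Y).det ^ (((p : ℝ) - n) / 2)) *
        A (Y.transpose * Y) := by
    rw [← lintegral_orthAvg hF (measurable_ofReal_det_rpow _)]
    refine lintegral_congr_ae ?_
    filter_upwards [ae_posDef_gram hmn] with Y hY
    rw [orthAvg_eq hmn hF hY]
  have h3 : Measurable fun r : Mat m m => ENNReal.ofReal (r.det ^ (((p : ℝ) - n) / 2)) * A r :=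
    (measurable_ofReal_det_rpow _).mul hA
  rw [h1, h2, lintegral_gram hmp hA, lintegral_gram hmn h3, ← mul_assoc,
    ← ENNReal.ofReal_mul (div_pos hcp hcn).le, div_mul_cancel₀ _ hcn.ne']
  congr 1
  refine lintegral_congr_ae ?_
  filter_upwards [ae_coneInvMeasure_posDef] with r hr
  rw [← mul_assoc, ← ENNReal.ofReal_mul (Real.rpow_pos_of_pos hr.det_pos _).le,
    ← Real.rpow_add hr.det_pos]
  congr 3; ring

/-! ### Integration over the Stiefel manifold -/

theorem continuous_orbitMap : Continuous (orbitMap n k) :=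
  (continuous_subtype_val.matrix_mul continuous_const).subtype_mk _

instance instIsProbabilityStiefelMeasure : IsProbabilityMeasure (stiefelMeasure n k) :=
  Measure.isProbabilityMeasure_map continuous_orbitMap.measurable.aemeasurable

theorem measurable_stiefel_mul {α : Type*} [MeasurableSpace α] {g : α → Stiefel n p}
    {f : α → Mat p m} (hg : Measurable g) (hf : Measurable f) :
    Measurable fun a => (g a).1 * f a := by
  have h : Continuous fun q : Stiefel n p × Mat p m => q.1.1 * q.2 :=
    (continuous_subtype_val.comp continuous_fst).matrix_mul continuous_snd
  have h2 := h.measurable.comp (hg.prodMk hf)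
  exact h2

/-- The image of `d_*ξ dη` under `(ξ, η) ↦ ξη`. -/
theorem map_stiefel_mul (hm : m ≤ n - k) :
    Measure.map (fun q : Stiefel n (n - k) × Mat (n - k) m => q.1.1 * q.2)
        ((stiefelMeasure n k).prod volume) =
      ENNReal.ofReal (polarConst (n - k) m / polarConst n m) •
        (volume : Measure (Mat n m)).withDensity fun Y =>
          ENNReal.ofReal ((Y.transpose * Y).det ^ ((((n - k : ℕ) : ℝ) - n) / 2)) := by
  refine Measure.ext_of_lintegral _ fun F hF => ?_
  have hd : Measurable fun Y : Mat n m =>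
      ENNReal.ofReal ((Y.transpose * Y).det ^ ((((n - k : ℕ) : ℝ) - n) / 2)) :=
    (measurable_ofReal_det_rpow _).comp measurable_gram
  have hmul : Measurable fun q : Stiefel n (n - k) × Mat (n - k) m => q.1.1 * q.2 :=
    measurable_stiefel_mul measurable_fst measurable_snd
  have hFm : Measurable fun q : Stiefel n (n - k) × Mat (n - k) m => F (q.1.1 * q.2) :=
    hF.comp hmul
  rw [lintegral_map hF hmul, lintegral_prod _ hFm.aemeasurable, lintegral_smul_measure, lintegral_withDensity_eq_lintegral_mul _ hd hF, stiefelMeasure,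
    lintegral_map hFm.lintegral_prod_right' continuous_orbitMap.measurable]
  have h := lintegral_orthHaar_frame hm (Nat.sub_le n k) (stiefelBase n k).2 hF
  refine Eq.trans (lintegral_congr fun γ => lintegral_congr fun η => ?_) h
  rw [← Matrix.mul_assoc]
  rfl

end Orthogonal

/-! ### Integrals over the cone and the truncated constant -/

section ConeIntegral

variable {n m p k : ℕ}

theorem continuous_matFourier {w : Mat p m → ℂ} (hw : Integrable w) :
    Continuous (matFourier w) := by
  unfold matFourier
  have htr (x : Mat p m) : Continuous fun y : Mat p m => (y.transpose * x).trace :=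
    (continuous_id.matrix_transpose.matrix_mul continuous_const).matrix_trace
  have htr' (y : Mat p m) : Continuous fun x : Mat p m => (y.transpose * x).trace :=
    (continuous_const.matrix_mul continuous_id).matrix_trace
  refine continuous_of_dominated (bound := fun x => ‖w x‖) (fun y => ?_) (fun y => ?_) hw.norm ?_
  · refine Continuous.aestronglyMeasurable ?_ |>.mul hw.aestronglyMeasurable
    exact Complex.continuous_exp.comp
      (continuous_const.mul (Complex.continuous_ofReal.comp (htr' y)))
  · refine Eventually.of_forall fun x => ?_
    rw [norm_mul, mul_comm Complex.I, Complex.norm_exp_ofReal_mul_I, one_mul]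
  · refine Eventually.of_forall fun x => ?_
    exact (Complex.continuous_exp.comp
      (continuous_const.mul (Complex.continuous_ofReal.comp (htr x)))).mul continuous_const

theorem norm_matFourier_le (w : Mat p m → ℂ) (y : Mat p m) :
    ‖matFourier w y‖ ≤ ∫ x, ‖w x‖ := by
  refine (norm_integral_le_integral_norm _).trans_eq ?_
  refine integral_congr_ae (Eventually.of_forall fun x => ?_)
  simp only
  rw [norm_mul, mul_comm Complex.I, Complex.norm_exp_ofReal_mul_I, one_mul]

theorem gram_stdFrame_mul (hmp : m ≤ p) {r : Mat m m} (hr : r.PosSemidef) :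
    (stdFrame p m * matSqrt r).transpose * (stdFrame p m * matSqrt r) = r := by
  rw [Matrix.transpose_mul, Matrix.mul_assoc, ← Matrix.mul_assoc _ (stdFrame p m),
    transpose_stdFrame_mul_self hmp, Matrix.one_mul, transpose_matSqrt, matSqrt_mul_self hr]

theorem posDef_matSqrt_mul_mul {r s : Mat m m} (hr : r.PosDef) (hs : s.PosDef) :
    (matSqrt s * r * matSqrt s).PosDef := by
  have := (posDef_congr_iff (r := r) (det_matSqrt_pos hs).ne').2 hr
  rwa [transpose_matSqrt] at this

/-- A radial Fourier transform is a bounded measurable function of the Gram matrix. -/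
theorem exists_measurable_profile (hmp : m ≤ p) {w : Mat p m → ℂ} (hw : Integrable w)
    (hs : ∃ u₀ : Mat m m → ℂ, IsSymmetricOnCone u₀ ∧
      ∀ y, matFourier w y = u₀ (y.transpose * y)) :
    ∃ g : Mat m m → ℂ, Measurable g ∧ IsSymmetricOnCone g ∧
      (∀ y, matFourier w y = g (y.transpose * y)) ∧ ∀ r, ‖g r‖ ≤ ∫ x, ‖w x‖ := by
  obtain ⟨u₀, hsym, hu⟩ := hs
  -- The given profile `u₀` need not be measurable. The matrix `[I; 0] r^{1/2}` has Gram matrix `r`,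
  -- so evaluating the continuous function `ŵ` there gives a measurable and bounded profile that
  -- agrees with `u₀` on positive semidefinite matrices.
  refine ⟨fun r => matFourier w (stdFrame p m * matSqrt r), ?_, ?_, ?_,
    fun r => norm_matFourier_le _ _⟩
  · exact (continuous_matFourier hw).measurable.comp
      ((continuous_const.matrix_mul continuous_id).measurable.comp measurable_matSqrt)
  · intro r s hr hs
    simp only [hu, gram_stdFrame_mul hmp (posDef_matSqrt_mul_mul hr hs).posSemidef,
      gram_stdFrame_mul hmp (posDef_matSqrt_mul_mul hs hr).posSemidef]
    exact hsym r s hr hs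
  · intro y
    simp only [hu, gram_stdFrame_mul hmp (posSemidef_transpose_mul_self y)]

theorem integral_comp_measurePreserving {α β : Type*} [MeasurableSpace α] [MeasurableSpace β]
    {μ : Measure α} {ν : Measure β} {f : α → β} (hf : MeasurePreserving f μ ν)
    {h : β → ℂ} (hh : AEStronglyMeasurable h ν) : ∫ a, h (f a) ∂μ = ∫ b, h b ∂ν := by
  rw [← hf.map_eq] at hh ⊢
  exact (integral_map hf.measurable.aemeasurable hh).symm

theorem integral_gram (hmp : m ≤ p) {h : Mat m m → ℂ} (hh : Measurable h) :
    ∫ z : Mat p m, h (z.transpose * z) =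
      (polarConst p m : ℂ) * ∫ r, ((r.det ^ ((p : ℝ) / 2) : ℝ) : ℂ) * h r ∂(coneInvMeasure m) := by
  rw [← integral_map (φ := fun z : Mat p m => z.transpose * z) (f := h)
    measurable_gram.aemeasurable hh.aestronglyMeasurable, map_gram_volume hmp,
    integral_smul_measure, ENNReal.toReal_ofReal (polarConst_pos hmp).le,
    integral_withDensity_eq_integral_toReal_smul (measurable_ofReal_det_rpow _)
      (Eventually.of_forall fun _ => ENNReal.ofReal_lt_top), Complex.real_smul]
  congr 1
  refine integral_congr_ae ?_
  filter_upwards [ae_coneInvMeasure_posDef] with r hr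
  rw [ENNReal.toReal_ofReal (Real.rpow_pos_of_pos hr.det_pos _).le, Complex.real_smul]

/-- Polar coordinates on the `(n-k) × m` matrices: the exponents combine to `(n-k)/2 - n/2 = -k/2`.
As `σ_{n,m}` is `2^m` times the polar constant, the prefactor `2^{m(k+1)} π^{km}` reduces to
`(2π)^{km}`. -/
theorem truncConst_eq (hmp : m ≤ n - k) (hkn : k ≤ n) {G : Mat (n - k) m → ℂ} {g : Mat m m → ℂ}
    (hg : Measurable g) (hG : ∀ y, G y = g (y.transpose * y)) (A B : Mat m m) :
    truncConst n k m G A B =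
      (((2 * Real.pi) ^ (k * m) * polarConst (n - k) m / polarConst n m : ℝ) : ℂ) *
        ∫ r in coneInterval A B, ((r.det ^ (-(k : ℝ) / 2) : ℝ) : ℂ) * g r ∂(coneInvMeasure m) := by
  have hI := measurableSet_coneInterval A B
  have hcn : polarConst n m ≠ 0 := (polarConst_pos (hmp.trans (Nat.sub_le n k))).ne'
  let h : Mat m m → ℂ := (coneInterval A B).indicator fun r =>
    g r / (((Real.sqrt r.det) ^ n : ℝ) : ℂ)
  have hh : Measurable h := (hg.div (Complex.measurable_ofReal.comp
    ((Real.continuous_sqrt.measurable.comp measurable_det).pow_const n))).indicator hI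
  have h1 : ∫ ζ in {ζ : Mat (n - k) m | ζ.transpose * ζ ∈ coneInterval A B},
      G ζ / ((detNorm ζ ^ n : ℝ) : ℂ) = ∫ ζ : Mat (n - k) m, h (ζ.transpose * ζ) := by
    have hS : MeasurableSet {ζ : Mat (n - k) m | ζ.transpose * ζ ∈ coneInterval A B} :=
      measurable_gram hI
    rw [← integral_indicator hS]
    refine integral_congr_ae (Eventually.of_forall fun ζ => ?_)
    simp only [h, hG, detNorm]
    rfl
  have h2 : ∀ᵐ r ∂(coneInvMeasure m),
      (((r.det ^ (((n - k : ℕ) : ℝ) / 2) : ℝ) : ℂ) * h r) =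
      (coneInterval A B).indicator
        (fun r => ((r.det ^ (-(k : ℝ) / 2) : ℝ) : ℂ) * g r) r := by
    filter_upwards [ae_coneInvMeasure_posDef] with r hr
    by_cases hrI : r ∈ coneInterval A B
    · simp only [h, Set.indicator_of_mem hrI]
      have e1 : Real.sqrt r.det ^ n = r.det ^ ((n : ℝ) / 2) := by
        rw [Real.sqrt_eq_rpow, ← Real.rpow_natCast, ← Real.rpow_mul hr.det_pos.le]
        congr 1; ring
      have e2 : r.det ^ (((n - k : ℕ) : ℝ) / 2) = r.det ^ (-(k : ℝ) / 2) * r.det ^ ((n : ℝ) / 2) := by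
        rw [← Real.rpow_add hr.det_pos, Nat.cast_sub hkn]
        congr 1; ring
      have e3 : ((r.det ^ ((n : ℝ) / 2) : ℝ) : ℂ) ≠ 0 :=
        Complex.ofReal_ne_zero.2 (Real.rpow_pos_of_pos hr.det_pos _).ne'
      rw [e1, e2, Complex.ofReal_mul]
      field_simp
    · simp only [h, Set.indicator_of_notMem hrI, mul_zero]
  rw [truncConst, h1, integral_gram hmp hh, integral_congr_ae h2, integral_indicator hI, ← mul_assoc,
    ← Complex.ofReal_mul]
  congr 2
  have : stiefelMass n m = 2 ^ m * polarConst n m := by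
    rw [polarConst_eq_stiefelMass]; field_simp
  rw [this, mul_pow, mul_add, pow_add, mul_one, mul_comm m k]
  field_simp

/-- The truncated constant at `r` as an integral over a fixed interval. -/
theorem truncConst_smul_eq (hmp : m ≤ n - k) (hkn : k ≤ n) {G : Mat (n - k) m → ℂ}
    {g : Mat m m → ℂ} (hg : Measurable g) (hG : ∀ y, G y = g (y.transpose * y))
    (hsym : IsSymmetricOnCone g) {r : Mat m m} (hr : r.PosDef) (ε ρ : ℝ) :
    truncConst n k m G (ε • r) (ρ • r) =
      (((2 * Real.pi) ^ (k * m) * polarConst (n - k) m / polarConst n m *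
          r.det ^ (-(k : ℝ) / 2) : ℝ) : ℂ) *
        ∫ a in coneInterval (ε • (1 : Mat m m)) (ρ • (1 : Mat m m)),
          ((a.det ^ (-(k : ℝ) / 2) : ℝ) : ℂ) * g (matSqrt a * r * matSqrt a)
          ∂(coneInvMeasure m) := by
  set s := matSqrt r
  have hs : 0 < s.det := det_matSqrt_pos hr
  have hst : s.transpose = s := transpose_matSqrt r
  have hss : s * s = r := matSqrt_mul_self hr.posSemidef
  have hI := measurableSet_coneInterval (ε • r) (ρ • r)
  have hmem (a : Mat m m) : s.transpose * a * s ∈ coneInterval (ε • r) (ρ • r) ↔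
      a ∈ coneInterval (ε • (1 : Mat m m)) (ρ • (1 : Mat m m)) := by
    rw [← mem_coneInterval_congr_iff (A := ε • 1) hs.ne']
    have e (c : ℝ) : s.transpose * (c • 1) * s = c • r := by
      rw [hst, Matrix.mul_smul, Matrix.mul_one, Matrix.smul_mul, hss]
    rw [e, e]
  let H : Mat m m → ℂ := (coneInterval (ε • r) (ρ • r)).indicator
    fun r => ((r.det ^ (-(k : ℝ) / 2) : ℝ) : ℂ) * g r
  have hH : Measurable H := ((Complex.measurable_ofReal.comp
    (measurable_det.pow_const _)).mul hg).indicator hI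
  rw [truncConst_eq hmp hkn hg hG, ← integral_indicator hI,
    ← integral_indicator (measurableSet_coneInterval _ _), Complex.ofReal_mul, mul_assoc]
  congr 1
  rw [← integral_const_mul]
  -- Substitute `r^{1/2} a r^{1/2}` for the variable of integration. The symmetry condition on `g`
  -- then rewrites `g(r^{1/2} a r^{1/2})` as `g(a^{1/2} r a^{1/2})`, the form in which the scale `a`
  -- acts on the frequency.
  refine (integral_comp_measurePreserving (map_congr_coneInvMeasure s hs.ne')
    hH.aestronglyMeasurable).symm.trans (integral_congr_ae ?_)
  filter_upwards [ae_coneInvMeasure_posDef] with a ha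
  by_cases haI : a ∈ coneInterval (ε • (1 : Mat m m)) (ρ • (1 : Mat m m))
  · simp only [H]
    rw [Set.indicator_of_mem ((hmem a).2 haI), Set.indicator_of_mem haI, hst,
      hsym r a hr ha, ← mul_assoc, ← Complex.ofReal_mul]
    have e : (s * a * s).det = r.det * a.det := by
      rw [← hss, Matrix.det_mul, Matrix.det_mul, Matrix.det_mul]; ring
    rw [e, Real.mul_rpow hr.det_pos.le ha.det_pos.le]
  · simp only [H]
    rw [Set.indicator_of_notMem (fun h => haI ((hmem a).1 h)), Set.indicator_of_notMem haI,
      mul_zero]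

end ConeIntegral

/-! ### Fourier multipliers on square integrable functions -/

section Multiplier

open scoped FourierTransform SchwartzMap ContDiff InnerProductSpace

variable {V : Type*} [NormedAddCommGroup V] [InnerProductSpace ℝ V] [FiniteDimensional ℝ V]
  [MeasurableSpace V] [BorelSpace V]

theorem continuous_fourier {f : V → ℂ} (hf : Integrable f) : Continuous (𝓕 f) :=
  VectorFourier.fourierIntegral_continuous Real.continuous_fourierChar
    (by exact continuous_inner) hf

/-- A real test function as a complex Schwartz function. -/
noncomputable def testSchwartz {g : V → ℝ} (hg : ContDiff ℝ ∞ g) (hgc : HasCompactSupport g) :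
    𝓢(V, ℂ) :=
  HasCompactSupport.toSchwartzMap (f := fun x => (g x : ℂ))
    (hgc.comp_left Complex.ofReal_zero) (Complex.ofRealCLM.contDiff.comp hg)

theorem integral_testSchwartz_smul {g : V → ℝ} (hg : ContDiff ℝ ∞ g) (hgc : HasCompactSupport g)
    (F : V → ℂ) : ∫ x, testSchwartz hg hgc x • F x = ∫ x, g x • F x := by
  refine integral_congr_ae (Eventually.of_forall fun x => ?_)
  change ((g x : ℂ)) • F x = g x • F x
  rw [Complex.real_smul, smul_eq_mul]

/-- The Fourier transform of `L²` extends the Fourier integral. -/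
theorem coeFn_fourier_toLp {f : V → ℂ} (hf : Integrable f) (hf2 : MemLp f 2) :
    (𝓕 (hf2.toLp f) : Lp ℂ 2 (volume : Measure V)) =ᵐ[volume] 𝓕 f := by
  refine ae_eq_of_integral_contDiff_smul_eq ?_ (continuous_fourier hf).locallyIntegrable ?_
  · exact (Lp.memLp _).locallyIntegrable (by norm_num)
  intro g hg hgc
  -- The `L²` transform agrees with that of tempered distributions, which is defined by duality; the
  -- integral transform satisfies the same duality by Fubini (`h2`).
  have h1 := congrArg (fun T : 𝓢'(V, ℂ) => T (testSchwartz hg hgc))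
    (Lp.fourier_toTemperedDistribution_eq (hf2.toLp f))
  simp only [TemperedDistribution.fourier_apply, Lp.toTemperedDistribution_apply] at h1
  have h2 := VectorFourier.integral_fourierIntegral_smul_eq_flip (L := innerₗ V) (μ := volume)
    (ν := volume) Real.continuous_fourierChar continuous_inner
    (testSchwartz hg hgc).integrable hf
  have h3 : ∫ x, (𝓕 (testSchwartz hg hgc)) x • f x = ∫ x, testSchwartz hg hgc x • (𝓕 f) x := by
    simpa using! h2
  refine (integral_testSchwartz_smul hg hgc _).symm.trans (Eq.trans ?_
    (h3.trans (integral_testSchwartz_smul hg hgc _)))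
  rw [← h1]
  refine integral_congr_ae ?_
  filter_upwards [hf2.coeFn_toLp] with x hx
  rw [hx]

/-- A bounded Fourier multiplier applied to an integrable and square integrable function. -/
theorem exists_multiplier {f M : V → ℂ} (hf : Integrable f) (hf2 : MemLp f 2)
    (hM : Measurable M) {C : ℝ} (hC : ∀ y, ‖M y‖ ≤ C) :
    ∃ T : V → ℂ, MemLp T 2 ∧ MemLp (𝓕 f) 2 ∧
      (∀ g : V → ℝ, ContDiff ℝ ∞ g → HasCompactSupport g →
        ∫ x, g x • T x = ∫ Y, 𝓕⁻ (fun x => (g x : ℂ)) Y * (M Y * 𝓕 f Y)) ∧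
      ∀ c : ℂ, eLpNorm (fun x => T x - c * f x) 2 volume =
        eLpNorm (fun Y => (M Y - c) * 𝓕 f Y) 2 volume := by
  have hφ : MemLp (𝓕 f) 2 := (memLp_congr_ae (coeFn_fourier_toLp hf hf2)).1 (Lp.memLp _)
  have hMφ : MemLp (fun Y => M Y * 𝓕 f Y) 2 := by
    refine hφ.of_le_mul (c := C) (hM.aestronglyMeasurable.mul hφ.aestronglyMeasurable) ?_
    refine Eventually.of_forall fun Y => ?_
    rw [norm_mul]
    exact mul_le_mul_of_nonneg_right (hC Y) (norm_nonneg _)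
  -- The function `T` is the inverse `L²` transform of `M · 𝓕 f`. The pairing with `g` is duality,
  -- and the norm identity is Plancherel applied to `T - c f`.
  refine ⟨(𝓕⁻ (hMφ.toLp _) : Lp ℂ 2 (volume : Measure V)), Lp.memLp _, hφ, ?_, ?_⟩
  · intro g hg hgc
    have h1 := congrArg (fun T : 𝓢'(V, ℂ) => T (testSchwartz hg hgc))
      (Lp.fourierInv_toTemperedDistribution_eq (hMφ.toLp _))
    simp only [TemperedDistribution.fourierInv_apply, Lp.toTemperedDistribution_apply] at h1
    rw [← integral_testSchwartz_smul hg hgc, ← h1]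
    have hGeq : ⇑(𝓕⁻ (testSchwartz hg hgc) : 𝓢(V, ℂ)) = 𝓕⁻ (fun x => (g x : ℂ)) :=
      SchwartzMap.fourierInv_coe _
    refine integral_congr_ae ?_
    filter_upwards [hMφ.coeFn_toLp] with Y hY
    rw [hY, hGeq, smul_eq_mul]
  · intro c
    have h1 : eLpNorm (fun x => (𝓕⁻ (hMφ.toLp _) : Lp ℂ 2 (volume : Measure V)) x - c * f x) 2
        volume = ‖(𝓕⁻ (hMφ.toLp _) - c • hf2.toLp f : Lp ℂ 2 (volume : Measure V))‖ₑ := by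
      rw [Lp.enorm_def]
      refine eLpNorm_congr_ae ?_
      filter_upwards [Lp.coeFn_sub (𝓕⁻ (hMφ.toLp _) : Lp ℂ 2 (volume : Measure V))
        (c • hf2.toLp f), Lp.coeFn_smul c (hf2.toLp f), hf2.coeFn_toLp] with x h1 h2 h3
      rw [h1, Pi.sub_apply, h2, Pi.smul_apply, h3, smul_eq_mul]
    have h2 : ‖(𝓕⁻ (hMφ.toLp _) - c • hf2.toLp f : Lp ℂ 2 (volume : Measure V))‖ₑ =
        ‖(hMφ.toLp _ - c • 𝓕 (hf2.toLp f) : Lp ℂ 2 (volume : Measure V))‖ₑ := by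
      rw [← ofReal_norm, ← ofReal_norm, ← Lp.norm_fourier_eq, sub_eq_add_neg,
        FourierTransform.fourier_add, FourierTransform.fourier_neg,
        FourierTransform.fourier_smul, FourierTransform.fourier_fourierInv_eq, ← sub_eq_add_neg]
    rw [h1, h2, Lp.enorm_def]
    refine eLpNorm_congr_ae ?_
    filter_upwards [Lp.coeFn_sub (hMφ.toLp _) (c • 𝓕 (hf2.toLp f)),
      Lp.coeFn_smul c (𝓕 (hf2.toLp f) : Lp ℂ 2 (volume : Measure V)), hMφ.coeFn_toLp,
      coeFn_fourier_toLp hf hf2] with x h1 h2 h3 h4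
    rw [h1, Pi.sub_apply, h2, Pi.smul_apply, h3, h4, smul_eq_mul]
    ring

end Multiplier

/-! ### The Fourier transform on matrices and on Euclidean space -/

section Transport

open scoped FourierTransform SchwartzMap ContDiff InnerProductSpace

variable {n m p k : ℕ}

/-- Matrices as Euclidean vectors. -/
noncomputable def matE (n m : ℕ) : Mat n m ≃L[ℝ] EuclideanSpace ℝ (Fin n × Fin m) :=
  (vecEquiv n m).trans (PiLp.continuousLinearEquiv 2 ℝ (fun _ : Fin n × Fin m => ℝ)).symm

theorem measurePreserving_matE : MeasurePreserving (matE n m) :=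
  (PiLp.volume_preserving_toLp (Fin n × Fin m)).comp volume_preserving_vecEquiv

theorem measurableEmbedding_matE : MeasurableEmbedding (matE n m) :=
  (matE n m).toHomeomorph.measurableEmbedding

theorem measurePreserving_matE_symm : MeasurePreserving (matE n m).symm :=
  measurePreserving_matE.symm (matE n m).toHomeomorph.toMeasurableEquiv

theorem measurableEmbedding_matE_symm : MeasurableEmbedding (matE n m).symm :=
  (matE n m).symm.toHomeomorph.measurableEmbedding

theorem inner_matE (Y x : Mat n m) :
    ⟪matE n m Y, matE n m x⟫_ℝ = (Y.transpose * x).trace := by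
  rw [PiLp.inner_apply, Fintype.sum_prod_type, Finset.sum_comm]
  simp only [Matrix.trace, Matrix.diag, Matrix.mul_apply, Matrix.transpose_apply]
  refine Finset.sum_congr rfl fun j _ => Finset.sum_congr rfl fun i _ => ?_
  change x i j * Y i j = _
  ring

theorem norm_matE_sq (x : Mat n m) : ‖matE n m x‖ ^ 2 = (x.transpose * x).trace := by
  rw [← inner_matE, real_inner_self_eq_norm_sq]

/-- The Euclidean transform has kernel `e^{±2πi⟨x,y⟩}` and `matFourier` has `e^{i tr(y'x)}`. The
factors `2π`, and the minus sign in the next theorem, all come from this. -/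
theorem fourierInv_matE (F : Mat n m → ℂ) (Y : Mat n m) :
    𝓕⁻ (F ∘ (matE n m).symm) (matE n m Y) = matFourier F ((2 * Real.pi) • Y) := by
  rw [Real.fourierInv_eq', matFourier,
    ← measurePreserving_matE.integral_comp measurableEmbedding_matE]
  refine integral_congr_ae (Eventually.of_forall fun x => ?_)
  simp only [Function.comp, ContinuousLinearEquiv.symm_apply_apply, real_inner_comm, inner_matE,
    smul_eq_mul, Matrix.transpose_smul, Matrix.smul_mul, Matrix.trace_smul]
  rw [mul_comm Complex.I]

theorem fourier_matE (F : Mat n m → ℂ) (Y : Mat n m) :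
    𝓕 (F ∘ (matE n m).symm) (matE n m Y) = matFourier F (-(2 * Real.pi) • Y) := by
  rw [← neg_neg (matE n m Y), ← Real.fourierInv_eq_fourier_neg, ← map_neg, fourierInv_matE,
    smul_neg, neg_smul]

/-- Smooth compactly supported functions of a matrix. -/
def IsTest (g : Mat n m → ℝ) : Prop :=
  ContDiff ℝ ∞ (g ∘ (matE n m).symm) ∧ HasCompactSupport g

theorem IsTest.hasCompactSupport_comp {g : Mat n m → ℝ} (hg : IsTest g) :
    HasCompactSupport (g ∘ (matE n m).symm) :=
  hg.2.comp_homeomorph (matE n m).symm.toHomeomorph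

theorem IsTest.continuous {g : Mat n m → ℝ} (hg : IsTest g) : Continuous g := by
  have := hg.1.continuous.comp (matE n m).continuous
  convert! this using 1

theorem ae_eq_of_integral_isTest {F G : Mat n m → ℂ} (hF : LocallyIntegrable F)
    (hG : LocallyIntegrable G)
    (h : ∀ g : Mat n m → ℝ, IsTest g → ∫ x, g x • F x = ∫ x, g x • G x) : F =ᵐ[volume] G := by
  have hloc {F : Mat n m → ℂ} (hF : LocallyIntegrable F) :
      LocallyIntegrable (F ∘ (matE n m).symm) := by
    rw [locallyIntegrable_iff] at hF ⊢
    intro K hK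
    have h1 := hF ((matE n m).symm '' K) (hK.image (matE n m).symm.continuous)
    rwa [← measurePreserving_matE_symm.integrableOn_image measurableEmbedding_matE_symm]
  have h1 : F ∘ (matE n m).symm =ᵐ[volume] G ∘ (matE n m).symm := by
    refine ae_eq_of_integral_contDiff_smul_eq (hloc hF) (hloc hG) fun g hg hgc => ?_
    have hT : IsTest (g ∘ matE n m) := by
      refine ⟨?_, hgc.comp_homeomorph (matE n m).toHomeomorph⟩
      convert! hg using 1
    have h2 := h _ hT
    rw [← measurePreserving_matE.integral_comp measurableEmbedding_matE,
      ← measurePreserving_matE.integral_comp measurableEmbedding_matE]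
    simpa using h2
  have h2 := measurePreserving_matE.quasiMeasurePreserving.ae_eq_comp h1
  filter_upwards [h2] with x hx
  simpa using hx

theorem exists_matrix_multiplier {f M : Mat n m → ℂ} (hf : Integrable f) (hf2 : MemLp f 2)
    (hM : Measurable M) {C : ℝ} (hC : ∀ y, ‖M y‖ ≤ C) :
    ∃ T : Mat n m → ℂ, MemLp T 2 ∧
      MemLp (fun Y : Mat n m => matFourier f (-(2 * Real.pi) • Y)) 2 ∧
      (∀ g : Mat n m → ℝ, IsTest g →
        ∫ x, g x • T x = ∫ Y : Mat n m,
          matFourier (fun x => (g x : ℂ)) ((2 * Real.pi) • Y) *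
            (M Y * matFourier f (-(2 * Real.pi) • Y))) ∧
      ∀ c : ℂ, eLpNorm (fun x => T x - c * f x) 2 volume =
        eLpNorm (fun Y : Mat n m => (M Y - c) * matFourier f (-(2 * Real.pi) • Y)) 2 volume := by
  have hs := measurePreserving_matE_symm (n := n) (m := m)
  obtain ⟨T, hT, hφ, hpair, hnorm⟩ := exists_multiplier
    ((hs.integrable_comp_emb measurableEmbedding_matE_symm).2 hf)
    (hf2.comp_measurePreserving hs) (hM.comp hs.measurable) (fun y => hC _)
  have hφ' : (fun Y : Mat n m => matFourier f (-(2 * Real.pi) • Y)) =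
      𝓕 (f ∘ (matE n m).symm) ∘ matE n m := by
    ext Y
    rw [Function.comp, fourier_matE]
  refine ⟨T ∘ matE n m, hT.comp_measurePreserving measurePreserving_matE, ?_, ?_, ?_⟩
  · rw [hφ']
    exact hφ.comp_measurePreserving measurePreserving_matE
  · intro g hg
    have h1 := hpair _ hg.1 hg.hasCompactSupport_comp
    rw [← measurePreserving_matE.integral_comp measurableEmbedding_matE,
      ← measurePreserving_matE.integral_comp measurableEmbedding_matE] at h1
    simp only [Function.comp, ContinuousLinearEquiv.symm_apply_apply] at h1 ⊢
    rw [h1]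
    refine integral_congr_ae (Eventually.of_forall fun Y => ?_)
    simp only
    rw [← fourierInv_matE, ← fourier_matE]
    rfl
  · intro c
    have h1 := hnorm c
    rw [← eLpNorm_comp_measurePreserving (f := matE n m) ?_ measurePreserving_matE,
      ← eLpNorm_comp_measurePreserving (f := matE n m) ?_ measurePreserving_matE] at h1
    · convert! h1 using 2
      · ext x
        simp only [Function.comp_apply, ContinuousLinearEquiv.symm_apply_apply]
        rw [← fourier_matE]
    · exact ((hM.comp hs.measurable).aestronglyMeasurable.sub aestronglyMeasurable_const).mul
        hφ.aestronglyMeasurable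
    · exact hT.aestronglyMeasurable.sub (aestronglyMeasurable_const.mul
        (hf2.comp_measurePreserving hs).aestronglyMeasurable)

/-- Fourier inversion on the space of matrices. -/
theorem eq_integral_matFourier {h : Mat p m → ℂ} (hc : Continuous h) (hi : Integrable h)
    (hF : Integrable fun η : Mat p m => matFourier h ((2 * Real.pi) • η)) (τ : Mat p m) :
    h τ = ∫ η : Mat p m, matFourier h ((2 * Real.pi) • η) *
      Complex.exp (-(2 * Real.pi * Complex.I) * ((η.transpose * τ).trace : ℂ)) := by
  have hs := measurePreserving_matE_symm (n := p) (m := m)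
  have h1 : (fun η : Mat p m => matFourier h ((2 * Real.pi) • η)) =
      𝓕⁻ (h ∘ (matE p m).symm) ∘ matE p m := by
    ext Y
    rw [Function.comp, fourierInv_matE]
  rw [h1, measurePreserving_matE.integrable_comp_emb measurableEmbedding_matE] at hF
  have hi' := (hs.integrable_comp_emb measurableEmbedding_matE_symm).2 hi
  have hF' : Integrable (𝓕 (h ∘ (matE p m).symm)) := by
    have := hF.comp_neg
    refine this.congr (Eventually.of_forall fun x => ?_)
    simp only
    rw [Real.fourierInv_eq_fourier_neg, neg_neg]
  have h2 := Continuous.fourier_fourierInv_eq (hc.comp (matE p m).symm.continuous) hi' hF'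
  have h3 := congrFun h2 (matE p m τ)
  rw [Real.fourier_eq', ← measurePreserving_matE.integral_comp measurableEmbedding_matE] at h3
  simp only [Function.comp_apply, ContinuousLinearEquiv.symm_apply_apply] at h3
  rw [← h3]
  refine integral_congr_ae (Eventually.of_forall fun η => ?_)
  simp only
  rw [fourierInv_matE, inner_matE, smul_eq_mul, mul_comm]
  congr 2
  push_cast
  ring

/-- The Fourier transform of a test function is rapidly decreasing. -/
theorem IsTest.exists_decay {g : Mat n m → ℝ} (hg : IsTest g) (N : ℕ) :
    ∃ C : ℝ, ∀ Y : Mat n m, ‖matFourier (fun x => (g x : ℂ)) ((2 * Real.pi) • Y)‖ ≤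
      C * (1 + ‖matE n m Y‖) ^ (-(N : ℝ)) := by
  set G : 𝓢(EuclideanSpace ℝ (Fin n × Fin m), ℂ) :=
    𝓕⁻ (testSchwartz hg.1 hg.hasCompactSupport_comp)
  refine ⟨2 ^ N * (Finset.Iic (N, 0)).sup (schwartzSeminormFamily ℝ _ ℂ) G, fun Y => ?_⟩
  have h1 := G.one_add_le_sup_seminorm_apply (𝕜 := ℝ) (m := (N, 0)) (k := N) (n := 0) le_rfl
    le_rfl (matE n m Y)
  rw [norm_iteratedFDeriv_zero] at h1
  have h2 : G (matE n m Y) = matFourier (fun x => (g x : ℂ)) ((2 * Real.pi) • Y) := by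
    rw [← fourierInv_matE, SchwartzMap.fourierInv_coe]
    rfl
  have h3 : 0 < 1 + ‖matE n m Y‖ := by positivity
  rw [Real.rpow_neg h3.le, Real.rpow_natCast, ← div_eq_mul_inv, le_div_iff₀ (by positivity),
    ← h2, mul_comm]
  exact h1

theorem integrable_decay (p m : ℕ) :
    Integrable fun η : Mat p m => (1 + ‖matE p m η‖) ^ (-((p * m + 1 : ℕ) : ℝ)) := by
  have := integrable_one_add_norm (E := EuclideanSpace ℝ (Fin p × Fin m)) (μ := volume)
    (r := ((p * m + 1 : ℕ) : ℝ)) (by simp)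
  exact (measurePreserving_matE.integrable_comp_emb measurableEmbedding_matE).2 this

end Transport

/-! ### Integration over the fibres of a frame -/

section Fibre

variable {n m p k : ℕ}

/-- Stacking a `p × m` matrix on top of a `k × m` matrix. -/
noncomputable def stack (h : p + k = n) : Mat p m × Mat k m ≃ᵐ Mat n m :=
  (MeasurableEquiv.sumPiEquivProdPi (fun _ : Fin p ⊕ Fin k => Fin m → ℝ)).symm.trans
    (MeasurableEquiv.piCongrLeft (fun _ : Fin n => Fin m → ℝ)
      (finSumFinEquiv.trans (finCongr h)))

theorem stack_inl (h : p + k = n) (q : Mat p m × Mat k m) (i : Fin p) (j : Fin m) :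
    stack h q (finCongr h (Fin.castAdd k i)) j = q.1 i j := by
  have := Equiv.piCongrLeft_apply_apply (fun _ : Fin n => Fin m → ℝ)
    (finSumFinEquiv.trans (finCongr h))
    ((MeasurableEquiv.sumPiEquivProdPi (fun _ : Fin p ⊕ Fin k => Fin m → ℝ)).symm q) (Sum.inl i)
  exact congrFun this j

theorem stack_inr (h : p + k = n) (q : Mat p m × Mat k m) (i : Fin k) (j : Fin m) :
    stack h q (finCongr h (Fin.natAdd p i)) j = q.2 i j := by
  have := Equiv.piCongrLeft_apply_apply (fun _ : Fin n => Fin m → ℝ)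
    (finSumFinEquiv.trans (finCongr h))
    ((MeasurableEquiv.sumPiEquivProdPi (fun _ : Fin p ⊕ Fin k => Fin m → ℝ)).symm q) (Sum.inr i)
  exact congrFun this j

theorem measurePreserving_stack (h : p + k = n) :
    MeasurePreserving (stack (m := m) h) (volume.prod volume) volume :=
  (volume_measurePreserving_piCongrLeft (fun _ : Fin n => Fin m → ℝ) _).comp
    (volume_measurePreserving_sumPiEquivProdPi_symm (fun _ : Fin p ⊕ Fin k => Fin m → ℝ))

theorem continuous_stack (h : p + k = n) : Continuous (stack (m := m) h) := by
  refine continuous_pi fun i => continuous_pi fun j => ?_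
  obtain ⟨s, rfl⟩ := (finSumFinEquiv.trans (finCongr h)).surjective i
  rcases s with s | s
  · have : (fun q : Mat p m × Mat k m => stack h q
        ((finSumFinEquiv.trans (finCongr h)) (Sum.inl s)) j) = fun q => q.1 s j := by
      ext q
      exact stack_inl h q s j
    rw [this]
    exact continuous_fst.matrix_elem s j
  · have : (fun q : Mat p m × Mat k m => stack h q
        ((finSumFinEquiv.trans (finCongr h)) (Sum.inr s)) j) = fun q => q.2 s j := by
      ext q
      exact stack_inr h q s j
    rw [this]
    exact continuous_snd.matrix_elem s j

theorem stdFrame_transpose_mul_stack (h : p + k = n) (q : Mat p m × Mat k m) :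
    (stdFrame n p).transpose * stack h q = q.1 := by
  ext i j
  rw [Matrix.mul_apply, Finset.sum_eq_single (finCongr h (Fin.castAdd k i)), stack_inl]
  · simp [stdFrame]
  · intro b _ hb
    have : (b : ℕ) ≠ i := fun hbi => hb (Fin.ext (by simpa using hbi))
    simp [stdFrame, this]
  · simp

/-- Coordinates on the space of matrices adapted to a frame. -/
theorem exists_frame_coordinates (h : p + k = n) (m : ℕ) {ξ : Mat n p}
    (hξ : ξ.transpose * ξ = 1) :
    ∃ Θ : Mat p m × Mat k m → Mat n m, Continuous Θ ∧ MeasurableEmbedding Θ ∧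
      MeasurePreserving Θ (volume.prod volume) volume ∧ (∀ q, ξ.transpose * Θ q = q.1) ∧
      ∀ q i j, q.2 i j ^ 2 ≤ ((Θ q).transpose * Θ q).trace := by
  -- Complete the frame `ξ` to an orthogonal matrix `γ` and take `Θ(τ, z) = γ [τ; z]`. Then `τ =
  -- ξ'Θ`, and `z` parametrises the fibre.
  obtain ⟨γ, rfl⟩ := exists_orthGroup_mul_stdFrame (by omega : p ≤ n) hξ
  have hγ : (γ : Mat n n).transpose * (γ : Mat n n) = 1 :=
    (Matrix.mem_orthogonalGroup_iff' (Fin n) ℝ).1 γ.2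
  have hγ' : (γ : Mat n n) * (γ : Mat n n).transpose = 1 :=
    (Matrix.mem_orthogonalGroup_iff (Fin n) ℝ).1 γ.2
  have hemb : MeasurableEmbedding fun z : Mat n m => (γ : Mat n n) * z := by
    have hc (A : Mat n n) : Continuous fun z : Mat n m => A * z :=
      continuous_const.matrix_mul continuous_id
    refine Topology.IsClosedEmbedding.measurableEmbedding
      (Homeomorph.isClosedEmbedding
        { toFun := fun z => (γ : Mat n n) * z
          invFun := fun z => (γ : Mat n n).transpose * z
          left_inv := fun z => by simp only [← Matrix.mul_assoc, hγ, Matrix.one_mul]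
          right_inv := fun z => by simp only [← Matrix.mul_assoc, hγ', Matrix.one_mul]
          continuous_toFun := hc _
          continuous_invFun := hc _ })
  refine ⟨fun q => (γ : Mat n n) * stack h q, ?_, hemb.comp (stack h).measurableEmbedding,
    (volume_preserving_orthGroup_mul γ).comp (measurePreserving_stack h), fun q => ?_,
    fun q i j => ?_⟩
  · exact continuous_const.matrix_mul (continuous_stack h)
  · simp only
    rw [Matrix.transpose_mul, Matrix.mul_assoc, ← Matrix.mul_assoc _ (γ : Mat n n), hγ,
      Matrix.one_mul, stdFrame_transpose_mul_stack]
  · simp only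
    rw [Matrix.transpose_mul, Matrix.mul_assoc, ← Matrix.mul_assoc _ (γ : Mat n n), hγ,
      Matrix.one_mul, ← stack_inr h q i j]
    exact sq_entry_le_trace _ _ _

/-- The closed ball of radius `R` for the Frobenius norm. -/
def frobBall (n m : ℕ) (R : ℝ) : Set (Mat n m) := {x | (x.transpose * x).trace ≤ R ^ 2}

theorem isClosed_frobBall (R : ℝ) : IsClosed (frobBall n m R) :=
  isClosed_le ((continuous_id.matrix_transpose.matrix_mul continuous_id).matrix_trace)
    continuous_const

theorem exists_subset_frobBall {K : Set (Mat n m)} (hK : IsCompact K) :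
    ∃ R : ℝ, 0 ≤ R ∧ K ⊆ frobBall n m R := by
  obtain ⟨C, hC⟩ := (hK.image (f := fun x : Mat n m => (x.transpose * x).trace)
    (continuous_id.matrix_transpose.matrix_mul continuous_id).matrix_trace).bddAbove
  refine ⟨Real.sqrt C, Real.sqrt_nonneg _, fun x hx => ?_⟩
  have h1 : (x.transpose * x).trace ≤ C := hC ⟨x, hx, rfl⟩
  have h2 : 0 ≤ (x.transpose * x).trace := by
    rw [← norm_matE_sq]
    positivity
  change (x.transpose * x).trace ≤ Real.sqrt C ^ 2
  rw [Real.sq_sqrt (h2.trans h1)]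
  exact h1

/-- Integrating a function of `ξ'x` over a ball costs at most a constant. -/
theorem setLIntegral_frame_le (h : p + k = n) {R : ℝ} (hR : 0 ≤ R) {ξ : Mat n p}
    (hξ : ξ.transpose * ξ = 1) {F : Mat p m → ℝ≥0∞} (hF : Measurable F) :
    ∫⁻ x in frobBall n m R, F (ξ.transpose * x) ≤
      volume {z : Mat k m | ∀ i j, |z i j| ≤ R} * ∫⁻ τ, F τ := by
  obtain ⟨Θ, hΘc, hΘe, hΘ, hξΘ, hbd⟩ := exists_frame_coordinates h m hξ
  set S := {z : Mat k m | ∀ i j, |z i j| ≤ R}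
  have hS : MeasurableSet S := (isCompact_setOf_abs_le R).isClosed.measurableSet
  rw [← lintegral_indicator (isClosed_frobBall R).measurableSet,
    ← hΘ.lintegral_comp_emb hΘe]
  calc _ ≤ ∫⁻ q, F q.1 * S.indicator 1 q.2 ∂((volume : Measure (Mat p m)).prod
        (volume : Measure (Mat k m))) := by
        refine lintegral_mono fun q => ?_
        simp only
        by_cases hq : Θ q ∈ frobBall n m R
        · have : q.2 ∈ S := fun i j => abs_le_of_sq_le_sq ((hbd q i j).trans hq) hR
          rw [Set.indicator_of_mem hq, hξΘ, Set.indicator_of_mem this, Pi.one_apply, mul_one]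
        · rw [Set.indicator_of_notMem hq]
          exact zero_le
    _ = _ := by
        rw [lintegral_prod_mul hF.aemeasurable (measurable_one.indicator hS).aemeasurable,
          lintegral_indicator_one hS, mul_comm]

theorem norm_matE_frame_mul {ξ : Mat n p} (hξ : ξ.transpose * ξ = 1) (η : Mat p m) :
    ‖matE n m (ξ * η)‖ = ‖matE p m η‖ := by
  have : ‖matE n m (ξ * η)‖ ^ 2 = ‖matE p m η‖ ^ 2 := by
    rw [norm_matE_sq, norm_matE_sq, Matrix.transpose_mul, Matrix.mul_assoc,
      ← Matrix.mul_assoc _ ξ, hξ, Matrix.one_mul]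
  exact (sq_eq_sq₀ (norm_nonneg _) (norm_nonneg _)).1 this

theorem IsTest.integrable {g : Mat n m → ℝ} (hg : IsTest g) :
    Integrable fun x => (g x : ℂ) :=
  (hg.continuous.integrable_of_hasCompactSupport hg.2).ofReal

theorem IsTest.continuous_fourier {g : Mat n m → ℝ} (hg : IsTest g) :
    Continuous fun Y : Mat n m => matFourier (fun x => (g x : ℂ)) ((2 * Real.pi) • Y) :=
  (continuous_matFourier hg.integrable).comp (continuous_const_smul _)

theorem IsTest.integrable_fourier_frame_mul {g : Mat n m → ℝ} (hg : IsTest g) {ξ : Mat n p}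
    (hξ : ξ.transpose * ξ = 1) :
    Integrable fun η : Mat p m => matFourier (fun x => (g x : ℂ)) ((2 * Real.pi) • (ξ * η)) := by
  -- Multiplication by `ξ` is isometric, so the decay in `ξη` is decay in `η`; the exponent exceeds
  -- the dimension `pm` by one.
  obtain ⟨C, hC⟩ := hg.exists_decay (p * m + 1)
  refine ((integrable_decay p m).const_mul C).mono' ?_ (Eventually.of_forall fun η => ?_)
  · exact (hg.continuous_fourier.comp
      (continuous_const.matrix_mul continuous_id)).aestronglyMeasurable
  · have := hC (ξ * η)
    rwa [norm_matE_frame_mul hξ] at this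

theorem cexp_two_pi_eq (r : ℝ) : Complex.exp (-(2 * Real.pi * Complex.I) * (r : ℂ)) =
    Complex.exp (((-(2 * Real.pi * r) : ℝ) : ℂ) * Complex.I) := by
  congr 1
  push_cast
  ring

theorem norm_cexp_two_pi (r : ℝ) :
    ‖Complex.exp (-(2 * Real.pi * Complex.I) * (r : ℂ))‖ = 1 := by
  rw [cexp_two_pi_eq, Complex.norm_exp_ofReal_mul_I]

theorem continuous_cexp_trace {α : Type*} [TopologicalSpace α] {Y x : α → Mat p m}
    (hY : Continuous Y) (hx : Continuous x) : Continuous fun a =>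
      Complex.exp (-(2 * Real.pi * Complex.I) * ((((Y a).transpose * x a).trace : ℝ) : ℂ)) :=
  Complex.continuous_exp.comp (continuous_const.mul (Complex.continuous_ofReal.comp
    (hY.matrix_transpose.matrix_mul hx).matrix_trace))

theorem matFourier_neg_two_pi (w : Mat p m → ℂ) (η : Mat p m) :
    matFourier w (-(2 * Real.pi) • η) =
      ∫ τ : Mat p m, Complex.exp (-(2 * Real.pi * Complex.I) *
        ((η.transpose * τ).trace : ℂ)) * w τ := by
  unfold matFourier
  refine integral_congr_ae (Eventually.of_forall fun τ => ?_)
  simp only [Matrix.transpose_smul, Matrix.smul_mul, Matrix.trace_smul, smul_eq_mul]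
  congr 2
  push_cast
  ring

theorem integral_cexp_mul_sub (w : Mat p m → ℂ) (η t : Mat p m) :
    ∫ τ : Mat p m, Complex.exp (-(2 * Real.pi * Complex.I) *
        ((η.transpose * τ).trace : ℂ)) * w (τ - t) =
      Complex.exp (-(2 * Real.pi * Complex.I) * ((η.transpose * t).trace : ℂ)) *
        matFourier w (-(2 * Real.pi) • η) := by
  rw [matFourier_neg_two_pi, ← integral_const_mul,
    ← integral_sub_right_eq_self (fun τ : Mat p m => Complex.exp (-(2 * Real.pi * Complex.I) *
        ((η.transpose * t).trace : ℂ)) * (Complex.exp (-(2 * Real.pi * Complex.I) *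
        ((η.transpose * τ).trace : ℂ)) * w τ)) t]
  refine integral_congr_ae (Eventually.of_forall fun τ => ?_)
  simp only
  rw [← mul_assoc, ← Complex.exp_add, Matrix.mul_sub, Matrix.trace_sub]
  congr 2
  push_cast
  ring

/-- Pairing a test function with a function of `ξ'x`. -/
theorem integral_test_mul_frame (h : p + k = n) {g : Mat n m → ℝ} (hg : IsTest g)
    {v : Mat p m → ℂ} (hv : Integrable v) {ξ : Mat n p} (hξ : ξ.transpose * ξ = 1)
    (t : Mat p m) :
    ∫ x : Mat n m, (g x : ℂ) * v (ξ.transpose * x - t) =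
      ∫ η : Mat p m, matFourier (fun x => (g x : ℂ)) ((2 * Real.pi) • (ξ * η)) *
        (Complex.exp (-(2 * Real.pi * Complex.I) * ((η.transpose * t).trace : ℂ)) *
          matFourier v (-(2 * Real.pi) • η)) := by
  obtain ⟨Θ, hΘc, hΘe, hΘ, hξΘ, hbd⟩ := exists_frame_coordinates h m hξ
  obtain ⟨R, hR, hsub⟩ := exists_subset_frobBall hg.2
  set S := {z : Mat k m | ∀ i j, |z i j| ≤ R}
  have hSc : IsCompact S := isCompact_setOf_abs_le R
  have hzero : ∀ τ z, z ∉ S → (g (Θ (τ, z)) : ℂ) = 0 := by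
    intro τ z hz
    by_contra hne
    have h1 : Θ (τ, z) ∈ frobBall n m R :=
      hsub (subset_tsupport g (by simpa using hne))
    exact hz fun i j => abs_le_of_sq_le_sq ((hbd (τ, z) i j).trans h1) hR
  obtain ⟨B, hB⟩ := hg.continuous.bounded_above_of_compact_support hg.2
  -- `H(τ)` is the integral of `g` over the fibre `ξ'x = τ`. It is continuous because `g` vanishes
  -- unless the fibre coordinate lies in the compact set `S`.
  set H : Mat p m → ℂ := fun τ => ∫ z : Mat k m, (g (Θ (τ, z)) : ℂ)
  have hgΘ : Integrable (fun q => (g (Θ q) : ℂ))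
      ((volume : Measure (Mat p m)).prod (volume : Measure (Mat k m))) :=
    (hΘ.integrable_comp_emb hΘe).2 hg.integrable
  have hHi : Integrable H := hgΘ.integral_prod_left
  have hHc : Continuous H := by
    have h1 : H = fun τ => ∫ z in S, (g (Θ (τ, z)) : ℂ) := by
      ext τ
      exact (setIntegral_eq_integral_of_forall_compl_eq_zero (hzero τ)).symm
    have h2 : Continuous (Function.uncurry fun (τ : Mat p m) (z : Mat k m) =>
        (g (Θ (τ, z)) : ℂ)) := Complex.continuous_ofReal.comp (hg.continuous.comp hΘc)
    rw [h1]
    exact continuous_parametric_integral_of_continuous h2 hSc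
  -- Projection-slice: since `tr((ξη)'x) = tr(η' ξ'x)`, the transform of `H` is that of `g`
  -- restricted to the matrices `ξη`.
  have hHF (η : Mat p m) : matFourier H ((2 * Real.pi) • η) =
      matFourier (fun x => (g x : ℂ)) ((2 * Real.pi) • (ξ * η)) := by
    unfold matFourier
    rw [← hΘ.integral_comp hΘe, integral_prod]
    · refine integral_congr_ae (Eventually.of_forall fun τ => ?_)
      simp only [H]
      rw [← integral_const_mul]
      refine integral_congr_ae (Eventually.of_forall fun z => ?_)
      simp only
      rw [Matrix.transpose_smul, Matrix.transpose_smul, Matrix.transpose_mul, Matrix.smul_mul,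
        Matrix.smul_mul, Matrix.mul_assoc, hξΘ]
    · refine hgΘ.bdd_mul (c := 1) ?_ (Eventually.of_forall fun q => ?_)
      · refine Continuous.aestronglyMeasurable ?_
        exact Complex.continuous_exp.comp (continuous_const.mul (Complex.continuous_ofReal.comp
          (continuous_const.matrix_mul hΘc).matrix_trace))
      · rw [mul_comm, Complex.norm_exp_ofReal_mul_I]
  have hFi := hg.integrable_fourier_frame_mul hξ (m := m)
  have hvt : Integrable fun τ : Mat p m => v (τ - t) := hv.comp_sub_right t
  calc ∫ x : Mat n m, (g x : ℂ) * v (ξ.transpose * x - t)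
      = ∫ τ : Mat p m, H τ * v (τ - t) := by
        rw [← hΘ.integral_comp hΘe]
        simp only [hξΘ]
        rw [integral_prod]
        · refine integral_congr_ae (Eventually.of_forall fun τ => ?_)
          simp only [H]
          rw [integral_mul_const]
        · have h1 : Integrable (fun q : Mat p m × Mat k m =>
              v (q.1 - t) * S.indicator (fun _ => (1 : ℂ)) q.2) (volume.prod volume) :=
            hvt.mul_prod ((integrable_indicator_iff hSc.isClosed.measurableSet).2
              (integrableOn_const hSc.measure_lt_top.ne))
          refine (h1.bdd_mul (c := B) (f := fun q => (g (Θ q) : ℂ)) ?_ ?_).congr ?_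
          · exact (Complex.continuous_ofReal.comp
              (hg.continuous.comp hΘc)).aestronglyMeasurable
          · refine Eventually.of_forall fun q => ?_
            simpa using hB (Θ q)
          · refine Eventually.of_forall fun q => ?_
            by_cases hq : q.2 ∈ S
            · simp only [Set.indicator_of_mem hq, mul_one]
            · simp only [Set.indicator_of_notMem hq, mul_zero, hzero q.1 q.2 hq, zero_mul]
    _ = ∫ τ : Mat p m, ∫ η : Mat p m,
          matFourier (fun x => (g x : ℂ)) ((2 * Real.pi) • (ξ * η)) *
            (Complex.exp (-(2 * Real.pi * Complex.I) * ((η.transpose * τ).trace : ℂ)) *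
              v (τ - t)) := by
        refine integral_congr_ae (Eventually.of_forall fun τ => ?_)
        simp only
        -- Fourier inversion is applied to the smooth factor `H`, so nothing beyond integrability is
        -- needed of `v`.
        rw [eq_integral_matFourier hHc hHi (by simpa only [hHF] using hFi) τ,
          ← integral_mul_const]
        simp only [hHF, mul_assoc]
    _ = _ := by
        rw [integral_integral_swap]
        · refine integral_congr_ae (Eventually.of_forall fun η => ?_)
          simp only
          rw [integral_const_mul, integral_cexp_mul_sub]
        · refine ((hvt.mul_prod hFi).mul_bdd (c := 1) (g := fun q : Mat p m × Mat p m =>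
            Complex.exp (-(2 * Real.pi * Complex.I) * ((q.2.transpose * q.1).trace : ℂ)))
              ?_ ?_).congr ?_
          · exact (continuous_cexp_trace continuous_snd continuous_fst).aestronglyMeasurable
          · exact Eventually.of_forall fun q => (norm_cexp_two_pi _).le
          · refine Eventually.of_forall fun q => ?_
            simp only [Function.uncurry]
            ring

end Fibre

/-! ### Scaled wavelets and convolutions -/

section Scaled

open scoped FourierTransform

variable {n m p k : ℕ}

theorem measurable_stiefel_transpose_mul {α : Type*} [MeasurableSpace α]
    {g : α → Stiefel n (n - k)} {f : α → Mat n m} (hg : Measurable g) (hf : Measurable f) :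
    Measurable fun a => (g a).1.transpose * f a := by
  have h : Continuous fun q : Stiefel n (n - k) × Mat n m => q.1.1.transpose * q.2 :=
    (continuous_subtype_val.comp continuous_fst).matrix_transpose.matrix_mul continuous_snd
  have h2 := h.measurable.comp (hg.prodMk hf)
  exact h2

theorem measurable_matrix_mul {α : Type*} [MeasurableSpace α] {f : α → Mat p m}
    {g : α → Mat m k} (hf : Measurable f) (hg : Measurable g) :
    Measurable fun a => f a * g a := by
  have h : Continuous fun q : Mat p m × Mat m k => q.1 * q.2 :=
    continuous_fst.matrix_mul continuous_snd
  have h2 := h.measurable.comp (hf.prodMk hg)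
  exact h2

theorem measurable_scaled {w : Mat p m → ℂ} (hw : Measurable w) {α : Type*}
    [MeasurableSpace α] {a : α → Mat m m} {z : α → Mat p m} (ha : Measurable a)
    (hz : Measurable z) : Measurable fun b => scaled w (a b) (z b) := by
  have h1 : Measurable fun b => (a b).det := measurable_det.comp ha
  have h2 : Measurable fun b => (matSqrt (a b))⁻¹ :=
    measurable_matInv.comp (measurable_matSqrt.comp ha)
  exact (Complex.measurable_ofReal.comp (h1.pow_const _)).mul
    (hw.comp (measurable_matrix_mul hz h2))

theorem isUnit_det_matSqrt {a : Mat m m} (ha : a.PosDef) : IsUnit (matSqrt a).det :=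
  isUnit_iff_ne_zero.2 (det_matSqrt_pos ha).ne'

theorem scaled_mul_matSqrt (w : Mat p m → ℂ) {a : Mat m m} (ha : a.PosDef) (z : Mat p m) :
    scaled w a (z * matSqrt a) = ((a.det ^ (-(p : ℝ) / 2) : ℝ) : ℂ) * w z := by
  rw [scaled, Matrix.mul_assoc, Matrix.mul_nonsing_inv _ (isUnit_det_matSqrt ha), Matrix.mul_one]

theorem abs_det_matSqrt_pow {a : Mat m m} (ha : a.PosDef) :
    |(matSqrt a).det| ^ p = a.det ^ ((p : ℝ) / 2) := by
  rw [abs_of_pos (det_matSqrt_pos ha), ← det_matSqrt_sq ha, ← Real.rpow_natCast,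
    ← Real.rpow_natCast, ← Real.rpow_mul (det_matSqrt_pos ha).le]
  congr 1
  push_cast
  ring

theorem measurableEmbedding_mul_right {g : Mat m m} (hg : IsUnit g.det) :
    MeasurableEmbedding fun z : Mat p m => z * g := by
  have hc (A : Mat m m) : Continuous fun z : Mat p m => z * A :=
    continuous_id.matrix_mul continuous_const
  exact Topology.IsClosedEmbedding.measurableEmbedding
    (Homeomorph.isClosedEmbedding
      { toFun := fun z : Mat p m => z * g
        invFun := fun z : Mat p m => z * g⁻¹
        left_inv := fun z => by
          simp only [Matrix.mul_assoc, Matrix.mul_nonsing_inv _ hg, Matrix.mul_one]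
        right_inv := fun z => by
          simp only [Matrix.mul_assoc, Matrix.nonsing_inv_mul _ hg, Matrix.mul_one]
        continuous_toFun := hc _
        continuous_invFun := hc _ })

theorem integral_mul_right {g : Mat m m} (hg : g.det ≠ 0) (F : Mat p m → ℂ) :
    ∫ z : Mat p m, F (z * g) = (((|g.det| ^ p)⁻¹ : ℝ) : ℂ) * ∫ z, F z := by
  rw [← (measurableEmbedding_mul_right (isUnit_iff_ne_zero.2 hg)).integral_map,
    map_mul_right_volume g hg, integral_smul_measure, ENNReal.toReal_ofReal (by positivity),
    Complex.real_smul]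

/-- The normalisation `|a|^{-p/2}` is the Jacobian of `z ↦ z a^{-1/2}`. Because of this, all bounds
below are uniform in `a`. -/
theorem lintegral_enorm_scaled {w : Mat p m → ℂ} (hw : Measurable w) {a : Mat m m}
    (ha : a.PosDef) : ∫⁻ z, ‖scaled w a z‖ₑ = ∫⁻ z, ‖w z‖ₑ := by
  have hs := det_matSqrt_pos ha
  have hd : 0 < |(matSqrt a).det| ^ p := pow_pos (abs_pos.2 hs.ne') p
  have h1 : ∫⁻ z : Mat p m, ‖scaled w a (z * matSqrt a)‖ₑ =
      ENNReal.ofReal ((|(matSqrt a).det| ^ p)⁻¹) * ∫⁻ z, ‖scaled w a z‖ₑ := by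
    rw [← (measurableEmbedding_mul_right (isUnit_det_matSqrt ha)).lintegral_map
      (fun z => ‖scaled w a z‖ₑ), map_mul_right_volume _ hs.ne', lintegral_smul_measure,
      smul_eq_mul]
  have h2 : ∫⁻ z : Mat p m, ‖scaled w a (z * matSqrt a)‖ₑ =
      ENNReal.ofReal ((|(matSqrt a).det| ^ p)⁻¹) * ∫⁻ z, ‖w z‖ₑ := by
    rw [← lintegral_const_mul _ hw.enorm]
    refine lintegral_congr fun z => ?_
    rw [scaled_mul_matSqrt w ha, enorm_mul, abs_det_matSqrt_pow ha, ← Real.rpow_neg ha.det_pos.le,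
      neg_div]
    congr 1
    rw [← ofReal_norm, Complex.norm_real, Real.norm_of_nonneg (Real.rpow_nonneg ha.det_pos.le _)]
  rw [h2] at h1
  exact ((ENNReal.mul_right_inj (by simpa using hd) ENNReal.ofReal_ne_top).1 h1).symm

theorem integrable_scaled {w : Mat p m → ℂ} (hw : Measurable w) (hwi : Integrable w)
    {a : Mat m m} (ha : a.PosDef) : Integrable (scaled w a) := by
  refine ⟨(measurable_scaled hw measurable_const measurable_id).aestronglyMeasurable, ?_⟩
  rw [HasFiniteIntegral, lintegral_enorm_scaled hw ha]
  exact hwi.2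

/-- Substitute `x = z a^{1/2}` and use the cyclicity of the trace; the Jacobian cancels the
normalisation. -/
theorem matFourier_scaled (w : Mat p m → ℂ) {a : Mat m m} (ha : a.PosDef) (y : Mat p m) :
    matFourier (scaled w a) y = matFourier w (y * matSqrt a) := by
  have hs := det_matSqrt_pos ha
  have hd : 0 < a.det ^ ((p : ℝ) / 2) := Real.rpow_pos_of_pos ha.det_pos _
  have h1 := integral_mul_right hs.ne' (fun x : Mat p m =>
    Complex.exp (Complex.I * ((y.transpose * x).trace : ℂ)) * scaled w a x)
  rw [abs_det_matSqrt_pow ha] at h1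
  have h2 : ∫ z : Mat p m, Complex.exp (Complex.I *
        ((y.transpose * (z * matSqrt a)).trace : ℂ)) * scaled w a (z * matSqrt a) =
      (((a.det ^ ((p : ℝ) / 2))⁻¹ : ℝ) : ℂ) * matFourier w (y * matSqrt a) := by
    rw [matFourier, ← integral_const_mul]
    refine integral_congr_ae (Eventually.of_forall fun z => ?_)
    simp only
    rw [scaled_mul_matSqrt w ha, Matrix.transpose_mul, transpose_matSqrt,
      ← Matrix.mul_assoc, Matrix.trace_mul_comm, ← Matrix.mul_assoc, neg_div,
      Real.rpow_neg ha.det_pos.le]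
    ring
  rw [h2] at h1
  exact (mul_left_cancel₀ (by simpa using hd.ne') h1).symm

theorem matFourier_conv {u v : Mat p m → ℂ} (hu : Integrable u) (hv : Integrable v)
    (y : Mat p m) : matFourier (conv u v) y = matFourier u y * matFourier v y := by
  have hs := measurePreserving_matE_symm (n := p) (m := m)
  have h1 := Real.fourier_mul_convolution_eq
    ((hs.integrable_comp_emb measurableEmbedding_matE_symm).2 hu)
    ((hs.integrable_comp_emb measurableEmbedding_matE_symm).2 hv)
    (matE p m ((-(2 * Real.pi)⁻¹) • y))
  -- The convolution theorem is evaluated at `-y/(2π)`, the point at which the normalisations match.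
  have hy : -(2 * Real.pi) • (-(2 * Real.pi)⁻¹) • y = y := by
    rw [smul_smul, neg_mul_neg, mul_inv_cancel₀ (by positivity), one_smul]
  have h2 : convolution (u ∘ (matE p m).symm) (v ∘ (matE p m).symm)
      (ContinuousLinearMap.mul ℂ ℂ) volume = conv u v ∘ (matE p m).symm := by
    ext x
    rw [Function.comp, conv, convolution, convolution,
      ← measurePreserving_matE.integral_comp measurableEmbedding_matE]
    simp
  rw [h2, fourier_matE, fourier_matE, fourier_matE, hy] at h1
  exact h1

theorem quasiMeasurePreserving_sub_left_mul (t : Mat p m) {g : Mat m m} (hg : IsUnit g.det) :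
    Measure.QuasiMeasurePreserving (fun z : Mat p m => (t - z) * g) := by
  have h1 : Measure.QuasiMeasurePreserving (fun z : Mat p m => z * g) := by
    refine ⟨(measurableEmbedding_mul_right hg).measurable, ?_⟩
    rw [map_mul_right_volume g (isUnit_iff_ne_zero.1 hg)]
    exact Measure.smul_absolutelyContinuous
  exact h1.comp (Measure.measurePreserving_sub_left volume t).quasiMeasurePreserving

theorem quasiMeasurePreserving_frame_mul (h : p + k = n) {ξ : Mat n p}
    (hξ : ξ.transpose * ξ = 1) :
    Measure.QuasiMeasurePreserving (fun y : Mat n m => ξ.transpose * y) := by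
  have hmeas : Measurable fun y : Mat n m => ξ.transpose * y :=
    (continuous_const.matrix_mul continuous_id).measurable
  refine ⟨hmeas, Measure.AbsolutelyContinuous.mk fun s hs hs0 => ?_⟩
  obtain ⟨Θ, -, -, hΘ, hξΘ, -⟩ := exists_frame_coordinates h m hξ
  rw [Measure.map_apply hmeas hs, ← hΘ.measure_preimage (hmeas hs).nullMeasurableSet]
  -- In frame coordinates the preimage of `s` is a cylinder over `s`, null as soon as `s` is.
  have : Θ ⁻¹' ((fun y : Mat n m => ξ.transpose * y) ⁻¹' s) = s ×ˢ Set.univ := by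
    ext q
    simp [hξΘ]
  rw [this, Measure.prod_prod, hs0, zero_mul]

theorem ridgelet_congr (hkn : k ≤ n) {u u' : Mat (n - k) m → ℂ} {f f' : Mat n m → ℂ}
    (hu : u =ᵐ[volume] u') (hf : f =ᵐ[volume] f') {a : Mat m m} (ha : a.PosDef)
    (ξ : Stiefel n (n - k)) (t : Mat (n - k) m) : ridgelet u a f ξ t = ridgelet u' a f' ξ t := by
  have h1 := ((quasiMeasurePreserving_sub_left_mul t
    (Matrix.isUnit_nonsing_inv_det _ (isUnit_det_matSqrt ha))).comp
    (quasiMeasurePreserving_frame_mul (m := m) (Nat.sub_add_cancel hkn) ξ.2)).ae_eq_comp hu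
  refine integral_congr_ae ?_
  filter_upwards [h1, hf] with y hy hy'
  simp only [Function.comp] at hy
  rw [hy', scaled, scaled, hy]

/-- The integrals in `y` and `t` absorb null sets, so the integrand is unchanged at every `x` and
every positive definite `a`. This permits measurable representatives of `u`, `v`, `f`. -/
theorem reproIntegrand_congr (hkn : k ≤ n) {u u' v v' : Mat (n - k) m → ℂ} {f f' : Mat n m → ℂ}
    (hu : u =ᵐ[volume] u') (hv : v =ᵐ[volume] v') (hf : f =ᵐ[volume] f') (x : Mat n m)
    {a : Mat m m} (ha : a.PosDef) : reproIntegrand u v f x a = reproIntegrand u' v' f' x a := by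
  unfold reproIntegrand dualRidgelet
  congr 1
  refine integral_congr_ae (Eventually.of_forall fun ξ => integral_congr_ae ?_)
  have h1 := (quasiMeasurePreserving_sub_left_mul (ξ.1.transpose * x)
    (Matrix.isUnit_nonsing_inv_det _ (isUnit_det_matSqrt ha))).ae_eq_comp hv
  filter_upwards [h1] with t ht
  simp only [Function.comp] at ht
  rw [ridgelet_congr hkn hu hf ha, scaled, scaled, ht]

end Scaled

/-! ### The composed ridgelet transform at a fixed scale -/

section FixedScale

variable {n m k : ℕ}

/-- The integrand of the composition of the ridgelet transform and its dual. -/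
noncomputable def ridgeletKernel (u v : Mat (n - k) m → ℂ) (f : Mat n m → ℂ) (a : Mat m m)
    (x : Mat n m) (q : Stiefel n (n - k) × (Mat (n - k) m × Mat n m)) : ℂ :=
  f q.2.2 * scaled u a (q.2.1 - q.1.1.transpose * q.2.2) *
    scaled v a (q.1.1.transpose * x - q.2.1)

/-- The measure on the parameters of `ridgeletKernel`. -/
noncomputable abbrev kernelMeasure (n m k : ℕ) :
    Measure (Stiefel n (n - k) × (Mat (n - k) m × Mat n m)) :=
  (stiefelMeasure n k).prod (volume.prod volume)

variable {u v : Mat (n - k) m → ℂ} {f : Mat n m → ℂ}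

theorem measurable_ridgeletKernel (hu : Measurable u) (hv : Measurable v) (hf : Measurable f)
    {α : Type*} [MeasurableSpace α] {a : α → Mat m m} {x : α → Mat n m}
    {q : α → Stiefel n (n - k) × (Mat (n - k) m × Mat n m)} (ha : Measurable a)
    (hx : Measurable x) (hq : Measurable q) :
    Measurable fun b => ridgeletKernel u v f (a b) (x b) (q b) := by
  have h1 : Measurable fun b => (q b).1 := measurable_fst.comp hq
  have h2 : Measurable fun b => (q b).2.1 := measurable_fst.comp (measurable_snd.comp hq)
  have h3 : Measurable fun b => (q b).2.2 := measurable_snd.comp (measurable_snd.comp hq)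
  have h4 : Measurable fun b => scaled u (a b) ((q b).2.1 - (q b).1.1.transpose * (q b).2.2) :=
    measurable_scaled hu ha (h2.sub (measurable_stiefel_transpose_mul h1 h3))
  have h5 : Measurable fun b => scaled v (a b) ((q b).1.1.transpose * x b - (q b).2.1) :=
    measurable_scaled hv ha ((measurable_stiefel_transpose_mul h1 hx).sub h2)
  exact ((hf.comp h3).mul h4).mul h5

/-- Tonelli, integrating in `x` first: on a ball the factor `v_a(ξ'x - t)` costs a constant times
`‖v‖₁`, then `t` gives `‖u‖₁` and `y` gives `‖f‖₁`. Integrating over a ball is essential, since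
`v_a(ξ'x - t)` does not decay along the fibres. The bound does not depend on `a`. -/
theorem setLIntegral_ridgeletKernel_le (hkn : k ≤ n) (hu : Measurable u) (hv : Measurable v)
    (hf : Measurable f) {R : ℝ} (hR : 0 ≤ R) {a : Mat m m} (ha : a.PosDef) :
    ∫⁻ x in frobBall n m R, (∫⁻ q, ‖ridgeletKernel u v f a x q‖ₑ ∂(kernelMeasure n m k)) ≤
      (volume {z : Mat k m | ∀ i j, |z i j| ≤ R} * ∫⁻ z, ‖v z‖ₑ) *
        ((∫⁻ y, ‖f y‖ₑ) * ∫⁻ z, ‖u z‖ₑ) := by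
  have hvs : Measurable (scaled v a) := measurable_scaled hv measurable_const measurable_id
  have hus : Measurable (scaled u a) := measurable_scaled hu measurable_const measurable_id
  set D := volume {z : Mat k m | ∀ i j, |z i j| ≤ R} * ∫⁻ z, ‖v z‖ₑ
  have hx (ξ : Stiefel n (n - k)) (t : Mat (n - k) m) :
      ∫⁻ x in frobBall n m R, ‖scaled v a (ξ.1.transpose * x - t)‖ₑ ≤ D := by
    refine (setLIntegral_frame_le (Nat.sub_add_cancel hkn) hR ξ.2
      (F := fun τ => ‖scaled v a (τ - t)‖ₑ)
      (hvs.comp (measurable_id.sub_const t)).enorm).trans_eq ?_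
    rw [lintegral_sub_right_eq_self (fun τ => ‖scaled v a τ‖ₑ) t, lintegral_enorm_scaled hv ha]
  have hmeas : Measurable fun q : Stiefel n (n - k) × (Mat (n - k) m × Mat n m) =>
      ‖f q.2.2 * scaled u a (q.2.1 - q.1.1.transpose * q.2.2)‖ₑ :=
    ((hf.comp (measurable_snd.comp measurable_snd)).mul (hus.comp
      ((measurable_fst.comp measurable_snd).sub (measurable_stiefel_transpose_mul measurable_fst
        (measurable_snd.comp measurable_snd))))).enorm
  have hK : Measurable fun z : Mat n m × (Stiefel n (n - k) × (Mat (n - k) m × Mat n m)) =>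
      ‖ridgeletKernel u v f a z.1 z.2‖ₑ :=
    (measurable_ridgeletKernel hu hv hf measurable_const measurable_fst measurable_snd).enorm
  rw [lintegral_lintegral_swap hK.aemeasurable]
  calc _ ≤ ∫⁻ q, ‖f q.2.2 * scaled u a (q.2.1 - q.1.1.transpose * q.2.2)‖ₑ * D
        ∂(kernelMeasure n m k) := by
        refine lintegral_mono fun q => ?_
        simp only [ridgeletKernel, enorm_mul _ (scaled v a _)]
        rw [lintegral_const_mul]
        · gcongr
          exact hx q.1 q.2.1
        · exact (hvs.comp ((continuous_const.matrix_mul continuous_id).measurable.sub_const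
            q.2.1)).enorm
    _ = D * ∫⁻ ξ, (∫⁻ y, (∫⁻ t, ‖f y‖ₑ * ‖scaled u a (t - ξ.1.transpose * y)‖ₑ))
        ∂(stiefelMeasure n k) := by
        rw [lintegral_mul_const _ hmeas, mul_comm, lintegral_prod _ hmeas.aemeasurable]
        congr 1
        refine lintegral_congr fun ξ => ?_
        refine (lintegral_prod_symm _ (hmeas.comp measurable_prodMk_left).aemeasurable).trans ?_
        simp only [Function.comp, enorm_mul]
    _ = _ := by
        congr 1
        have hin (ξ : Stiefel n (n - k)) :
            ∫⁻ y, (∫⁻ t, ‖f y‖ₑ * ‖scaled u a (t - ξ.1.transpose * y)‖ₑ) =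
              (∫⁻ y, ‖f y‖ₑ) * ∫⁻ z, ‖u z‖ₑ := by
          rw [← lintegral_mul_const _ hf.enorm]
          refine lintegral_congr fun y => ?_
          rw [lintegral_const_mul' _ _ enorm_ne_top,
            lintegral_sub_right_eq_self (fun τ => ‖scaled u a τ‖ₑ), lintegral_enorm_scaled hu ha]
        simp only [hin, lintegral_const, measure_univ, mul_one]

theorem integrable_test_mul_ridgeletKernel (hkn : k ≤ n) (hu : Measurable u) (hv : Measurable v)
    (hf : Measurable f) (hui : Integrable u) (hvi : Integrable v) (hfi : Integrable f)
    {g : Mat n m → ℝ} (hg : IsTest g) {a : Mat m m} (ha : a.PosDef) :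
    Integrable (fun z : (Stiefel n (n - k) × (Mat (n - k) m × Mat n m)) × Mat n m =>
      (g z.2 : ℂ) * ridgeletKernel u v f a z.2 z.1) ((kernelMeasure n m k).prod volume) := by
  obtain ⟨R, hR, hsub⟩ := exists_subset_frobBall hg.2
  obtain ⟨B, hB⟩ := hg.continuous.bounded_above_of_compact_support hg.2
  have hgm : Measurable fun x => (g x : ℂ) := Complex.measurable_ofReal.comp hg.continuous.measurable
  have hm : Measurable (fun z : (Stiefel n (n - k) × (Mat (n - k) m × Mat n m)) × Mat n m =>
      (g z.2 : ℂ) * ridgeletKernel u v f a z.2 z.1) :=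
    (hgm.comp measurable_snd).mul
      (measurable_ridgeletKernel hu hv hf measurable_const measurable_snd measurable_fst)
  refine ⟨hm.aestronglyMeasurable, ?_⟩
  rw [HasFiniteIntegral, lintegral_prod_symm _ hm.enorm.aemeasurable]
  have hK (x : Mat n m) : Measurable fun q => ‖ridgeletKernel u v f a x q‖ₑ :=
    (measurable_ridgeletKernel hu hv hf measurable_const measurable_const measurable_id).enorm
  calc _ ≤ ∫⁻ x in frobBall n m R, ENNReal.ofReal B *
        (∫⁻ q, ‖ridgeletKernel u v f a x q‖ₑ ∂(kernelMeasure n m k)) := by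
        rw [← lintegral_indicator (isClosed_frobBall R).measurableSet]
        refine lintegral_mono fun x => ?_
        simp only [enorm_mul]
        rw [lintegral_const_mul _ (hK x)]
        by_cases hx : x ∈ frobBall n m R
        · rw [Set.indicator_of_mem hx]
          gcongr
          rw [← ofReal_norm, Complex.norm_real]
          exact ENNReal.ofReal_le_ofReal (hB x)
        · have : g x = 0 := by
            by_contra hne
            exact hx (hsub (subset_tsupport g hne))
          simp [this]
    _ = ENNReal.ofReal B * ∫⁻ x in frobBall n m R,
        (∫⁻ q, ‖ridgeletKernel u v f a x q‖ₑ ∂(kernelMeasure n m k)) :=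
        lintegral_const_mul' _ _ ENNReal.ofReal_ne_top
    _ < ∞ := by
        refine ENNReal.mul_lt_top ENNReal.ofReal_lt_top
          ((setLIntegral_ridgeletKernel_le hkn hu hv hf hR ha).trans_lt ?_)
        exact ENNReal.mul_lt_top (ENNReal.mul_lt_top (isCompact_setOf_abs_le R).measure_lt_top
          hvi.2) (ENNReal.mul_lt_top hfi.2 hui.2)

/-- Integrating `f(y) U(t - ξ'y)` against an exponential in `t`. -/
theorem integral_cexp_mul_frame {p : ℕ} {U : Mat p m → ℂ} (ξ : Mat n p)
    (η : Mat p m) :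
    ∫ y : Mat n m, ∫ t : Mat p m, f y * U (t - ξ.transpose * y) *
      Complex.exp (-(2 * Real.pi * Complex.I) * ((η.transpose * t).trace : ℂ)) =
    matFourier U (-(2 * Real.pi) • η) * matFourier f (-(2 * Real.pi) • (ξ * η)) := by
  rw [matFourier_neg_two_pi f, ← integral_const_mul]
  refine integral_congr_ae (Eventually.of_forall fun y => ?_)
  simp only
  have h := integral_cexp_mul_sub U η (ξ.transpose * y)
  calc _ = f y * ∫ τ : Mat p m, Complex.exp (-(2 * Real.pi * Complex.I) *
        ((η.transpose * τ).trace : ℂ)) * U (τ - ξ.transpose * y) := by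
        rw [← integral_const_mul]
        refine integral_congr_ae (Eventually.of_forall fun t => ?_)
        simp only
        ring
    _ = _ := by
        rw [h, Matrix.transpose_mul, Matrix.mul_assoc]
        ring

theorem integrable_mul_comp_sub {p : ℕ} {U : Mat p m → ℂ} (hU : Measurable U)
    (hf : Measurable f) (hUi : Integrable U) (hfi : Integrable f) (ξ : Mat n p) :
    Integrable (fun z : Mat p m × Mat n m => f z.2 * U (z.1 - ξ.transpose * z.2))
      (volume.prod volume) := by
  have h1 : Measurable fun z : Mat p m × Mat n m => z.1 - ξ.transpose * z.2 :=
    (continuous_fst.sub (continuous_const.matrix_mul continuous_snd)).measurable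
  have hm : Measurable fun z : Mat p m × Mat n m => f z.2 * U (z.1 - ξ.transpose * z.2) :=
    (hf.comp measurable_snd).mul (hU.comp h1)
  refine ⟨hm.aestronglyMeasurable, ?_⟩
  rw [HasFiniteIntegral, lintegral_prod_symm _ hm.enorm.aemeasurable]
  calc _ = ∫⁻ y, ‖f y‖ₑ * ∫⁻ z, ‖U z‖ₑ := by
        refine lintegral_congr fun y => ?_
        simp only [enorm_mul]
        rw [lintegral_const_mul' _ _ enorm_ne_top,
          lintegral_sub_right_eq_self (fun τ => ‖U τ‖ₑ)]
    _ < ∞ := by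
        rw [lintegral_mul_const _ hf.enorm]
        exact ENNReal.mul_lt_top hfi.2 hUi.2

/-- Pairing of the composed transform at a fixed scale with a test function. -/
theorem integral_kernelMeasure_eq (hkn : k ≤ n) (hu : Measurable u) (hv : Measurable v)
    (hf : Measurable f) (hui : Integrable u) (hvi : Integrable v) (hfi : Integrable f)
    {g : Mat n m → ℝ} (hg : IsTest g) {a : Mat m m} (ha : a.PosDef) :
    ∫ q, (∫ x : Mat n m, (g x : ℂ) * ridgeletKernel u v f a x q) ∂(kernelMeasure n m k) =
      ∫ ξ : Stiefel n (n - k), (∫ η : Mat (n - k) m,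
        matFourier (fun x => (g x : ℂ)) ((2 * Real.pi) • (ξ.1 * η)) *
          (matFourier u (-(2 * Real.pi) • (η * matSqrt a)) *
            matFourier v (-(2 * Real.pi) • (η * matSqrt a))) *
          matFourier f (-(2 * Real.pi) • (ξ.1 * η))) ∂(stiefelMeasure n k) := by
  have hvs : Measurable (scaled v a) := measurable_scaled hv measurable_const measurable_id
  have hus : Measurable (scaled u a) := measurable_scaled hu measurable_const measurable_id
  have husi := integrable_scaled hu hui ha
  have hvsi := integrable_scaled hv hvi ha
  have hint := (integrable_test_mul_ridgeletKernel hkn hu hv hf hui hvi hfi hg ha).integral_prod_left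
  rw [integral_prod _ hint]
  refine integral_congr_ae (Eventually.of_forall fun ξ => ?_)
  simp only
  set Gh : Mat (n - k) m → ℂ := fun η =>
    matFourier (fun x => (g x : ℂ)) ((2 * Real.pi) • (ξ.1 * η))
  set e : Mat (n - k) m → Mat (n - k) m → ℂ := fun η t =>
    Complex.exp (-(2 * Real.pi * Complex.I) * ((η.transpose * t).trace : ℂ))
  have hGh : Integrable Gh := hg.integrable_fourier_frame_mul ξ.2
  have hec : Continuous fun z : (Mat (n - k) m × Mat n m) × Mat (n - k) m => e z.2 z.1.1 :=
    continuous_cexp_trace continuous_snd (continuous_fst.comp continuous_fst)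
  have hen (η t) : ‖e η t‖ ≤ 1 := (norm_cexp_two_pi _).le
  set Vh : Mat (n - k) m → ℂ := fun η => matFourier (scaled v a) (-(2 * Real.pi) • η)
  have hVc : Continuous Vh := (continuous_matFourier hvsi).comp (continuous_const_smul _)
  have hFU := integrable_mul_comp_sub hus hf husi hfi ξ.1
  -- This justifies exchanging `η` with `(t, y)`: `f(y) u_a(t - ξ'y)` is integrable in `(t, y)`,
  -- `ĝ(ξη)` is integrable in `η`, and the exponential and the transform of `v_a` are bounded.
  have hbig : Integrable (fun z : (Mat (n - k) m × Mat n m) × Mat (n - k) m =>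
      (f z.1.2 * scaled u a (z.1.1 - ξ.1.transpose * z.1.2)) * Gh z.2 * (e z.2 z.1.1 * Vh z.2))
      ((volume.prod volume).prod volume) := by
    refine (hFU.mul_prod hGh).mul_bdd (c := 1 * ∫ z, ‖scaled v a z‖)
      (g := fun z : (Mat (n - k) m × Mat n m) × Mat (n - k) m => e z.2 z.1.1 * Vh z.2)
      (hec.mul (hVc.comp continuous_snd)).aestronglyMeasurable
      (Eventually.of_forall fun z => ?_)
    rw [norm_mul]
    exact mul_le_mul (hen _ _) (norm_matFourier_le _ _) (norm_nonneg _) zero_le_one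
  -- For fixed `ξ` the `x`-integral produces `ĝ(ξη)` and the transform of `v_a`; the `(t,
  -- y)`-integral then produces the transforms of `u_a` at `η` and of `f` at `ξη`.
  calc ∫ z : Mat (n - k) m × Mat n m, (∫ x : Mat n m, (g x : ℂ) *
        ridgeletKernel u v f a x (ξ, z)) ∂(volume.prod volume)
      = ∫ z : Mat (n - k) m × Mat n m, (∫ η : Mat (n - k) m,
          (f z.2 * scaled u a (z.1 - ξ.1.transpose * z.2)) * Gh η * (e η z.1 * Vh η))
          ∂(volume.prod volume) := by
        refine integral_congr_ae (Eventually.of_forall fun z => ?_)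
        simp only
        have h := integral_test_mul_frame (Nat.sub_add_cancel hkn) hg hvsi ξ.2 z.1
        calc _ = (f z.2 * scaled u a (z.1 - ξ.1.transpose * z.2)) *
              ∫ x : Mat n m, (g x : ℂ) * scaled v a (ξ.1.transpose * x - z.1) := by
              rw [← integral_const_mul]
              refine integral_congr_ae (Eventually.of_forall fun x => ?_)
              simp only [ridgeletKernel]
              ring
          _ = _ := by
              rw [h, ← integral_const_mul]
              refine integral_congr_ae (Eventually.of_forall fun η => ?_)
              exact (mul_assoc _ _ _).symm
    _ = ∫ η : Mat (n - k) m, (∫ z : Mat (n - k) m × Mat n m,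
          (f z.2 * scaled u a (z.1 - ξ.1.transpose * z.2)) * Gh η * (e η z.1 * Vh η)
          ∂(volume.prod volume)) := integral_integral_swap hbig
    _ = _ := by
        refine integral_congr_ae (Eventually.of_forall fun η => ?_)
        simp only
        have h1 : Integrable (fun z : Mat (n - k) m × Mat n m =>
            f z.2 * scaled u a (z.1 - ξ.1.transpose * z.2) * e η z.1) (volume.prod volume) :=
          hFU.mul_bdd (c := 1) (g := fun z : Mat (n - k) m × Mat n m => e η z.1)
            (continuous_cexp_trace continuous_const continuous_fst).aestronglyMeasurable
            (Eventually.of_forall fun z => hen _ _)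
        calc _ = (Gh η * Vh η) * ∫ z : Mat (n - k) m × Mat n m,
              f z.2 * scaled u a (z.1 - ξ.1.transpose * z.2) * e η z.1 ∂(volume.prod volume) := by
              rw [← integral_const_mul]
              refine integral_congr_ae (Eventually.of_forall fun z => ?_)
              simp only
              ring
          _ = _ := by
              rw [integral_prod_symm _ h1]
              simp only [e]
              rw [integral_cexp_mul_frame]
              simp only [Gh, Vh]
              rw [matFourier_scaled v ha, matFourier_scaled u ha, Matrix.smul_mul]
              ring

end FixedScale

/-! ### The truncated reproducing integral as a Fourier multiplier -/

section Truncation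

variable {n m k : ℕ} {u v : Mat (n - k) m → ℂ} {f : Mat n m → ℂ}

/-- The invariant measure of the cone restricted to a bounded interval. -/
noncomputable abbrev truncMeasure (m : ℕ) (ε ρ : ℝ) : Measure (Mat m m) :=
  (coneInvMeasure m).restrict (coneInterval (ε • (1 : Mat m m)) (ρ • (1 : Mat m m)))

theorem isFiniteMeasure_truncMeasure {ε ρ : ℝ} (hε : 0 < ε) :
    IsFiniteMeasure (truncMeasure m ε ρ) :=
  ⟨by rw [Measure.restrict_apply_univ]; exact coneInvMeasure_coneInterval_lt_top hε⟩

theorem ae_truncMeasure_posDef {ε ρ : ℝ} : ∀ᵐ a ∂(truncMeasure m ε ρ), a.PosDef :=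
  ae_restrict_of_ae ae_coneInvMeasure_posDef

theorem measurable_truncKernel (hu : Measurable u) (hv : Measurable v) (hf : Measurable f) :
    Measurable fun z : Mat n m × (Mat m m × (Stiefel n (n - k) × (Mat (n - k) m × Mat n m))) =>
      ridgeletKernel u v f z.2.1 z.1 z.2.2 / ((z.2.1.det ^ ((k : ℝ) / 2) : ℝ) : ℂ) := by
  have h1 : Measurable fun z : Mat n m × (Mat m m × (Stiefel n (n - k) ×
      (Mat (n - k) m × Mat n m))) => z.2.1 := measurable_fst.comp measurable_snd
  exact (measurable_ridgeletKernel hu hv hf h1 measurable_fst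
    (measurable_snd.comp measurable_snd)).div
    (Complex.measurable_ofReal.comp ((measurable_det.comp h1).pow_const _))

/-- The fixed-scale bound is uniform in `a`, while `|a|^{-k/2}` is bounded and the invariant measure
finite on the interval. This one statement supplies the Fubini exchanges for the truncated integral.
-/
theorem integrable_truncKernel (hkn : k ≤ n) (hu : Measurable u) (hv : Measurable v)
    (hf : Measurable f) (hui : Integrable u) (hvi : Integrable v) (hfi : Integrable f)
    {ε : ℝ} (hε : 0 < ε) (ρ : ℝ) {R : ℝ} (hR : 0 ≤ R) :
    Integrable (fun z : Mat n m × (Mat m m × (Stiefel n (n - k) × (Mat (n - k) m × Mat n m))) =>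
      ridgeletKernel u v f z.2.1 z.1 z.2.2 / ((z.2.1.det ^ ((k : ℝ) / 2) : ℝ) : ℂ))
      ((volume.restrict (frobBall n m R)).prod
        ((truncMeasure m ε ρ).prod (kernelMeasure n m k))) := by
  have hfin := isFiniteMeasure_truncMeasure (m := m) (ρ := ρ) hε
  have hm := measurable_truncKernel (k := k) hu hv hf
  refine ⟨hm.aestronglyMeasurable, ?_⟩
  obtain ⟨C, hC⟩ := exists_det_rpow_le hε m ρ (-((k : ℝ) / 2))
  set D := (volume {z : Mat k m | ∀ i j, |z i j| ≤ R} * ∫⁻ z, ‖v z‖ₑ) *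
        ((∫⁻ y, ‖f y‖ₑ) * ∫⁻ z, ‖u z‖ₑ)
  have hD : D < ∞ := ENNReal.mul_lt_top (ENNReal.mul_lt_top
    (isCompact_setOf_abs_le R).measure_lt_top hvi.2) (ENNReal.mul_lt_top hfi.2 hui.2)
  have hsec (x : Mat n m) : Measurable fun z : Mat m m × (Stiefel n (n - k) ×
      (Mat (n - k) m × Mat n m)) => ‖ridgeletKernel u v f z.1 x z.2 /
        ((z.1.det ^ ((k : ℝ) / 2) : ℝ) : ℂ)‖ₑ := (hm.comp measurable_prodMk_left).enorm
  have hswap : Measurable fun z : Mat n m × Mat m m => ∫⁻ q, ‖ridgeletKernel u v f z.2 z.1 q /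
        ((z.2.det ^ ((k : ℝ) / 2) : ℝ) : ℂ)‖ₑ ∂(kernelMeasure n m k) := by
    have h1 : Measurable fun z : (Mat n m × Mat m m) × (Stiefel n (n - k) ×
        (Mat (n - k) m × Mat n m)) => (z.1.1, (z.1.2, z.2)) := by fun_prop
    exact (hm.comp h1).enorm.lintegral_prod_right'
  rw [HasFiniteIntegral, lintegral_prod _ hm.enorm.aemeasurable]
  calc _ = ∫⁻ x in frobBall n m R, (∫⁻ a, (∫⁻ q, ‖ridgeletKernel u v f a x q /
          ((a.det ^ ((k : ℝ) / 2) : ℝ) : ℂ)‖ₑ ∂(kernelMeasure n m k)) ∂(truncMeasure m ε ρ)) := by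
        refine lintegral_congr fun x => ?_
        exact lintegral_prod _ (hsec x).aemeasurable
    _ = ∫⁻ a, (∫⁻ x in frobBall n m R, (∫⁻ q, ‖ridgeletKernel u v f a x q /
          ((a.det ^ ((k : ℝ) / 2) : ℝ) : ℂ)‖ₑ ∂(kernelMeasure n m k))) ∂(truncMeasure m ε ρ) :=
        lintegral_lintegral_swap hswap.aemeasurable
    _ ≤ ∫⁻ _, ENNReal.ofReal C * D ∂(truncMeasure m ε ρ) := by
        refine setLIntegral_mono_ae measurable_const.aemeasurable
          (ae_coneInvMeasure_posDef.mono fun a ha haI => ?_)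
        have h1 : ‖((a.det ^ ((k : ℝ) / 2) : ℝ) : ℂ)⁻¹‖ₑ ≤ ENNReal.ofReal C := by
          rw [← ofReal_norm, norm_inv, Complex.norm_real,
            Real.norm_of_nonneg (Real.rpow_nonneg ha.det_pos.le _), ← Real.rpow_neg ha.det_pos.le]
          exact ENNReal.ofReal_le_ofReal (hC a haI)
        simp only [div_eq_mul_inv (_ : ℂ), enorm_mul]
        calc _ = ∫⁻ x in frobBall n m R, ‖((a.det ^ ((k : ℝ) / 2) : ℝ) : ℂ)⁻¹‖ₑ *
              ∫⁻ q, ‖ridgeletKernel u v f a x q‖ₑ ∂(kernelMeasure n m k) := by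
              refine lintegral_congr fun x => ?_
              rw [lintegral_mul_const' _ _ enorm_ne_top, mul_comm]
          _ ≤ _ := by
              rw [lintegral_const_mul' _ _ enorm_ne_top]
              exact mul_le_mul' h1 (setLIntegral_ridgeletKernel_le hkn hu hv hf hR ha)
    _ < ∞ := by
        rw [lintegral_const]
        exact ENNReal.mul_lt_top (ENNReal.mul_lt_top ENNReal.ofReal_lt_top hD)
          (measure_lt_top _ _)

theorem ae_integrable_truncKernel (hkn : k ≤ n) (hu : Measurable u) (hv : Measurable v)
    (hf : Measurable f) (hui : Integrable u) (hvi : Integrable v) (hfi : Integrable f)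
    {ε : ℝ} (hε : 0 < ε) (ρ : ℝ) :
    ∀ᵐ x : Mat n m, Integrable (fun z : Mat m m × (Stiefel n (n - k) ×
      (Mat (n - k) m × Mat n m)) =>
        ridgeletKernel u v f z.1 x z.2 / ((z.1.det ^ ((k : ℝ) / 2) : ℝ) : ℂ))
      ((truncMeasure m ε ρ).prod (kernelMeasure n m k)) := by
  have hfin := isFiniteMeasure_truncMeasure (m := m) (ρ := ρ) hε
  -- Integrability is known only over balls in `x`, so the almost everywhere statement is collected
  -- over balls of integer radius.
  have h (N : ℕ) := (integrable_truncKernel hkn hu hv hf hui hvi hfi hε ρ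
    (Nat.cast_nonneg N)).prod_right_ae
  have h2 : ∀ N : ℕ, ∀ᵐ x : Mat n m, x ∈ frobBall n m N → Integrable (fun z : Mat m m ×
      (Stiefel n (n - k) × (Mat (n - k) m × Mat n m)) =>
        ridgeletKernel u v f z.1 x z.2 / ((z.1.det ^ ((k : ℝ) / 2) : ℝ) : ℂ))
      ((truncMeasure m ε ρ).prod (kernelMeasure n m k)) := fun N =>
    (ae_restrict_iff' (isClosed_frobBall _).measurableSet).1 (h N)
  filter_upwards [ae_all_iff.2 h2] with x hx
  obtain ⟨R, hR, hsub⟩ := exists_subset_frobBall (isCompact_singleton (x := x))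
  obtain ⟨N, hN⟩ := exists_nat_ge R
  refine hx N ?_
  have h3 : (x.transpose * x).trace ≤ R ^ 2 := hsub rfl
  exact h3.trans (pow_le_pow_left₀ hR hN 2)

/-- Fubini for the integrand of the truncated reproducing integral. -/
theorem ae_reproIntegrand_eq {μ : Measure (Mat m m)} [SFinite μ] {x : Mat n m}
    (h : Integrable (fun z : Mat m m × (Stiefel n (n - k) × (Mat (n - k) m × Mat n m)) =>
        ridgeletKernel u v f z.1 x z.2 / ((z.1.det ^ ((k : ℝ) / 2) : ℝ) : ℂ))
      (μ.prod (kernelMeasure n m k))) (hμ : ∀ᵐ a ∂μ, a.PosDef) :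
    (fun a => ∫ q, ridgeletKernel u v f a x q / ((a.det ^ ((k : ℝ) / 2) : ℝ) : ℂ)
      ∂(kernelMeasure n m k)) =ᵐ[μ] reproIntegrand u v f x := by
  filter_upwards [h.prod_right_ae, hμ] with a ha hpos
  have hd : ((a.det ^ ((k : ℝ) / 2) : ℝ) : ℂ) ≠ 0 :=
    Complex.ofReal_ne_zero.2 (Real.rpow_pos_of_pos hpos.det_pos _).ne'
  have ha' : Integrable (ridgeletKernel u v f a x) (kernelMeasure n m k) := by
    refine (ha.mul_const ((a.det ^ ((k : ℝ) / 2) : ℝ) : ℂ)).congr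
      (Eventually.of_forall fun q => ?_)
    exact div_mul_cancel₀ _ hd
  rw [integral_div, reproIntegrand]
  congr 1
  rw [integral_prod _ ha', dualRidgelet]
  refine integral_congr_ae ?_
  filter_upwards [ha'.prod_right_ae] with ξ hξ
  rw [integral_prod _ hξ]
  refine integral_congr_ae (Eventually.of_forall fun t => ?_)
  simp only [ridgeletKernel, ridgelet]
  rw [integral_mul_const]

theorem ae_integrableOn_reproIntegrand (hkn : k ≤ n) (hu : Measurable u) (hv : Measurable v)
    (hf : Measurable f) (hui : Integrable u) (hvi : Integrable v) (hfi : Integrable f)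
    {ε : ℝ} (hε : 0 < ε) (ρ : ℝ) :
    ∀ᵐ x : Mat n m, IntegrableOn (reproIntegrand u v f x)
      (coneInterval (ε • (1 : Mat m m)) (ρ • (1 : Mat m m))) (coneInvMeasure m) := by
  filter_upwards [ae_integrable_truncKernel hkn hu hv hf hui hvi hfi hε ρ] with x hx
  exact hx.integral_prod_left.congr (ae_reproIntegrand_eq hx ae_truncMeasure_posDef)

theorem ae_reproTrunc_eq (hkn : k ≤ n) (hu : Measurable u) (hv : Measurable v)
    (hf : Measurable f) (hui : Integrable u) (hvi : Integrable v) (hfi : Integrable f)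
    {ε : ℝ} (hε : 0 < ε) (ρ : ℝ) :
    ∀ᵐ x : Mat n m, reproTrunc u v f ε ρ x = ∫ z, ridgeletKernel u v f z.1 x z.2 /
      ((z.1.det ^ ((k : ℝ) / 2) : ℝ) : ℂ) ∂((truncMeasure m ε ρ).prod (kernelMeasure n m k)) := by
  filter_upwards [ae_integrable_truncKernel hkn hu hv hf hui hvi hfi hε ρ] with x hx
  rw [integral_prod _ hx, reproTrunc]
  exact (integral_congr_ae (ae_reproIntegrand_eq hx ae_truncMeasure_posDef)).symm

theorem integrableOn_reproTrunc (hkn : k ≤ n) (hu : Measurable u) (hv : Measurable v)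
    (hf : Measurable f) (hui : Integrable u) (hvi : Integrable v) (hfi : Integrable f)
    {ε : ℝ} (hε : 0 < ε) (ρ : ℝ) {R : ℝ} (hR : 0 ≤ R) :
    IntegrableOn (reproTrunc u v f ε ρ) (frobBall n m R) := by
  have hfin := isFiniteMeasure_truncMeasure (m := m) (ρ := ρ) hε
  refine (integrable_truncKernel hkn hu hv hf hui hvi hfi hε ρ hR).integral_prod_left.congr ?_
  filter_upwards [ae_restrict_of_ae (ae_reproTrunc_eq hkn hu hv hf hui hvi hfi hε ρ)] with x hx
  exact hx.symm

theorem locallyIntegrable_reproTrunc (hkn : k ≤ n) (hu : Measurable u) (hv : Measurable v)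
    (hf : Measurable f) (hui : Integrable u) (hvi : Integrable v) (hfi : Integrable f)
    {ε : ℝ} (hε : 0 < ε) (ρ : ℝ) : LocallyIntegrable (reproTrunc u v f ε ρ) := by
  rw [locallyIntegrable_iff]
  intro K hK
  obtain ⟨R, hR, hsub⟩ := exists_subset_frobBall hK
  exact (integrableOn_reproTrunc hkn hu hv hf hui hvi hfi hε ρ hR).mono_set hsub

/-- The truncated reproducing integral against a test function, on the Fourier side. -/
theorem integral_test_smul_reproTrunc (hkn : k ≤ n) (hu : Measurable u) (hv : Measurable v)
    (hf : Measurable f) (hui : Integrable u) (hvi : Integrable v) (hfi : Integrable f)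
    {ε : ℝ} (hε : 0 < ε) (ρ : ℝ) {g : Mat n m → ℝ} (hg : IsTest g) :
    ∫ x, g x • reproTrunc u v f ε ρ x =
      ∫ a, ((a.det ^ (-(k : ℝ) / 2) : ℝ) : ℂ) * (∫ ξ : Stiefel n (n - k), (∫ η : Mat (n - k) m,
        matFourier (fun x => (g x : ℂ)) ((2 * Real.pi) • (ξ.1 * η)) *
          (matFourier u (-(2 * Real.pi) • (η * matSqrt a)) *
            matFourier v (-(2 * Real.pi) • (η * matSqrt a))) *
          matFourier f (-(2 * Real.pi) • (ξ.1 * η))) ∂(stiefelMeasure n k))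
        ∂(truncMeasure m ε ρ) := by
  have hfin := isFiniteMeasure_truncMeasure (m := m) (ρ := ρ) hε
  obtain ⟨R, hR, hsub⟩ := exists_subset_frobBall hg.2
  obtain ⟨B, hB⟩ := hg.continuous.bounded_above_of_compact_support hg.2
  have hzero : ∀ x, x ∉ frobBall n m R → g x = 0 := by
    intro x hx
    by_contra hne
    exact hx (hsub (subset_tsupport g hne))
  have hI : Integrable (fun z : Mat n m × (Mat m m × (Stiefel n (n - k) ×
      (Mat (n - k) m × Mat n m))) => (g z.1 : ℂ) * (ridgeletKernel u v f z.2.1 z.1 z.2.2 /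
        ((z.2.1.det ^ ((k : ℝ) / 2) : ℝ) : ℂ)))
      ((volume.restrict (frobBall n m R)).prod
        ((truncMeasure m ε ρ).prod (kernelMeasure n m k))) := by
    refine (integrable_truncKernel hkn hu hv hf hui hvi hfi hε ρ hR).bdd_mul (c := B)
      (f := fun z => (g z.1 : ℂ)) ?_ (Eventually.of_forall fun z => ?_)
    · exact (Complex.continuous_ofReal.comp
        (hg.continuous.comp continuous_fst)).measurable.aestronglyMeasurable
    · rw [Complex.norm_real]
      exact hB _
  calc ∫ x, g x • reproTrunc u v f ε ρ x
      = ∫ x in frobBall n m R, g x • reproTrunc u v f ε ρ x :=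
        (setIntegral_eq_integral_of_forall_compl_eq_zero fun x hx => by
          rw [hzero x hx, zero_smul]).symm
    _ = ∫ x in frobBall n m R, (∫ z, (g x : ℂ) * (ridgeletKernel u v f z.1 x z.2 /
          ((z.1.det ^ ((k : ℝ) / 2) : ℝ) : ℂ))
          ∂((truncMeasure m ε ρ).prod (kernelMeasure n m k))) := by
        refine integral_congr_ae ?_
        filter_upwards [ae_restrict_of_ae (ae_reproTrunc_eq hkn hu hv hf hui hvi hfi hε ρ)]
          with x hx
        rw [hx, integral_const_mul, Complex.real_smul]
    _ = ∫ z, (∫ x in frobBall n m R, (g x : ℂ) * (ridgeletKernel u v f z.1 x z.2 /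
          ((z.1.det ^ ((k : ℝ) / 2) : ℝ) : ℂ)))
          ∂((truncMeasure m ε ρ).prod (kernelMeasure n m k)) := integral_integral_swap hI
    _ = ∫ a, (∫ q, (∫ x in frobBall n m R, (g x : ℂ) * (ridgeletKernel u v f a x q /
          ((a.det ^ ((k : ℝ) / 2) : ℝ) : ℂ))) ∂(kernelMeasure n m k)) ∂(truncMeasure m ε ρ) :=
        integral_prod _ hI.integral_prod_right
    _ = _ := by
        refine integral_congr_ae ?_
        filter_upwards [ae_truncMeasure_posDef] with a ha
        rw [← integral_kernelMeasure_eq hkn hu hv hf hui hvi hfi hg ha, ← integral_const_mul]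
        refine integral_congr_ae (Eventually.of_forall fun q => ?_)
        simp only
        rw [← integral_const_mul, setIntegral_eq_integral_of_forall_compl_eq_zero]
        · refine integral_congr_ae (Eventually.of_forall fun x => ?_)
          simp only
          rw [neg_div, Real.rpow_neg ha.det_pos.le, div_eq_mul_inv, Complex.ofReal_inv]
          ring
        · intro x hx
          rw [hzero x hx, Complex.ofReal_zero, zero_mul]

end Truncation

/-! ### Identification of the multiplier and convergence -/

section Reproducing

variable {n m k : ℕ}

theorem integrable_fourier_stiefel_mul {g : Mat n m → ℝ} (hg : IsTest g) :
    Integrable (fun q : Stiefel n (n - k) × Mat (n - k) m =>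
      matFourier (fun x => (g x : ℂ)) ((2 * Real.pi) • (q.1.1 * q.2)))
      ((stiefelMeasure n k).prod volume) := by
  -- The decay depends only on `‖ξη‖ = ‖η‖`, so it is uniform in the frame, and the frames carry a
  -- probability measure.
  obtain ⟨C, hC⟩ := hg.exists_decay ((n - k) * m + 1)
  have h1 : Integrable (fun q : Stiefel n (n - k) × Mat (n - k) m => (1 : ℝ) *
      (C * (1 + ‖matE (n - k) m q.2‖) ^ (-(((n - k) * m + 1 : ℕ) : ℝ))))
      ((stiefelMeasure n k).prod volume) :=
    (integrable_const (1 : ℝ)).mul_prod ((integrable_decay (n - k) m).const_mul C)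
  refine h1.mono' ?_ (Eventually.of_forall fun q => ?_)
  · have h2 : Measurable fun q : Stiefel n (n - k) × Mat (n - k) m => q.1.1 * q.2 :=
      measurable_stiefel_mul measurable_fst measurable_snd
    exact (hg.continuous_fourier.measurable.comp h2).aestronglyMeasurable
  · have := hC (q.1.1 * q.2)
    rwa [norm_matE_frame_mul q.1.2, ← one_mul (C * _)] at this

theorem polarRatio_pos (hm : m ≤ n - k) : 0 < polarConst (n - k) m / polarConst n m :=
  div_pos (polarConst_pos hm) (polarConst_pos (hm.trans (Nat.sub_le n k)))

theorem measurable_gram_density (n k m : ℕ) : Measurable fun Y : Mat n m =>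
    ENNReal.ofReal ((Y.transpose * Y).det ^ ((((n - k : ℕ) : ℝ) - n) / 2)) :=
  (measurable_ofReal_det_rpow _).comp measurable_gram

theorem toReal_gram_density (Y : Mat n m) (s : ℝ) :
    (ENNReal.ofReal ((Y.transpose * Y).det ^ s)).toReal = (Y.transpose * Y).det ^ s :=
  ENNReal.toReal_ofReal (Real.rpow_nonneg (posSemidef_transpose_mul_self Y).det_nonneg _)

/-- For `k ≤ n` the weight is `|Y'Y|^{-k/2}`, which for `k > 0` is unbounded near matrices of
deficient rank. Integrability against it is read off from the variables `(ξ, η)`, where no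
singularity is visible. -/
theorem integrable_of_stiefel_mul (hm : m ≤ n - k) {H : Mat n m → ℂ} (hH : Measurable H)
    (hi : Integrable (fun q : Stiefel n (n - k) × Mat (n - k) m => H (q.1.1 * q.2))
      ((stiefelMeasure n k).prod volume)) :
    Integrable fun Y : Mat n m =>
      (((Y.transpose * Y).det ^ ((((n - k : ℕ) : ℝ) - n) / 2) : ℝ) : ℂ) * H Y := by
  have h2 : Measurable fun q : Stiefel n (n - k) × Mat (n - k) m => q.1.1 * q.2 :=
    measurable_stiefel_mul measurable_fst measurable_snd
  have h3 := (integrable_map_measure (f := fun q : Stiefel n (n - k) × Mat (n - k) m =>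
    q.1.1 * q.2) (g := H) hH.aestronglyMeasurable h2.aemeasurable).2 hi
  rw [map_stiefel_mul hm, integrable_smul_measure
    (by simpa using polarRatio_pos hm) ENNReal.ofReal_ne_top,
    integrable_withDensity_iff_integrable_smul₀' (measurable_gram_density n k m).aemeasurable
      (Eventually.of_forall fun _ => ENNReal.ofReal_lt_top)] at h3
  refine h3.congr (Eventually.of_forall fun Y => ?_)
  simp only
  rw [toReal_gram_density, Complex.real_smul]

theorem integral_stiefel_mul (hm : m ≤ n - k) {H : Mat n m → ℂ} (hH : Measurable H) :
    ∫ q : Stiefel n (n - k) × Mat (n - k) m, H (q.1.1 * q.2)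
      ∂((stiefelMeasure n k).prod volume) =
    ((polarConst (n - k) m / polarConst n m : ℝ) : ℂ) * ∫ Y : Mat n m,
      (((Y.transpose * Y).det ^ ((((n - k : ℕ) : ℝ) - n) / 2) : ℝ) : ℂ) * H Y := by
  have h2 : Measurable fun q : Stiefel n (n - k) × Mat (n - k) m => q.1.1 * q.2 :=
    measurable_stiefel_mul measurable_fst measurable_snd
  have h3 := integral_map (μ := (stiefelMeasure n k).prod volume) (φ := fun q : Stiefel n (n - k) × Mat (n - k) m =>
    q.1.1 * q.2) (f := H) h2.aemeasurable hH.aestronglyMeasurable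
  rw [← h3, map_stiefel_mul hm, integral_smul_measure, ENNReal.toReal_ofReal (polarRatio_pos hm).le,
    integral_withDensity_eq_integral_toReal_smul₀ (measurable_gram_density n k m).aemeasurable
      (Eventually.of_forall fun _ => ENNReal.ofReal_lt_top), Complex.real_smul]
  congr 1
  refine integral_congr_ae (Eventually.of_forall fun Y => ?_)
  simp only
  rw [toReal_gram_density, Complex.real_smul]

/-- The Fourier multiplier of the truncated reproducing integral. -/
noncomputable def reproMultiplier (n k m : ℕ) (G : Mat (n - k) m → ℂ) (ε ρ : ℝ) :
    Mat n m → ℂ :=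
  {Y : Mat n m | (Y.transpose * Y).PosDef}.indicator fun Y =>
    truncConst n k m G (ε • ((2 * Real.pi) ^ 2 • (Y.transpose * Y)))
      (ρ • ((2 * Real.pi) ^ 2 • (Y.transpose * Y)))

theorem posDef_smul {r : Mat m m} (hr : r.PosDef) {c : ℝ} (hc : 0 < c) : (c • r).PosDef :=
  hr.smul hc

/-- The factor `(2π)^{km}` of the wavelet constant compensates exactly for evaluating the profile at
`(2π)² Y'Y`. -/
theorem two_pi_pow_mul_det_rpow {r : Mat m m} (hr : r.PosDef) (hkn : k ≤ n) :
    (2 * Real.pi) ^ (k * m) * ((2 * Real.pi) ^ 2 • r).det ^ (-(k : ℝ) / 2) =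
      r.det ^ ((((n - k : ℕ) : ℝ) - n) / 2) := by
  have h2 : (0 : ℝ) < 2 * Real.pi := by positivity
  have e : (((n - k : ℕ) : ℝ) - n) / 2 = -(k : ℝ) / 2 := by
    rw [Nat.cast_sub hkn]; ring
  rw [e, Matrix.det_smul, Fintype.card_fin, Real.mul_rpow (by positivity) hr.det_pos.le,
    ← mul_assoc]
  have : (((2 * Real.pi) ^ 2) ^ m) ^ (-(k : ℝ) / 2) = ((2 * Real.pi) ^ (k * m))⁻¹ := by
    rw [← pow_mul, ← Real.rpow_natCast, ← Real.rpow_mul h2.le, ← Real.rpow_natCast,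
      ← Real.rpow_neg h2.le]
    congr 1
    push_cast
    ring
  rw [this, mul_inv_cancel₀ (by positivity), one_mul]

theorem reproMultiplier_eq (hm : m ≤ n - k) (hkn : k ≤ n) {G : Mat (n - k) m → ℂ}
    {w : Mat m m → ℂ} (hw : Measurable w) (hG : ∀ y, G y = w (y.transpose * y))
    (hsym : IsSymmetricOnCone w) {Y : Mat n m} (hY : (Y.transpose * Y).PosDef) (ε ρ : ℝ) :
    reproMultiplier n k m G ε ρ Y = ((polarConst (n - k) m / polarConst n m : ℝ) : ℂ) *
      ((((Y.transpose * Y).det ^ ((((n - k : ℕ) : ℝ) - n) / 2) : ℝ) : ℂ) *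
        ∫ a, ((a.det ^ (-(k : ℝ) / 2) : ℝ) : ℂ) *
          w (matSqrt a * ((2 * Real.pi) ^ 2 • (Y.transpose * Y)) * matSqrt a)
          ∂(truncMeasure m ε ρ)) := by
  have h2 : (0 : ℝ) < (2 * Real.pi) ^ 2 := by positivity
  rw [reproMultiplier, Set.indicator_of_mem (by exact hY),
    truncConst_smul_eq hm hkn hw hG hsym (posDef_smul hY h2),
    ← two_pi_pow_mul_det_rpow hY hkn, ← mul_assoc, ← Complex.ofReal_mul]
  congr 2
  ring

theorem measurable_matSqrt_mul_mul {α : Type*} [MeasurableSpace α] {a r : α → Mat m m}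
    (ha : Measurable a) (hr : Measurable r) :
    Measurable fun b => matSqrt (a b) * r b * matSqrt (a b) :=
  measurable_matrix_mul (measurable_matrix_mul (measurable_matSqrt.comp ha) hr)
    (measurable_matSqrt.comp ha)

theorem measurable_scaled_gram {α : Type*} [MeasurableSpace α] {Y : α → Mat n m}
    (hY : Measurable Y) :
    Measurable fun b => (2 * Real.pi) ^ 2 • ((Y b).transpose * Y b) := by
  have h : Continuous fun Y : Mat n m => (2 * Real.pi) ^ 2 • (Y.transpose * Y) :=
    (continuous_const_smul _).comp continuous_gram
  exact h.measurable.comp hY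

/-- By definition the symbol is an integral over a domain moving with `Y`. `reproMultiplier_eq`
rewrites it as a parameter integral over a fixed interval, whose measurability is standard. -/
theorem measurable_reproMultiplier (hm : m ≤ n - k) (hkn : k ≤ n) {G : Mat (n - k) m → ℂ}
    {w : Mat m m → ℂ} (hw : Measurable w) (hG : ∀ y, G y = w (y.transpose * y))
    (hsym : IsSymmetricOnCone w) {ε : ℝ} (hε : 0 < ε) (ρ : ℝ) :
    Measurable (reproMultiplier n k m G ε ρ) := by
  have hfin := isFiniteMeasure_truncMeasure (m := m) (ρ := ρ) hε
  have hset : MeasurableSet {Y : Mat n m | (Y.transpose * Y).PosDef} :=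
    measurableSet_setOf_posDef.preimage measurable_gram
  have h1 : Measurable fun Y : Mat n m => ((polarConst (n - k) m / polarConst n m : ℝ) : ℂ) *
      ((((Y.transpose * Y).det ^ ((((n - k : ℕ) : ℝ) - n) / 2) : ℝ) : ℂ) *
        ∫ a, ((a.det ^ (-(k : ℝ) / 2) : ℝ) : ℂ) *
          w (matSqrt a * ((2 * Real.pi) ^ 2 • (Y.transpose * Y)) * matSqrt a)
          ∂(truncMeasure m ε ρ)) := by
    have h2 : Measurable fun z : Mat n m × Mat m m => ((z.2.det ^ (-(k : ℝ) / 2) : ℝ) : ℂ) *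
        w (matSqrt z.2 * ((2 * Real.pi) ^ 2 • (z.1.transpose * z.1)) * matSqrt z.2) :=
      (Complex.measurable_ofReal.comp ((measurable_det.comp measurable_snd).pow_const _)).mul
        (hw.comp (measurable_matSqrt_mul_mul measurable_snd
          (measurable_scaled_gram measurable_fst)))
    exact measurable_const.mul ((Complex.measurable_ofReal.comp
      ((measurable_det.comp measurable_gram).pow_const _)).mul
      h2.stronglyMeasurable.integral_prod_right'.measurable)
  have h3 : reproMultiplier n k m G ε ρ =
      {Y : Mat n m | (Y.transpose * Y).PosDef}.indicator fun Y =>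
        ((polarConst (n - k) m / polarConst n m : ℝ) : ℂ) *
      ((((Y.transpose * Y).det ^ ((((n - k : ℕ) : ℝ) - n) / 2) : ℝ) : ℂ) *
        ∫ a, ((a.det ^ (-(k : ℝ) / 2) : ℝ) : ℂ) *
          w (matSqrt a * ((2 * Real.pi) ^ 2 • (Y.transpose * Y)) * matSqrt a)
          ∂(truncMeasure m ε ρ)) := by
    ext Y
    by_cases hY : (Y.transpose * Y).PosDef
    · rw [reproMultiplier_eq hm hkn hw hG hsym hY, Set.indicator_of_mem (by exact hY)]
    · rw [reproMultiplier, Set.indicator_of_notMem (by exact hY),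
        Set.indicator_of_notMem (by exact hY)]
  rw [h3]
  exact h1.indicator hset

/-- Admissibility controls truncations only at positive definite `r`; the indicator in the symbol
extends the bound to every `Y`. -/
theorem norm_reproMultiplier_le {G : Mat (n - k) m → ℂ} {C : ℝ}
    (hC : ∀ r : Mat m m, r.PosDef → ∀ ε ρ : ℝ, 0 < ε → ε < ρ →
      ‖truncConst n k m G (ε • r) (ρ • r)‖ ≤ C) {ε ρ : ℝ} (hε : 0 < ε) (hρ : ε < ρ)
    (Y : Mat n m) : ‖reproMultiplier n k m G ε ρ Y‖ ≤ |C| := by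
  by_cases hY : (Y.transpose * Y).PosDef
  · rw [reproMultiplier, Set.indicator_of_mem (by exact hY)]
    exact (hC _ (posDef_smul hY (by positivity)) ε ρ hε hρ).trans (le_abs_self C)
  · rw [reproMultiplier, Set.indicator_of_notMem (by exact hY), norm_zero]
    exact abs_nonneg C

theorem gram_two_pi_smul_mul {p : ℕ} {ξ : Mat n p} (hξ : ξ.transpose * ξ = 1) (η : Mat p m)
    (a : Mat m m) :
    (-(2 * Real.pi) • (η * matSqrt a)).transpose * (-(2 * Real.pi) • (η * matSqrt a)) =
      matSqrt a * ((2 * Real.pi) ^ 2 • ((ξ * η).transpose * (ξ * η))) * matSqrt a := by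
  have h : (ξ * η).transpose * (ξ * η) = η.transpose * η := by
    rw [Matrix.transpose_mul, Matrix.mul_assoc, ← Matrix.mul_assoc _ ξ, hξ, Matrix.one_mul]
  rw [h, Matrix.transpose_smul, Matrix.smul_mul, Matrix.mul_smul, smul_smul,
    Matrix.transpose_mul, transpose_matSqrt, Matrix.mul_smul, Matrix.smul_mul, neg_mul_neg,
    ← pow_two]
  simp only [Matrix.mul_assoc]

variable {u v : Mat (n - k) m → ℂ} {f : Mat n m → ℂ}

/-- The truncated reproducing integral acts as the multiplier `reproMultiplier`. -/
theorem integral_test_smul_reproTrunc_eq (hm : m ≤ n - k) (hkn : k ≤ n) (hu : Measurable u)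
    (hv : Measurable v) (hf : Measurable f) (hui : Integrable u) (hvi : Integrable v)
    (hfi : Integrable f) {w : Mat m m → ℂ} (hw : Measurable w)
    (hG : ∀ y, matFourier u y * matFourier v y = w (y.transpose * y))
    (hsym : IsSymmetricOnCone w) {B : ℝ} (hB : ∀ r, ‖w r‖ ≤ B)
    {ε : ℝ} (hε : 0 < ε) (ρ : ℝ) {g : Mat n m → ℝ} (hg : IsTest g) :
    ∫ x, g x • reproTrunc u v f ε ρ x =
      ∫ Y : Mat n m, matFourier (fun x => (g x : ℂ)) ((2 * Real.pi) • Y) *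
        (reproMultiplier n k m (fun ζ => matFourier u ζ * matFourier v ζ) ε ρ Y *
          matFourier f (-(2 * Real.pi) • Y)) := by
  have hfin := isFiniteMeasure_truncMeasure (m := m) (ρ := ρ) hε
  set gh : Mat n m → ℂ := fun Y => matFourier (fun x => (g x : ℂ)) ((2 * Real.pi) • Y)
  set fh : Mat n m → ℂ := fun Y => matFourier f (-(2 * Real.pi) • Y)
  set W : Mat m m → Mat n m → ℂ := fun a Y =>
    w (matSqrt a * ((2 * Real.pi) ^ 2 • (Y.transpose * Y)) * matSqrt a)
  set d : Mat n m → ℂ := fun Y =>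
    (((Y.transpose * Y).det ^ ((((n - k : ℕ) : ℝ) - n) / 2) : ℝ) : ℂ)
  set D : Mat m m → ℂ := fun a => ((a.det ^ (-(k : ℝ) / 2) : ℝ) : ℂ)
  set κ : ℂ := ((polarConst (n - k) m / polarConst n m : ℝ) : ℂ)
  have hghm : Measurable gh := hg.continuous_fourier.measurable
  have hfhm : Measurable fh := ((continuous_matFourier hfi).comp (continuous_const_smul _)).measurable
  have hWm : Measurable fun z : Mat m m × Mat n m => W z.1 z.2 :=
    hw.comp (measurable_matSqrt_mul_mul measurable_fst (measurable_scaled_gram measurable_snd))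
  have hWm' (a : Mat m m) : Measurable (W a) :=
    hw.comp (measurable_matSqrt_mul_mul measurable_const (measurable_scaled_gram measurable_id))
  -- The value at `0` serves only to show that the bound is nonnegative.
  have hB' : 0 ≤ B := (norm_nonneg _).trans (hB 0)
  have hbd (a : Mat m m) (Y : Mat n m) : ‖W a Y * fh Y‖ ≤ B * ∫ x, ‖f x‖ := by
    rw [norm_mul]
    exact mul_le_mul (hB _) (norm_matFourier_le _ _) (norm_nonneg _) hB'
  have hstm : Measurable fun q : Stiefel n (n - k) × Mat (n - k) m => q.1.1 * q.2 :=
    measurable_stiefel_mul measurable_fst measurable_snd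
  have hst := integrable_fourier_stiefel_mul (k := k) hg
  have hdg : Integrable fun Y => d Y * gh Y := integrable_of_stiefel_mul hm hghm hst
  have hDm : Measurable D := Complex.measurable_ofReal.comp (measurable_det.pow_const _)
  have hDi : Integrable D (truncMeasure m ε ρ) := by
    obtain ⟨C, hC⟩ := exists_det_rpow_le hε m ρ (-(k : ℝ) / 2)
    refine Integrable.of_bound hDm.aestronglyMeasurable C ?_
    refine (ae_restrict_iff' (measurableSet_coneInterval _ _)).2 ?_
    filter_upwards [ae_coneInvMeasure_posDef] with a ha haI
    rw [Complex.norm_real, Real.norm_of_nonneg (Real.rpow_nonneg ha.det_pos.le _)]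
    exact hC a haI
  have hswap : Integrable (fun z : Mat m m × Mat n m => D z.1 * (d z.2 * gh z.2) *
      (W z.1 z.2 * fh z.2)) ((truncMeasure m ε ρ).prod volume) :=
    (hDi.mul_prod hdg).mul_bdd (c := B * ∫ x, ‖f x‖)
      (g := fun z : Mat m m × Mat n m => W z.1 z.2 * fh z.2)
      (hWm.mul (hfhm.comp measurable_snd)).aestronglyMeasurable
      (Eventually.of_forall fun z => hbd _ _)
  rw [integral_test_smul_reproTrunc hkn hu hv hf hui hvi hfi hε ρ hg]
  -- Pass from `(ξ, η)` to `Y = ξη`, bring the `a`-integral inside, and recognise the symbol; the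
  -- last step holds for `Y` of full rank, that is, almost everywhere.
  calc _ = ∫ a, D a * (κ * ∫ Y, d Y * (gh Y * (W a Y * fh Y))) ∂(truncMeasure m ε ρ) := by
        refine integral_congr_ae (Eventually.of_forall fun a => ?_)
        simp only
        have h1 : Integrable (fun q : Stiefel n (n - k) × Mat (n - k) m =>
            gh (q.1.1 * q.2) * (W a (q.1.1 * q.2) * fh (q.1.1 * q.2)))
            ((stiefelMeasure n k).prod volume) :=
          hst.mul_bdd (c := B * ∫ x, ‖f x‖)
            (g := fun q : Stiefel n (n - k) × Mat (n - k) m =>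
              W a (q.1.1 * q.2) * fh (q.1.1 * q.2))
            (((hWm' a).comp hstm).mul (hfhm.comp hstm)).aestronglyMeasurable
            (Eventually.of_forall fun q => hbd _ _)
        have h2 := integral_stiefel_mul hm (H := fun Y => gh Y * (W a Y * fh Y))
          (hghm.mul ((hWm' a).mul hfhm))
        rw [← h2, integral_prod _ h1]
        congr 1
        refine integral_congr_ae (Eventually.of_forall fun ξ =>
          integral_congr_ae (Eventually.of_forall fun η => ?_))
        simp only [W]
        rw [hG, gram_two_pi_smul_mul ξ.2, ← mul_assoc]
    _ = ∫ a, κ * (∫ Y, D a * (d Y * gh Y) * (W a Y * fh Y)) ∂(truncMeasure m ε ρ) := by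
        refine integral_congr_ae (Eventually.of_forall fun a => ?_)
        simp only
        rw [mul_left_comm, ← integral_const_mul (D a)]
        congr 1
        refine integral_congr_ae (Eventually.of_forall fun Y => ?_)
        simp only
        ring
    _ = κ * ∫ Y, (∫ a, D a * (d Y * gh Y) * (W a Y * fh Y) ∂(truncMeasure m ε ρ)) := by
        rw [integral_const_mul, integral_integral_swap hswap]
    _ = _ := by
        rw [← integral_const_mul]
        refine integral_congr_ae ?_
        filter_upwards [ae_posDef_gram (p := n) (m := m) (hm.trans (Nat.sub_le n k))] with Y hY
        rw [reproMultiplier_eq hm hkn hw hG hsym hY]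
        calc _ = κ * ((d Y * gh Y * fh Y) * ∫ a, D a * W a Y ∂(truncMeasure m ε ρ)) := by
              rw [← integral_const_mul (d Y * gh Y * fh Y)]
              congr 1
              refine integral_congr_ae (Eventually.of_forall fun a => ?_)
              simp only
              ring
          _ = _ := by
              simp only [κ, d, D, W, gh, fh]
              ring

theorem tendsto_smul_coneZero {r : Mat m m} (hr : r.PosDef) :
    Tendsto (fun ε : ℝ => ε • r) (𝓝[>] 0) (coneZero m) := by
  refine tendsto_nhdsWithin_iff.2 ⟨?_, ?_⟩
  · have h : Tendsto (fun ε : ℝ => ε • r) (𝓝 0) (𝓝 ((0 : ℝ) • r)) :=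
      (continuous_id.smul continuous_const).tendsto 0
    rw [zero_smul] at h
    exact h.mono_left nhdsWithin_le_nhds
  · filter_upwards [self_mem_nhdsWithin] with ε hε
    exact posDef_smul hr hε

theorem tendsto_smul_coneInfty {r : Mat m m} (hr : r.PosDef) :
    Tendsto (fun ρ : ℝ => ρ • r) atTop (coneInfty m) := by
  refine tendsto_iInf.2 fun c => tendsto_principal.2 ?_
  have hrt : r.transpose = r := by
    have := hr.isHermitian.eq
    rwa [Matrix.conjTranspose_eq_transpose_of_trivial] at this
  -- Write `ρr - cI = ρ (r - (c/ρ) I)` and use the openness of the cone at `r`.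
  have h1 : Tendsto (fun ρ : ℝ => r - (c / ρ) • (1 : Mat m m)) atTop (𝓝 r) := by
    have h2 : Tendsto (fun δ : ℝ => r - δ • (1 : Mat m m)) (𝓝 0) (𝓝 (r - (0 : ℝ) • 1)) :=
      (continuous_const.sub (continuous_id.smul continuous_const)).tendsto 0
    rw [zero_smul, sub_zero] at h2
    exact h2.comp (tendsto_const_nhds.div_atTop tendsto_id)
  filter_upwards [h1.eventually (eventually_posDef hr), eventually_gt_atTop 0] with ρ hρ hpos
  refine ⟨posDef_smul hr hpos, ?_⟩
  have h3 := posDef_smul (hρ (by rw [Matrix.transpose_sub, hrt, transpose_smul_one])) hpos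
  rwa [smul_sub, smul_smul, mul_div_cancel₀ _ hpos.ne'] at h3

/-- The limit defining `c` is over all `A → 0` and `B → ∞` in the cone. Along the rays `εr` and `ρr`
it gives the same constant for every `r`, which is why the limiting multiplier is a scalar. -/
theorem tendsto_reproMultiplier {G : Mat (n - k) m → ℂ} {c : ℂ}
    (hc : HasConeIntegral n k m G c) {Y : Mat n m} (hY : (Y.transpose * Y).PosDef) :
    Tendsto (fun p : ℝ × ℝ => reproMultiplier n k m G p.1 p.2 Y) (𝓝[>] (0 : ℝ) ×ˢ atTop)
      (𝓝 c) := by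
  have hr := posDef_smul hY (show (0 : ℝ) < (2 * Real.pi) ^ 2 by positivity)
  have h := Tendsto.comp hc (((tendsto_smul_coneZero hr).comp tendsto_fst).prodMk
    ((tendsto_smul_coneInfty hr).comp (tendsto_snd (f := 𝓝[>] (0 : ℝ)) (g := atTop))))
  refine h.congr fun p => ?_
  rw [reproMultiplier, Set.indicator_of_mem (by exact hY)]
  rfl

/-- Bounded multipliers converging almost everywhere converge strongly on `L²`. -/
theorem tendsto_eLpNorm_mul {α ι : Type*} [MeasurableSpace α] {μ : Measure α}
    {l : Filter ι} [l.IsCountablyGenerated] {F : ι → α → ℂ} {φ : α → ℂ} (hφ : MemLp φ 2 μ)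
    {C : ℝ} (hF : ∀ᶠ i in l, AEStronglyMeasurable (F i) μ ∧ ∀ x, ‖F i x‖ ≤ C)
    (hlim : ∀ᵐ x ∂μ, Tendsto (fun i => F i x) l (𝓝 0)) :
    Tendsto (fun i => eLpNorm (fun x => F i x * φ x) 2 μ) l (𝓝 0) := by
  have h1 : Tendsto (fun i => ∫⁻ x, ‖F i x * φ x‖ₑ ^ (2 : ℝ) ∂μ) l (𝓝 (∫⁻ _, 0 ∂μ)) := by
    refine tendsto_lintegral_filter_of_dominated_convergence'
      (fun x => (ENNReal.ofReal C * ‖φ x‖ₑ) ^ (2 : ℝ)) ?_ ?_ ?_ ?_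
    · filter_upwards [hF] with i hi
      exact (hi.1.mul hφ.aestronglyMeasurable).enorm.pow_const _
    · filter_upwards [hF] with i hi
      refine Eventually.of_forall fun x => ?_
      refine ENNReal.rpow_le_rpow ?_ (by norm_num)
      rw [enorm_mul]
      gcongr
      rw [← ofReal_norm]
      exact ENNReal.ofReal_le_ofReal (hi.2 x)
    · have h2 := lintegral_rpow_enorm_lt_top_of_eLpNorm_lt_top (by norm_num) (by norm_num) hφ.2
      simp only [ENNReal.toReal_ofNat] at h2
      simp only [ENNReal.mul_rpow_of_nonneg _ _ (show (0 : ℝ) ≤ 2 by norm_num)]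
      rw [lintegral_const_mul' _ _ (ENNReal.rpow_ne_top_of_nonneg (by norm_num)
        ENNReal.ofReal_ne_top)]
      exact ENNReal.mul_ne_top (ENNReal.rpow_ne_top_of_nonneg (by norm_num)
        ENNReal.ofReal_ne_top) h2.ne
    · filter_upwards [hlim] with x hx
      have h2 : Tendsto (fun i => ‖F i x * φ x‖ₑ) l (𝓝 0) := by
        have := (hx.mul_const (φ x)).enorm
        simpa using this
      have h3 := (ENNReal.continuous_rpow_const (y := 2)).tendsto 0 |>.comp h2
      simpa using! h3
  have h4 := (ENNReal.continuous_rpow_const (y := 1 / 2)).tendsto _ |>.comp h1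
  simp only [lintegral_const, zero_mul] at h4
  rw [ENNReal.zero_rpow_of_pos (by norm_num)] at h4
  refine h4.congr fun i => ?_
  rw [eLpNorm_eq_lintegral_rpow_enorm_toReal (by norm_num) (by norm_num)]
  simp

end Reproducing

/-! ### The reproducing formula -/

section Main

variable {n m k : ℕ} {u v : Mat (n - k) m → ℂ} {f : Mat n m → ℂ}

theorem matFourier_congr {p : ℕ} {w w' : Mat p m → ℂ} (h : w =ᵐ[volume] w') :
    matFourier w = matFourier w' := by
  ext y
  refine integral_congr_ae ?_
  filter_upwards [h] with x hx
  rw [hx]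

theorem reproTrunc_congr (hkn : k ≤ n) {u' v' : Mat (n - k) m → ℂ} {f' : Mat n m → ℂ}
    (hu : u =ᵐ[volume] u') (hv : v =ᵐ[volume] v') (hf : f =ᵐ[volume] f') (ε ρ : ℝ) :
    reproTrunc u v f ε ρ = reproTrunc u' v' f' ε ρ := by
  ext x
  refine integral_congr_ae ?_
  filter_upwards [ae_truncMeasure_posDef] with a ha
  exact reproIntegrand_congr hkn hu hv hf x ha

/-- The reproducing formula for measurable representatives. -/
theorem reproducing_of_measurable (hm : m ≤ n - k) (hkn : k ≤ n) (hu : Measurable u)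
    (hv : Measurable v) (hf : Measurable f) (hui : Integrable u) (hvi : Integrable v)
    (hfi : Integrable f) (hf2 : MemLp f 2) {w : Mat m m → ℂ} (hw : Measurable w)
    (hG : ∀ y, matFourier u y * matFourier v y = w (y.transpose * y))
    (hsym : IsSymmetricOnCone w) {B : ℝ} (hB : ∀ r, ‖w r‖ ≤ B) {C : ℝ}
    (hC : ∀ r : Mat m m, r.PosDef → ∀ ε ρ : ℝ, 0 < ε → ε < ρ →
      ‖truncConst n k m (fun ζ => matFourier u ζ * matFourier v ζ) (ε • r) (ρ • r)‖ ≤ C)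
    {c : ℂ} (hc : HasConeIntegral n k m (fun ζ => matFourier u ζ * matFourier v ζ) c) :
    (∀ ε ρ : ℝ, 0 < ε → ε < ρ → MemLp (reproTrunc u v f ε ρ) 2) ∧
      Tendsto (fun p : ℝ × ℝ =>
        eLpNorm (fun x => reproTrunc u v f p.1 p.2 x - c * f x) 2 volume)
        (𝓝[>] (0 : ℝ) ×ˢ atTop) (𝓝 0) := by
  set G : Mat (n - k) m → ℂ := fun ζ => matFourier u ζ * matFourier v ζ
  have hMm {ε : ℝ} (hε : 0 < ε) (ρ : ℝ) : Measurable (reproMultiplier n k m G ε ρ) :=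
    measurable_reproMultiplier hm hkn hw hG hsym hε ρ
  have key : ∀ ε ρ : ℝ, 0 < ε → ε < ρ → MemLp (reproTrunc u v f ε ρ) 2 ∧
      MemLp (fun Y : Mat n m => matFourier f (-(2 * Real.pi) • Y)) 2 ∧
      eLpNorm (fun x => reproTrunc u v f ε ρ x - c * f x) 2 volume =
        eLpNorm (fun Y : Mat n m => (reproMultiplier n k m G ε ρ Y - c) *
          matFourier f (-(2 * Real.pi) • Y)) 2 volume := by
    intro ε ρ hε hρ
    obtain ⟨T, hT, hφ, hpair, hnorm⟩ := exists_matrix_multiplier hfi hf2 (hMm hε ρ)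
      (fun Y => norm_reproMultiplier_le hC hε hρ Y)
    -- The truncated integral is so far only locally integrable. It equals the `L²` function `T`
    -- because both have the same pairings with test functions.
    have hTeq : reproTrunc u v f ε ρ =ᵐ[volume] T := by
      refine ae_eq_of_integral_isTest
        (locallyIntegrable_reproTrunc hkn hu hv hf hui hvi hfi hε ρ)
        (hT.locallyIntegrable (by norm_num)) fun g hg => ?_
      rw [hpair g hg]
      exact integral_test_smul_reproTrunc_eq hm hkn hu hv hf hui hvi hfi hw hG hsym hB hε ρ hg
    refine ⟨(memLp_congr_ae hTeq).2 hT, hφ, ?_⟩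
    rw [← hnorm c]
    refine eLpNorm_congr_ae ?_
    filter_upwards [hTeq] with x hx
    rw [hx]
  refine ⟨fun ε ρ hε hρ => (key ε ρ hε hρ).1, ?_⟩
  -- The product filter also contains pairs with `ε ≥ ρ`; eventually `ε < 1 < ρ`.
  have hev : ∀ᶠ p : ℝ × ℝ in 𝓝[>] (0 : ℝ) ×ˢ atTop, 0 < p.1 ∧ p.1 < p.2 := by
    have h1 : ∀ᶠ ε : ℝ in 𝓝[>] (0 : ℝ), 0 < ε ∧ ε < 1 := Ioo_mem_nhdsGT one_pos
    filter_upwards [h1.prod_mk (eventually_gt_atTop (1 : ℝ))] with p hp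
    exact ⟨hp.1.1, hp.1.2.trans hp.2⟩
  -- That the transform of `f` is in `L²` does not involve the truncation, so the pair `(1, 2)` is
  -- an arbitrary choice. The dominating constant `|C| + ‖c‖` bounds symbol minus limit.
  have hlim := tendsto_eLpNorm_mul (l := 𝓝[>] (0 : ℝ) ×ˢ atTop)
    (F := fun (p : ℝ × ℝ) Y => reproMultiplier n k m G p.1 p.2 Y - c) (C := |C| + ‖c‖)
    (key 1 2 one_pos one_lt_two).2.1 ?_ ?_
  · refine hlim.congr' ?_
    filter_upwards [hev] with p hp
    exact (key p.1 p.2 hp.1 hp.2).2.2.symm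
  · filter_upwards [hev] with p hp
    refine ⟨((hMm hp.1 p.2).sub_const c).aestronglyMeasurable, fun Y => ?_⟩
    exact (norm_sub_le _ _).trans
      (add_le_add_left (norm_reproMultiplier_le hC hp.1 hp.2 Y) _)
  · filter_upwards [ae_posDef_gram (p := n) (m := m) (hm.trans (Nat.sub_le n k))] with Y hY
    have := (tendsto_reproMultiplier hc hY).sub_const c
    rwa [sub_self] at this

end Main

end MatrixRidgelet

theorem mainTheorem5 {n k m : ℕ} (hm : 1 ≤ m) (hk : 1 ≤ k) (hkn : k ≤ n - m)
    (u v : MatrixRidgelet.Mat (n - k) m → ℂ)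
    (hu : Integrable u) (hv : Integrable v)
    (hur : MatrixRidgelet.IsRadial u) (hvr : MatrixRidgelet.IsRadial v)
    (hw : MatrixRidgelet.IsAdmissible n k m (MatrixRidgelet.conv u v)) :
    ∃ c : ℂ,
      MatrixRidgelet.HasConeIntegral n k m
        (fun ζ => MatrixRidgelet.matFourier u ζ * MatrixRidgelet.matFourier v ζ) c ∧
      ∀ f : MatrixRidgelet.Mat n m → ℂ, Integrable f → MemLp f 2 →
        (∀ ε ρ : ℝ, 0 < ε → ε < ρ →
          (∀ᵐ x : MatrixRidgelet.Mat n m,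
            IntegrableOn (MatrixRidgelet.reproIntegrand u v f x)
              (MatrixRidgelet.coneInterval (ε • (1 : MatrixRidgelet.Mat m m))
                (ρ • (1 : MatrixRidgelet.Mat m m)))
              (MatrixRidgelet.coneInvMeasure m)) ∧
          MemLp (MatrixRidgelet.reproTrunc u v f ε ρ) 2) ∧
        Tendsto (fun p : ℝ × ℝ =>
            eLpNorm (fun x => MatrixRidgelet.reproTrunc u v f p.1 p.2 x - c * f x) 2 volume)
          (𝓝[>] (0 : ℝ) ×ˢ atTop) (𝓝 0) := by
  open MatrixRidgelet in
  have hmp : m ≤ n - k := by omega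
  have hkn' : k ≤ n := by omega
  -- Through the convolution theorem, the admissibility of `u * v` becomes a set of statements about
  -- the product `û v̂`; in particular its wavelet constant is `c_{u,v}`.
  have hconv : matFourier (conv u v) = fun ζ => matFourier u ζ * matFourier v ζ := by
    ext ζ
    exact matFourier_conv hu hv ζ
  obtain ⟨c, hc⟩ := hw.converges
  obtain ⟨C, hC⟩ := hw.bounded
  obtain ⟨w, hwm, hsym, hG, hB⟩ := exists_measurable_profile hmp hw.integrable hw.symmetric
  simp only [hconv] at hc hC hG
  refine ⟨c, hc, fun f hf hf2 => ?_⟩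
  -- The functions `u`, `v`, `f` are only almost everywhere measurable. Measurable representatives
  -- have the same transforms and the same integrands `reproIntegrand` at positive definite scales.
  have hu' := hu.aestronglyMeasurable.ae_eq_mk
  have hv' := hv.aestronglyMeasurable.ae_eq_mk
  have hf' := hf.aestronglyMeasurable.ae_eq_mk
  have hum := hu.aestronglyMeasurable.stronglyMeasurable_mk.measurable
  have hvm := hv.aestronglyMeasurable.stronglyMeasurable_mk.measurable
  have hfm := hf.aestronglyMeasurable.stronglyMeasurable_mk.measurable
  rw [matFourier_congr hu', matFourier_congr hv'] at hc hC hG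
  obtain ⟨h1, h2⟩ := reproducing_of_measurable hmp hkn' hum hvm hfm (hu.congr hu')
    (hv.congr hv') (hf.congr hf') ((memLp_congr_ae hf').1 hf2) hwm hG hsym hB hC hc
  refine ⟨fun ε ρ hε hρ => ⟨?_, ?_⟩, ?_⟩
  · filter_upwards [ae_integrableOn_reproIntegrand hkn' hum hvm hfm (hu.congr hu')
      (hv.congr hv') (hf.congr hf') hε ρ] with x hx
    refine hx.congr ?_
    filter_upwards [ae_truncMeasure_posDef] with a ha
    exact (reproIntegrand_congr hkn' hu' hv' hf' x ha).symm
  · rw [reproTrunc_congr hkn' hu' hv' hf']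
    exact h1 ε ρ hε hρ
  · refine h2.congr fun p => eLpNorm_congr_ae ?_
    filter_upwards [hf'] with x hx
    rw [reproTrunc_congr hkn' hu' hv' hf', hx]
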